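/- All multigraphs are finite and loopless; parallel edges are allowed. For real $a>0$ and $b$, a multigraph $G$ is $(a,b)$-sparse if for every $A\subseteq V(G)$ with $|A|\ge 2$ the induced subgraph $G[A]$ has at most $a|A|+b$ edges. A forest is a multigraph without cycles, where two parallel edges form a cycle of length $2$. A $(D,F,F)$-coloring of $G$ is a partition $(M,F)$ of $V(G)$ into two (possibly empty) parts such that $G[M]$ is a forest of maximum degree at most $D$ and $G[F]$ is a forest. **Theorem.** Let $D\ge 1$ be an integer, and put $a_D=\frac{4D+3}{2(D+1)}$ and $b_D=\frac{1}{2(D+1)}$. 1. Every $(a_D,b_D)$-sparse multigraph has a $(D,F,F)$-coloring. The bound is exact, in the following sense. 2. For every $N$ there is a multigraph $H$ with $|V(H)|\ge N$ that has no $(D,F,F)$-coloring and satisfies $|E(H)|=\frac{(4D+3)|V(H)|+2}{2(D+1)}=a_D|V(H)|+2b_D$, while $|E(H[A])|\le a_D|A|+b_D$ for every proper subset $A\subsetneq V(H)$ with $|A|\ge 2$. 3. Consequently, neither parameter can be relaxed: if $a\ge a_D$, $b\ge b_D$, and either $a>a_D$ or $b\ge 2b_D$, then some $(a,b)$-sparse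 multigraph has no $(D,F,F)$-coloring. (For $b_D<b<2b_D$, being $(a_D,b)$-sparse is equivalent to being $(a_D,b_D)$-sparse, because $2(D+1)|E(G[A])|$ is an integer.) -/

import Mathlib

open scoped Graph

universe u v

namespace Graph

/-- A multigraph is `(a, b)`-sparse if it is loopless and, for every set `A` of at least two
vertices, the subgraph induced by `A` has (finitely many and) at most `a * |A| + b` edges. -/
def IsSparse {α : Type u} {β : Type v} (G : Graph α β) (a b : ℝ) : Prop :=
  G.Loopless ∧ ∀ A : Finset α, (A : Set α) ⊆ V(G) → 2 ≤ A.card →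
    E(G.induce (A : Set α)).Finite ∧ (E(G.induce (A : Set α)).ncard : ℝ) ≤ a * A.card + b

/-- The degree of a vertex: the number of incident edges, loops being counted twice. -/
noncomputable def degree {α : Type u} {β : Type v} (G : Graph α β) (x : α) : ℕ∞ :=
  (G.incidenceSet x).encard + (G.loopSet x).encard

/-- A forest is a multigraph without cycles. Cycles of length one and two are the loops and the
pairs of parallel edges, and they are excluded by `G.Simple`; cycles of length at least three
are cycles of the underlying simple graph. -/
def IsForest {α : Type u} {β : Type v} (G : Graph α β) : Prop :=
  G.Simple ∧ G.toSimpleGraph.IsAcyclic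

/-- `(M, F)` is a `(D, F, F)`-coloring of `G`: the (possibly empty) sets `M` and `F` partition the
vertex set, both induce forests, and the forest induced by `M` has maximum degree at most `D`. -/
structure IsDFFColoring {α : Type u} {β : Type v} (G : Graph α β) (D : ℕ) (M F : Set α) :
    Prop where
  union_eq : M ∪ F = V(G)
  disjoint : Disjoint M F
  isForest_left : (G.induce M).IsForest
  degree_le : ∀ x ∈ M, (G.induce M).degree x ≤ D
  isForest_right : (G.induce F).IsForest

/-- `G` has a `(D, F, F)`-coloring. -/
def HasDFFColoring {α : Type u} {β : Type v} (G : Graph α β) (D : ℕ) : Prop :=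
  ∃ M F : Set α, G.IsDFFColoring D M F

end Graph

/-! The colorability statement is proved for a class closed under the reductions used. Each vertex
`x` carries a flag `φ x` (may it enter the unrestricted forest `F`?) and a capacity `k x ≤ D + 1`:
its degree in the bounded forest `M` must stay below `k x`, so `k x = 0` bars it from `M`. A vertex
weighs `2 k x - 2`, plus `2D + 3` if `φ x` holds; an edge costs `2(D + 1)`. The potential of a set
is its weight minus the cost of its edges. An unrestricted vertex weighs `4D + 3`, so sparsity says
that potentials are at least `-1`. The prices fit the operations: one unit of capacity is worth `2`,
and barring a vertex from `M` never costs more than an edge. Forests are handled by counting: every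
nonempty set spans fewer edges than it has vertices.

Take a counterexample with fewest vertices. If a proper set `S` has small potential, color `S` by
minimality and contract the `F`-part of `S` to one vertex; neighbors of the `M`-part are barred from
`M`. The contracted graph is still sparse, and its coloring extends that of `S`
(`exists_coloring_of_contract`). If `S` has no coloring with an edge leaving from its `F`-part, `S`
acts like a single vertex forced into `M`, with a capacity read off from its potential. Hence
(`pot_ge_of_not_colorable`) no vertex is forced into `M`, and proper sets of at least two vertices
have potential at least `2D + 2`. So up to `D + 1` units of capacity can be removed from a proper
subgraph without loss of sparsity.

The total potential is at least `-1`, so some vertex has nonnegative charge. Such a vertex has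
degree three and capacity at least two. Deleting it and lowering the capacities of its neighbors
costs three units, which is affordable if `D ≥ 2` and ends that case.

For `D = 1` the same deletion shows that the graph has potential exactly `-1`. Further reductions
exclude adjacent vertices of degree three with capacity two, and a few related configurations.
Discharging then leaves no slack: the vertices of degree three and capacity two form an independent
set `L`, and the deficits `q` of the other vertices, the set `B`, sum to three (`exists_layered`). A
case analysis of this deficit gives `T ⊆ B` such that `T ∪ L` is a forest and `B \ T` has maximum
degree at most one (`Layered.exists_hits`); this is a coloring.

For exactness, a pair of new vertices joined by a double edge and each joined to a root lowers the
potential by `2` and adds one neighbor of the root in `M`, since a double edge must cross the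
partition. With `D + 1` such pairs the root cannot lie in `M`; a double edge then forces the next
vertex into `M`. Chains of these gadgets grow without bound and are closed by a contradiction at
potential exactly `-2`. -/

set_option linter.unusedSectionVars false

/-! ### Edge multiplicities -/

namespace Multiplicity

variable {α : Type*} [DecidableEq α]

/-- The function `m` counts the edges between pairs of vertices of a loopless multigraph. -/
structure IsMult (m : α → α → ℕ) : Prop where
  symm : ∀ x y, m x y = m y x
  self : ∀ x, m x x = 0

/-- The number of edges from `x` to `A`. -/
def deg (m : α → α → ℕ) (A : Finset α) (x : α) : ℕ := ∑ y ∈ A, m x y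

/-- Twice the number of edges inside `A`. -/
def total (m : α → α → ℕ) (A : Finset α) : ℕ := ∑ x ∈ A, deg m A x

/-- Every nonempty subset of `F` spans fewer edges than it has vertices. -/
def Forest (m : α → α → ℕ) (F : Finset α) : Prop :=
  ∀ A ⊆ F, A.Nonempty → total m A + 2 ≤ 2 * A.card

section Basic

variable {m m' : α → α → ℕ} {A B F : Finset α} {x y : α}

lemma deg_empty : deg m ∅ x = 0 := by simp [deg]

lemma deg_insert (h : y ∉ A) : deg m (insert y A) x = m x y + deg m A x := by
  simp [deg, Finset.sum_insert h]

lemma deg_union (h : Disjoint A B) : deg m (A ∪ B) x = deg m A x + deg m B x := by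
  simp [deg, Finset.sum_union h]

lemma deg_mono (h : A ⊆ B) : deg m A x ≤ deg m B x :=
  Finset.sum_le_sum_of_subset h

lemma le_deg (h : y ∈ A) : m x y ≤ deg m A x :=
  Finset.single_le_sum (f := fun y => m x y) (fun _ _ => Nat.zero_le _) h

lemma deg_eq_zero_iff : deg m A x = 0 ↔ ∀ y ∈ A, m x y = 0 := by
  simp [deg, Finset.sum_eq_zero_iff]

lemma deg_congr (h : ∀ y ∈ A, m x y = m' x y) : deg m A x = deg m' A x :=
  Finset.sum_congr rfl h

lemma deg_add_deg_sdiff (h : A ⊆ B) : deg m A x + deg m (B \ A) x = deg m B x := by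
  rw [← deg_union Finset.disjoint_sdiff, Finset.union_sdiff_of_subset h]

lemma total_congr (h : ∀ x ∈ A, ∀ y ∈ A, m x y = m' x y) : total m A = total m' A :=
  Finset.sum_congr rfl fun x hx => deg_congr (h x hx)

lemma total_empty : total m ∅ = 0 := by simp [total]

lemma total_singleton (hm : IsMult m) : total m {x} = 0 := by simp [total, deg, hm.self]

lemma sum_deg_comm (hm : IsMult m) : ∑ x ∈ A, deg m B x = ∑ y ∈ B, deg m A y := by
  unfold deg
  rw [Finset.sum_comm]
  exact Finset.sum_congr rfl fun y _ => Finset.sum_congr rfl fun x _ => hm.symm _ _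

lemma total_union (hm : IsMult m) (h : Disjoint A B) :
    total m (A ∪ B) = total m A + total m B + 2 * ∑ y ∈ B, deg m A y := by
  have e : ∀ x, deg m (A ∪ B) x = deg m A x + deg m B x := fun x => deg_union h
  have := sum_deg_comm hm (A := A) (B := B)
  simp only [total, Finset.sum_union h, e, Finset.sum_add_distrib]
  omega

lemma total_insert (hm : IsMult m) (h : x ∉ A) :
    total m (insert x A) = total m A + 2 * deg m A x := by
  have h1 : Disjoint A {x} := by simpa using h
  rw [Finset.insert_eq, Finset.union_comm, total_union hm h1, total_singleton hm]
  simp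

lemma total_le_of_le (h : ∀ x ∈ A, ∀ y ∈ A, m x y ≤ m' x y) : total m A ≤ total m' A :=
  Finset.sum_le_sum fun x hx => Finset.sum_le_sum fun y hy => h x hx y hy

lemma Forest.mono (h : Forest m B) (hAB : A ⊆ B) : Forest m A :=
  fun C hC hne => h C (hC.trans hAB) hne

lemma forest_empty : Forest m (∅ : Finset α) := by
  intro A hA hne
  rw [Finset.subset_empty.1 hA] at hne
  simp at hne

lemma Forest.of_le (h : Forest m' F) (hle : ∀ x ∈ F, ∀ y ∈ F, m x y ≤ m' x y) : Forest m F := by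
  intro A hA hne
  have := h A hA hne
  have := total_le_of_le (m := m) (m' := m') (A := A) fun x hx y hy => hle x (hA hx) y (hA hy)
  omega

/-- Adding a vertex with at most one edge keeps a forest. -/
lemma Forest.insert (hm : IsMult m) (h : Forest m F) (hx : deg m F x ≤ 1) :
    Forest m (insert x F) := by
  intro A hA hne
  by_cases hxA : x ∈ A
  · obtain ⟨A', hxA', rfl⟩ : ∃ A', x ∉ A' ∧ A = Insert.insert x A' :=
      ⟨A.erase x, by simp, by simp [hxA]⟩
    have hA' : A' ⊆ F := fun y hy => by
      rcases Finset.mem_insert.1 (hA (Finset.mem_insert_of_mem hy)) with rfl | h'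
      · exact absurd hy hxA'
      · exact h'
    rw [total_insert hm hxA', Finset.card_insert_of_notMem hxA']
    rcases A'.eq_empty_or_nonempty with rfl | hne'
    · simp [total_empty, deg_empty]
    · have := h A' hA' hne'
      have := deg_mono (m := m) (x := x) hA'
      omega
  · exact h A (fun y hy => (Finset.mem_insert.1 (hA hy)).resolve_left (fun e => hxA (e ▸ hy))) hne

lemma forest_singleton (hm : IsMult m) : Forest m {x} := by
  have := Forest.insert (x := x) hm (forest_empty (m := m)) (by simp [deg_empty])
  simpa using this

/-- Adding an independent set of vertices, each with at most one edge, keeps a forest. -/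
lemma Forest.union_of_deg_le_one (hm : IsMult m) (h : Forest m F) (X : Finset α)
    (hX : ∀ x ∈ X, deg m (F ∪ X) x ≤ 1) : Forest m (F ∪ X) := by
  suffices ∀ Y ⊆ X, Forest m (F ∪ Y) from this X subset_rfl
  intro Y
  induction Y using Finset.induction_on with
  | empty => intro _; simpa using h
  | insert y Y hy ih =>
    intro hY
    rw [Finset.union_insert]
    refine (ih fun z hz => hY (Finset.mem_insert_of_mem hz)).insert hm ?_
    refine (deg_mono (Finset.union_subset_union subset_rfl ?_)).trans
      (hX y (hY (Finset.mem_insert_self _ _)))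
    exact fun z hz => hY (Finset.mem_insert_of_mem hz)

/-- Expanding a vertex of a forest into a forest. -/
lemma Forest.expand {s : α} {S R : Finset α} (hm : IsMult m) (hm' : IsMult m')
    (hSR : Disjoint S R) (hs : s ∉ R) (hS : Forest m S) (hR : Forest m' (Insert.insert s R))
    (h1 : ∀ x ∈ R, ∀ y ∈ R, m' x y = m x y) (h2 : ∀ y ∈ R, deg m S y ≤ m' s y) :
    Forest m (S ∪ R) := by
  intro A hA hne
  set A1 := A ∩ S with hA1
  set A2 := A ∩ R with hA2
  have hAe : A = A1 ∪ A2 := by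
    rw [hA1, hA2, ← Finset.inter_union_distrib_left]
    exact (Finset.inter_eq_left.2 hA).symm
  have hd : Disjoint A1 A2 :=
    Finset.disjoint_of_subset_left Finset.inter_subset_right
      (Finset.disjoint_of_subset_right Finset.inter_subset_right hSR)
  have hA2R : A2 ⊆ R := Finset.inter_subset_right
  have hA1S : A1 ⊆ S := Finset.inter_subset_right
  have et : total m A2 = total m' A2 :=
    total_congr fun x hx y hy => (h1 x (hA2R hx) y (hA2R hy)).symm
  rcases A1.eq_empty_or_nonempty with h0 | hne1
  · rw [h0, Finset.empty_union] at hAe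
    rw [hAe, et]
    exact hR A2 (hA2R.trans (Finset.subset_insert _ _)) (hAe ▸ hne)
  · rw [hAe, total_union hm hd, Finset.card_union_of_disjoint hd]
    -- The vertex `s` stands for the whole of `A1`: its contribution `2` in the second bound cancels
    -- one of the two deficits, and the other deficit is what the union needs.
    have k1 := hS A1 hA1S hne1
    have hsA : s ∉ A2 := fun h => hs (hA2R h)
    have k2 := hR (Insert.insert s A2) (Finset.insert_subset_insert _ hA2R) (by simp)
    rw [total_insert hm' hsA, Finset.card_insert_of_notMem hsA] at k2
    have k3 : ∑ y ∈ A2, deg m A1 y ≤ deg m' A2 s :=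
      Finset.sum_le_sum fun y hy => (deg_mono hA1S).trans (h2 y (hA2R hy))
    omega

lemma Forest.union_of_no_edges {S R : Finset α} (hm : IsMult m) (hSR : Disjoint S R)
    (hS : Forest m S) (hR : Forest m R) (h : ∀ y ∈ R, deg m S y = 0) : Forest m (S ∪ R) := by
  intro A hA hne
  set A1 := A ∩ S with hA1
  set A2 := A ∩ R with hA2
  have hAe : A = A1 ∪ A2 := by
    rw [hA1, hA2, ← Finset.inter_union_distrib_left]
    exact (Finset.inter_eq_left.2 hA).symm
  have hd : Disjoint A1 A2 :=
    Finset.disjoint_of_subset_left Finset.inter_subset_right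
      (Finset.disjoint_of_subset_right Finset.inter_subset_right hSR)
  have hA2R : A2 ⊆ R := Finset.inter_subset_right
  have hA1S : A1 ⊆ S := Finset.inter_subset_right
  rcases A1.eq_empty_or_nonempty with h0 | hne1
  · rw [h0, Finset.empty_union] at hAe
    exact hR A (hAe ▸ hA2R) hne
  rcases A2.eq_empty_or_nonempty with h0 | hne2
  · rw [h0, Finset.union_empty] at hAe
    exact hS A (hAe ▸ hA1S) hne
  have k1 := hS A1 hA1S hne1
  have k2 := hR A2 hA2R hne2
  have k3 : ∑ y ∈ A2, deg m A1 y = 0 := Finset.sum_eq_zero fun y hy =>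
    Nat.eq_zero_of_le_zero ((deg_mono hA1S).trans (h y (hA2R hy)).le)
  rw [hAe, total_union hm hd, Finset.card_union_of_disjoint hd]
  omega

/-- The multiplicities after adding one edge between `a` and `b`. -/
def addEdge (m : α → α → ℕ) (a b : α) (x y : α) : ℕ :=
  m x y + if (x = a ∧ y = b) ∨ (x = b ∧ y = a) then 1 else 0

lemma IsMult.addEdge (hm : IsMult m) {a b : α} (hab : a ≠ b) : IsMult (addEdge m a b) := by
  constructor
  · intro x y
    simp only [Multiplicity.addEdge, hm.symm x y]
    congr 2
    apply propext
    tauto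
  · intro x
    simp only [Multiplicity.addEdge, hm.self x]
    rw [if_neg]
    rintro (⟨rfl, h⟩ | ⟨rfl, h⟩)
    · exact hab h
    · exact hab h.symm

lemma le_addEdge {a b : α} : m x y ≤ addEdge m a b x y := Nat.le_add_right _ _

lemma total_addEdge {a b : α} (hab : a ≠ b) :
    total (addEdge m a b) A = total m A + if a ∈ A ∧ b ∈ A then 2 else 0 := by
  have e : ∀ x y : α, (if (x = a ∧ y = b) ∨ (x = b ∧ y = a) then 1 else 0) =
      (if x = a then (if y = b then 1 else 0) else 0) +
      (if x = b then (if y = a then 1 else 0) else 0) := by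
    intro x y
    by_cases h1 : x = a
    · subst h1; simp [hab]
    · simp [h1, ite_and]
  simp only [total, deg, addEdge, e, Finset.sum_add_distrib]
  congr 1
  have f1 : ∀ c d : α, ∑ x ∈ A, ∑ y ∈ A, (if x = c then (if y = d then 1 else 0) else 0) =
      if c ∈ A ∧ d ∈ A then 1 else 0 := by
    intro c d
    by_cases hc : c ∈ A <;> by_cases hd : d ∈ A <;> simp [hc, hd, Finset.sum_ite_irrel]
  rw [f1, f1]
  by_cases ha : a ∈ A <;> by_cases hb : b ∈ A <;> simp [ha, hb]

/-- Subdividing an edge of a forest. -/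
lemma Forest.subdivide {a b v : α} (hm : IsMult m) (hab : a ≠ b)
    (h : Forest (addEdge m a b) F) (hva : m v a ≤ 1) (hvb : m v b ≤ 1)
    (hv : ∀ y ∈ F, y ≠ a → y ≠ b → m v y = 0) : Forest m (Insert.insert v F) := by
  intro A hA hne
  by_cases hvA : v ∈ A
  · obtain ⟨A', hvA', rfl⟩ : ∃ A', v ∉ A' ∧ A = Insert.insert v A' :=
      ⟨A.erase v, by simp, by simp [hvA]⟩
    have hA' : A' ⊆ F := fun y hy => by
      rcases Finset.mem_insert.1 (hA (Finset.mem_insert_of_mem hy)) with rfl | h'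
      · exact absurd hy hvA'
      · exact h'
    rw [total_insert hm hvA', Finset.card_insert_of_notMem hvA']
    rcases A'.eq_empty_or_nonempty with rfl | hne'
    · simp [total_empty, deg_empty]
    · have h1 := h A' hA' hne'
      rw [total_addEdge hab] at h1
      have h2 : deg m A' v ≤ (if a ∈ A' then 1 else 0) + (if b ∈ A' then 1 else 0) := by
        calc deg m A' v ≤ ∑ y ∈ A', ((if y = a then 1 else 0) + (if y = b then 1 else 0)) := by
              refine Finset.sum_le_sum fun y hy => ?_
              by_cases hya : y = a
              · subst hya; simp; omega
              · by_cases hyb : y = b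
                · subst hyb; simp; omega
                · simp [hv y (hA' hy) hya hyb]
          _ = _ := by simp [Finset.sum_add_distrib]
      by_cases ha : a ∈ A' <;> by_cases hb : b ∈ A' <;> simp [ha, hb] at h1 h2 <;> omega
  · refine (h.of_le fun x _ y _ => le_addEdge) A (fun y hy => ?_) hne
    exact (Finset.mem_insert.1 (hA hy)).resolve_left (fun e => hvA (e ▸ hy))

end Basic

/-! ### Potentials and colorings -/

/-- The weight of a vertex: `φ x` tells whether `x` may be put into the unrestricted forest, and
`k x` exceeds by one the degree that is allowed for `x` in the forest of bounded degree. -/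
def weight (D : ℕ) (φ : α → Bool) (k : α → ℕ) (x : α) : ℤ :=
  2 * k x - 2 + if φ x then 2 * (D : ℤ) + 3 else 0

/-- The potential of a set of vertices. -/
def pot (D : ℕ) (m : α → α → ℕ) (φ : α → Bool) (k : α → ℕ) (A : Finset α) : ℤ :=
  ∑ x ∈ A, weight D φ k x - (D + 1) * total m A

/-- Every nonempty subset of `V` has potential at least `-1`. -/
def Sparse (D : ℕ) (m : α → α → ℕ) (φ : α → Bool) (k : α → ℕ) (V : Finset α) : Prop :=
  ∀ A ⊆ V, A.Nonempty → -1 ≤ pot D m φ k A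

/-- The partition `(M, V \ M)` of `V` into two forests respects `φ` and the capacities `k`. -/
structure Coloring (m : α → α → ℕ) (φ : α → Bool) (k : α → ℕ) (V M : Finset α) : Prop where
  subset : M ⊆ V
  allowed : ∀ x ∈ V, x ∉ M → φ x = true
  deg_lt : ∀ x ∈ M, deg m M x < k x
  forest_left : Forest m M
  forest_right : Forest m (V \ M)

/-- Sparse weighted multigraphs with fewer than `n` vertices have colorings. -/
def ColorableBelow (α : Type*) [DecidableEq α] (D n : ℕ) : Prop :=
  ∀ (m : α → α → ℕ) (φ : α → Bool) (k : α → ℕ) (V : Finset α), V.card < n → IsMult m →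
    (∀ x ∈ V, k x ≤ D + 1) → Sparse D m φ k V → ∃ M, Coloring m φ k V M

section Potential

variable {D : ℕ} {m m' : α → α → ℕ} {φ φ' : α → Bool} {k k' : α → ℕ} {A B V : Finset α} {x : α}

lemma pot_empty : pot D m φ k ∅ = 0 := by simp [pot, total_empty]

lemma pot_singleton (hm : IsMult m) : pot D m φ k {x} = weight D φ k x := by
  simp [pot, total_singleton hm]

lemma pot_insert (hm : IsMult m) (h : x ∉ A) :
    pot D m φ k (insert x A) =
      pot D m φ k A + weight D φ k x - 2 * (D + 1) * deg m A x := by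
  simp only [pot, total_insert hm h, Finset.sum_insert h]
  push_cast
  ring

lemma pot_union (hm : IsMult m) (h : Disjoint A B) :
    pot D m φ k (A ∪ B) =
      pot D m φ k A + pot D m φ k B - 2 * (D + 1) * ∑ y ∈ B, (deg m A y : ℤ) := by
  simp only [pot, total_union hm h, Finset.sum_union h]
  push_cast
  ring

lemma pot_congr_mult (h : ∀ x ∈ A, ∀ y ∈ A, m x y = m' x y) :
    pot D m φ k A = pot D m' φ k A := by
  rw [pot, pot, total_congr h]

/-- The change of the potential when only the weights change. -/
lemma pot_eq_sub : pot D m φ' k' A =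
    pot D m φ k A - ∑ x ∈ A, (weight D φ k x - weight D φ' k' x) := by
  simp only [pot, Finset.sum_sub_distrib]
  ring

lemma pot_addEdge {a b : α} (hab : a ≠ b) : pot D (addEdge m a b) φ k A =
    pot D m φ k A - if a ∈ A ∧ b ∈ A then 2 * ((D : ℤ) + 1) else 0 := by
  simp only [pot, total_addEdge hab]
  split_ifs <;> push_cast <;> ring

lemma weight_sub_weight (h : φ' x = φ x) :
    weight D φ k x - weight D φ' k' x = 2 * ((k x : ℤ) - k' x) := by
  simp only [weight, h]
  ring

lemma weight_of_true (h : φ x = true) : weight D φ k x = 2 * k x + 2 * D + 1 := by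
  simp only [weight, h, if_true]
  ring

lemma weight_of_false (h : φ x = false) : weight D φ k x = 2 * k x - 2 := by
  simp [weight, h]

end Potential

end Multiplicity

namespace Multiplicity

variable {α : Type*} [DecidableEq α]
variable {D : ℕ} {m m' : α → α → ℕ} {φ φ' : α → Bool} {k k' : α → ℕ} {A B S V M : Finset α}
variable {x : α}

/-! ### Contraction -/

/-- The multiplicities after replacing the set `Q` by the single vertex `s`. -/
def contract (m : α → α → ℕ) (Q : Finset α) (s : α) (x y : α) : ℕ :=
  if x = s then (if y = s then 0 else deg m Q y) else if y = s then deg m Q x else m x y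

lemma IsMult.contract (hm : IsMult m) (Q : Finset α) (s : α) : IsMult (contract m Q s) := by
  constructor
  · intro x y
    unfold Multiplicity.contract
    split_ifs <;> simp [hm.symm x y]
  · intro x
    unfold Multiplicity.contract
    split_ifs <;> simp [hm.self x]

lemma contract_of_ne {Q : Finset α} {s x y : α} (hx : x ≠ s) (hy : y ≠ s) :
    contract m Q s x y = m x y := by
  simp [contract, hx, hy]

lemma contract_left {Q : Finset α} {s y : α} (hy : y ≠ s) :
    contract m Q s s y = deg m Q y := by
  simp [contract, hy]

lemma contract_right {Q : Finset α} {s y : α} (hy : y ≠ s) :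
    contract m Q s y s = deg m Q y := by
  simp [contract, hy]

lemma deg_contract_self {Q : Finset α} {s : α} (hs : s ∉ A) :
    deg (contract m Q s) A s = ∑ y ∈ A, deg m Q y :=
  Finset.sum_congr rfl fun _ hy => contract_left fun e => hs (e ▸ hy)

lemma deg_contract_of_ne {Q : Finset α} {s : α} (hs : s ∉ A) (hx : x ≠ s) :
    deg (contract m Q s) A x = deg m A x :=
  Finset.sum_congr rfl fun _ hy => contract_of_ne hx fun e => hs (e ▸ hy)

lemma pot_contract {Q : Finset α} {s : α} (hs : s ∉ A) :
    pot D (contract m Q s) φ k A = pot D m φ k A :=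
  pot_congr_mult fun _ hx _ hy =>
    contract_of_ne (fun e => hs (e ▸ hx)) (fun e => hs (e ▸ hy))

lemma pot_contract_insert (hm : IsMult m) {Q : Finset α} {s : α} (hs : s ∉ A) :
    pot D (contract m Q s) φ k (insert s A) =
      pot D m φ k A + weight D φ k s - 2 * (D + 1) * ∑ y ∈ A, (deg m Q y : ℤ) := by
  rw [pot_insert (hm.contract Q s) hs, pot_contract hs, deg_contract_self hs]
  push_cast
  ring

/-! ### Gluing colorings -/

lemma Coloring.of_le (h : Coloring m φ k' V M) (hk : ∀ x ∈ V, k' x ≤ k x) :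
    Coloring m φ k V M where
  subset := h.subset
  allowed := h.allowed
  deg_lt x hx := (h.deg_lt x hx).trans_le (hk x (h.subset hx))
  forest_left := h.forest_left
  forest_right := h.forest_right

lemma Coloring.of_not_forced (h : Coloring m φ' k V M) (hφ : ∀ x, φ' x = true → φ x = true) :
    Coloring m φ k V M where
  subset := h.subset
  allowed x hx hxM := hφ x (h.allowed x hx hxM)
  deg_lt := h.deg_lt
  forest_left := h.forest_left
  forest_right := h.forest_right

/-- Two parts joined by no edges are colored separately. -/
lemma exists_coloring_of_no_edges (hm : IsMult m) (hk : ∀ x ∈ V, k x ≤ D + 1)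
    (hV : Sparse D m φ k V) (ih : ColorableBelow α D V.card) (hS : S ⊆ V) (hne : S.Nonempty)
    (hSV : S ≠ V) (h0 : ∀ y ∈ V \ S, deg m S y = 0) : ∃ M, Coloring m φ k V M := by
  have hss : S ⊂ V := lt_of_le_of_ne hS hSV
  have hlt : (V \ S).card < V.card := by
    have := Finset.card_sdiff_add_card_eq_card hS
    have := hne.card_pos
    omega
  obtain ⟨M1, h1⟩ := ih m φ k S (Finset.card_lt_card hss) hm (fun x hx => hk x (hS hx))
    (fun A hA => hV A (hA.trans hS))
  obtain ⟨M2, h2⟩ := ih m φ k (V \ S) hlt hm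
    (fun x hx => hk x (Finset.sdiff_subset hx)) (fun A hA => hV A (hA.trans Finset.sdiff_subset))
  have hd : Disjoint M1 M2 := Finset.disjoint_of_subset_left h1.subset
    (Finset.disjoint_of_subset_right h2.subset Finset.disjoint_sdiff)
  have e0 : ∀ x ∈ S, ∀ y ∈ V \ S, m y x = 0 := fun x hx y hy => deg_eq_zero_iff.1 (h0 y hy) x hx
  have eVM : V \ (M1 ∪ M2) = (S \ M1) ∪ ((V \ S) \ M2) := by
    ext x
    have := @h1.subset x
    have := @h2.subset x
    have := @hS x
    simp only [Finset.mem_sdiff, Finset.mem_union] at *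
    tauto
  refine ⟨M1 ∪ M2, ⟨Finset.union_subset (h1.subset.trans hS)
    (h2.subset.trans Finset.sdiff_subset), ?_, ?_, ?_, ?_⟩⟩
  · intro x hx hxM
    by_cases hxS : x ∈ S
    · exact h1.allowed x hxS fun h => hxM (Finset.mem_union_left _ h)
    · exact h2.allowed x (Finset.mem_sdiff.2 ⟨hx, hxS⟩) fun h => hxM (Finset.mem_union_right _ h)
  · intro x hx
    rw [deg_union hd]
    rcases Finset.mem_union.1 hx with h | h
    · have : deg m M2 x = 0 := deg_eq_zero_iff.2 fun y hy => by
        rw [hm.symm]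
        exact e0 x (h1.subset h) y (h2.subset hy)
      rw [this, add_zero]
      exact h1.deg_lt x h
    · have : deg m M1 x = 0 := deg_eq_zero_iff.2 fun y hy => e0 y (h1.subset hy) x (h2.subset h)
      rw [this, zero_add]
      exact h2.deg_lt x h
  · exact h1.forest_left.union_of_no_edges hm hd h2.forest_left fun y hy =>
      deg_eq_zero_iff.2 fun x hx => e0 x (h1.subset hx) y (h2.subset hy)
  · rw [eVM]
    refine h1.forest_right.union_of_no_edges hm ?_ h2.forest_right fun y hy =>
      deg_eq_zero_iff.2 fun x hx => e0 x (Finset.sdiff_subset hx) y (Finset.sdiff_subset hy)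
    exact Finset.disjoint_of_subset_left Finset.sdiff_subset
      (Finset.disjoint_of_subset_right Finset.sdiff_subset Finset.disjoint_sdiff)

/-- The cross term in the potential of `S ∪ A` splits along a coloring of `S`. -/
lemma pot_union_split (hm : IsMult m) (h : Disjoint S A) (hM : M ⊆ S) :
    pot D m φ k (S ∪ A) = pot D m φ k S + pot D m φ k A -
      2 * (D + 1) * (∑ y ∈ A, (deg m M y : ℤ)) - 2 * (D + 1) * ∑ y ∈ A, (deg m (S \ M) y : ℤ) := by
  have : ∑ y ∈ A, (deg m S y : ℤ) =
      (∑ y ∈ A, (deg m M y : ℤ)) + ∑ y ∈ A, (deg m (S \ M) y : ℤ) := by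
    rw [← Finset.sum_add_distrib]
    refine Finset.sum_congr rfl fun y _ => ?_
    rw [← deg_add_deg_sdiff hM]
    push_cast
    ring
  rw [pot_union hm h, this]
  ring

/-- A coloring of a set of small potential extends to the whole vertex set if one of the edges
leaving the set starts at a vertex outside of the forest of bounded degree. -/
lemma exists_coloring_of_contract (hm : IsMult m) (hk : ∀ x ∈ V, k x ≤ D + 1)
    (hV : Sparse D m φ k V) (ih : ColorableBelow α D V.card) (hS : S ⊆ V) (hS2 : 2 ≤ S.card)
    (hp : pot D m φ k S ≤ 2 * D + 1)
    (hmin : ∀ T ⊆ V, S ⊆ T → T ≠ V → pot D m φ k S ≤ pot D m φ k T)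
    (hM : Coloring m φ k S M) (hedge : ∃ y ∈ V \ S, deg m (S \ M) y ≠ 0) :
    ∃ M', Coloring m φ k V M' := by
  -- Any vertex of `S` can serve as the name of the contracted vertex, since the rest of `S`
  -- disappears. This keeps the vertex type fixed throughout the induction; `2 ≤ S.card` makes the
  -- new graph smaller.
  obtain ⟨s, hs⟩ : S.Nonempty := Finset.card_pos.1 (by omega)
  set R := V \ S with hR
  have hsR : s ∉ R := fun h => (Finset.mem_sdiff.1 h).2 hs
  have hVu : V = S ∪ R := by rw [hR, Finset.union_sdiff_of_subset hS]
  have hcard : S.card + R.card = V.card := by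
    rw [hVu, Finset.card_union_of_disjoint Finset.disjoint_sdiff]
  have hSR : Disjoint S R := Finset.disjoint_sdiff
  set φ' : α → Bool := fun y => if y = s then true else φ y with hφ'
  -- Capacity `0` places `s` and all neighbors of `M` in the unrestricted forest. Thus no edge joins
  -- `M` to the new part of the bounded forest, and degrees in `M` do not change.
  set k' : α → ℕ := fun y => if y = s then 0 else if deg m M y = 0 then k y else 0 with hk'
  set m' := contract m (S \ M) s with hm'
  have hφR : ∀ y ∈ R, φ' y = φ y := fun y hy => by
    simp only [hφ']
    rw [if_neg]
    rintro rfl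
    exact hsR hy
  have hk'R : ∀ y ∈ R, k' y = if deg m M y = 0 then k y else 0 := fun y hy => by
    simp only [hk']
    rw [if_neg]
    rintro rfl
    exact hsR hy
  have hRV : R ⊆ V := Finset.sdiff_subset
  -- the new weights on `R`
  have hw : ∀ A ⊆ R, pot D m φ k A - 2 * (D + 1) * ∑ y ∈ A, (deg m M y : ℤ) ≤
      pot D m φ' k' A := by
    intro A hA
    rw [pot_eq_sub (k := k) (k' := k') (φ := φ) (φ' := φ'), Finset.mul_sum]
    refine sub_le_sub_left (Finset.sum_le_sum fun y hy => ?_) _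
    rw [weight_sub_weight (hφR y (hA hy)), hk'R y (hA hy)]
    split_ifs with h0
    · simp [h0]
    · have h1 : (1 : ℤ) ≤ deg m M y := by exact_mod_cast Nat.one_le_iff_ne_zero.2 h0
      have h2 : (k y : ℤ) ≤ D + 1 := by exact_mod_cast hk y (hRV (hA hy))
      push_cast
      nlinarith
  have hsplit : ∀ A ⊆ R, pot D m φ k (S ∪ A) = pot D m φ k S + pot D m φ k A -
      2 * (D + 1) * (∑ y ∈ A, (deg m M y : ℤ)) -
        2 * (D + 1) * ∑ y ∈ A, (deg m (S \ M) y : ℤ) := fun A hA =>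
    pot_union_split hm (Finset.disjoint_of_subset_right hA hSR) hM.subset
  have hlow : ∀ A ⊆ R, (-1 ≤ pot D m φ k (S ∪ A)) ∧
      (A ≠ R → pot D m φ k S ≤ pot D m φ k (S ∪ A)) := by
    intro A hA
    have hsub : S ∪ A ⊆ V := Finset.union_subset hS (hA.trans hRV)
    refine ⟨hV _ hsub ⟨s, Finset.mem_union_left _ hs⟩, fun hne => ?_⟩
    refine hmin _ hsub Finset.subset_union_left fun e => hne ?_
    refine Finset.Subset.antisymm hA fun y hy => ?_
    have := hRV hy
    rw [← e] at this
    exact (Finset.mem_union.1 this).resolve_left (Finset.mem_sdiff.1 hy).2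
  -- The vertex `s` weighs `2D + 1`, at least the potential of `S`, so a set `A` together with `s`
  -- is no worse than `S ∪ A`. Without `s`, minimality of `S` gives potential at least `0` unless `A
  -- = R`. In that case the edge from `hedge` is not charged, and its cost `2D + 2` offsets `-1 -
  -- (2D + 1)`.
  have hsparse : Sparse D m' φ' k' (insert s R) := by
    intro A' hA' hne'
    by_cases hsA : s ∈ A'
    · obtain ⟨A, hsA', rfl⟩ : ∃ A, s ∉ A ∧ A' = insert s A :=
        ⟨A'.erase s, by simp, by simp [hsA]⟩
      have hA : A ⊆ R := fun y hy => by
        rcases Finset.mem_insert.1 (hA' (Finset.mem_insert_of_mem hy)) with rfl | h'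
        · exact absurd hy hsA'
        · exact h'
      rw [pot_contract_insert hm hsA', weight_of_true (by simp [hφ'])]
      have h1 := hw A hA
      have h2 := hsplit A hA
      have h3 := (hlow A hA).1
      have h4 : k' s = 0 := by simp [hk']
      rw [h4]
      push_cast
      linarith
    · have hA : A' ⊆ R := fun y hy => by
        rcases Finset.mem_insert.1 (hA' hy) with rfl | h'
        · exact absurd hy hsA
        · exact h'
      rw [pot_contract hsA]
      have h1 := hw A' hA
      have h2 := hsplit A' hA
      have h3 := hlow A' hA
      have h5 : (0 : ℤ) ≤ ∑ y ∈ A', (deg m (S \ M) y : ℤ) := Finset.sum_nonneg fun _ _ => by simp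
      by_cases hAR : A' = R
      · have h6 : (1 : ℤ) ≤ ∑ y ∈ A', (deg m (S \ M) y : ℤ) := by
          obtain ⟨y, hy, hy0⟩ := hedge
          rw [hAR]
          have := Finset.single_le_sum (f := fun y => deg m (S \ M) y)
            (fun _ _ => Nat.zero_le _) hy
          have h7 : 1 ≤ ∑ y ∈ R, deg m (S \ M) y := by
            have := Nat.one_le_iff_ne_zero.2 hy0
            omega
          exact_mod_cast h7
        nlinarith [h3.1]
      · have := h3.2 hAR
        have h8 : (0 : ℤ) ≤ 2 * (D + 1) * ∑ y ∈ A', (deg m (S \ M) y : ℤ) := by positivity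
        linarith
  obtain ⟨M', h'⟩ := ih m' φ' k' (insert s R)
    (by rw [Finset.card_insert_of_notMem hsR]; omega) (hm.contract _ _)
    (by
      intro y hy
      rcases Finset.mem_insert.1 hy with rfl | hy
      · simp [hk']
      · rw [hk'R y hy]
        split_ifs
        · exact hk y (hRV hy)
        · omega) hsparse
  have hsM' : s ∉ M' := fun h => by
    have := h'.deg_lt s h
    simp [hk'] at this
  have hM'R : M' ⊆ R := fun y hy => by
    rcases Finset.mem_insert.1 (h'.subset hy) with rfl | h
    · exact absurd hy hsM'
    · exact h
  have hno : ∀ y ∈ M', deg m M y = 0 := fun y hy => by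
    by_contra h0
    have := h'.deg_lt y hy
    rw [hk'R y (hM'R hy), if_neg h0] at this
    omega
  have hne_s : ∀ y ∈ R, y ≠ s := fun y hy e => hsR (e ▸ hy)
  have hmR : ∀ x ∈ R, ∀ y ∈ R, m' x y = m x y := fun x hx y hy =>
    contract_of_ne (hne_s x hx) (hne_s y hy)
  have hd : Disjoint M M' := Finset.disjoint_of_subset_left hM.subset
    (Finset.disjoint_of_subset_right hM'R hSR)
  have eVM : V \ (M ∪ M') = (S \ M) ∪ (R \ M') := by
    ext x
    have := @hM.subset x
    have := @hM'R x
    have := @hS x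
    simp only [hR, Finset.mem_sdiff, Finset.mem_union] at *
    tauto
  refine ⟨M ∪ M', ⟨Finset.union_subset (hM.subset.trans hS) (hM'R.trans hRV), ?_, ?_, ?_, ?_⟩⟩
  · intro x hx hxM
    by_cases hxS : x ∈ S
    · exact hM.allowed x hxS fun h => hxM (Finset.mem_union_left _ h)
    · have hxR : x ∈ R := Finset.mem_sdiff.2 ⟨hx, hxS⟩
      rw [← hφR x hxR]
      exact h'.allowed x (Finset.mem_insert_of_mem hxR) fun h => hxM (Finset.mem_union_right _ h)
  · intro x hx
    rw [deg_union hd]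
    rcases Finset.mem_union.1 hx with h | h
    · have : deg m M' x = 0 := deg_eq_zero_iff.2 fun y hy => by
        rw [hm.symm]
        exact deg_eq_zero_iff.1 (hno y hy) x h
      rw [this, add_zero]
      exact hM.deg_lt x h
    · have := h'.deg_lt x h
      rw [deg_contract_of_ne hsM' (hne_s x (hM'R h)), hk'R x (hM'R h), if_pos (hno x h)] at this
      rw [hno x h, zero_add]
      exact this
  · refine hM.forest_left.union_of_no_edges hm hd (h'.forest_left.of_le fun x hx y hy => ?_) hno
    exact (hmR x (hM'R hx) y (hM'R hy)).ge
  · rw [eVM]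
    have hF := h'.forest_right
    rw [Finset.insert_sdiff_of_notMem _ hsM'] at hF
    refine Forest.expand (s := s) hm (hm.contract (S \ M) s) ?_ ?_ hM.forest_right hF ?_ ?_
    · exact Finset.disjoint_of_subset_left Finset.sdiff_subset
        (Finset.disjoint_of_subset_right Finset.sdiff_subset hSR)
    · exact fun h => hsR (Finset.sdiff_subset h)
    · exact fun x hx y hy => hmR x (Finset.sdiff_subset hx) y (Finset.sdiff_subset hy)
    · exact fun y hy => (contract_left (hne_s y (Finset.sdiff_subset hy))).ge

end Multiplicity

namespace Multiplicity

variable {α : Type*} [DecidableEq α]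
variable {D : ℕ} {m m' : α → α → ℕ} {φ φ' : α → Bool} {k k' : α → ℕ} {A B S V M : Finset α}
variable {x : α}

/-! ### Sets of small potential -/

/-- A vertex that must belong to the forest of bounded degree can be deleted. -/
lemma exists_coloring_of_forced (hm : IsMult m) (hk : ∀ x ∈ V, k x ≤ D + 1)
    (hV : Sparse D m φ k V) (ih : ColorableBelow α D V.card) (hx : x ∈ V) (hφ : φ x = false)
    (hxV : V ≠ {x})
    (hmin : ∀ T ⊆ V, x ∈ T → T ≠ {x} → T ≠ V → weight D φ k x ≤ pot D m φ k T) :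
    ∃ M, Coloring m φ k V M := by
  by_cases hnb : ∀ y ∈ V \ {x}, deg m {x} y = 0
  · exact exists_coloring_of_no_edges hm hk hV ih (Finset.singleton_subset_iff.2 hx)
      (Finset.singleton_nonempty x) hxV.symm hnb
  push Not at hnb
  obtain ⟨y₀, hy₀, hm₀⟩ := hnb
  have hy₀V : y₀ ∈ V.erase x := by simpa [and_comm] using hy₀
  have hm₀ : m x y₀ ≠ 0 := by simpa [deg, hm.symm x] using hm₀
  have hwx : weight D φ k x = 2 * k x - 2 := weight_of_false hφ
  have hkx : 1 ≤ k x := by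
    have := hV {x} (Finset.singleton_subset_iff.2 hx) (Finset.singleton_nonempty x)
    rw [pot_singleton hm, hwx] at this
    omega
  have hkx' := hk x hx
  -- The vertex `x` goes to `M` and its neighbors are barred from `M`. If `x` has capacity at least
  -- two, one simple neighbor `y₀` may stay eligible at the price of a single unit.
  set k' : α → ℕ := fun y => if m x y = 0 then k y else
    if y = y₀ ∧ m x y = 1 ∧ 2 ≤ k x then k y - 1 else 0 with hk'
  have hk'le : ∀ y, k' y ≤ k y := fun y => by
    simp only [hk']
    split_ifs <;> omega
  have hins : insert x (V.erase x) = V := Finset.insert_erase hx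
  -- Barring a neighbor costs at most one edge, `2(D + 1)`. At `y₀` there is a saving of `2D`:
  -- either only one unit is removed, or the edge is multiple and one copy already pays.
  have hdrop : ∀ y ∈ V.erase x, weight D φ k y - weight D φ k' y ≤
      2 * (D + 1) * (m x y : ℤ) - if y = y₀ then (if 2 ≤ k x then 2 * (D : ℤ) else 0) else 0 := by
    intro y hy
    rw [weight_sub_weight rfl]
    have hky : (k y : ℤ) ≤ D + 1 := by exact_mod_cast hk y (Finset.mem_of_mem_erase hy)
    have hD : (0 : ℤ) ≤ D := by positivity
    by_cases h0 : m x y = 0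
    · have : y ≠ y₀ := fun e => hm₀ (e ▸ h0)
      simp [hk', h0, this]
    have h1 : (1 : ℤ) ≤ m x y := by exact_mod_cast Nat.one_le_iff_ne_zero.2 h0
    by_cases h2 : y = y₀ ∧ m x y = 1 ∧ 2 ≤ k x
    · have e : k' y = k y - 1 := by simp only [hk', if_neg h0, if_pos h2]
      rw [e, if_pos h2.1, if_pos h2.2.2, h2.2.1]
      push_cast
      omega
    · have e : k' y = 0 := by simp only [hk', if_neg h0, if_neg h2]
      rw [e]
      split_ifs with h3 h4
      · have : (2 : ℤ) ≤ m x y := by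
          have : m x y ≠ 1 := fun h => h2 ⟨h3, h, h4⟩
          omega
        push_cast
        nlinarith
      · push_cast
        nlinarith
      · push_cast
        nlinarith
  have hsum : ∀ A ⊆ V.erase x, pot D m φ k (insert x A) - weight D φ k x +
      (∑ y ∈ A, if y = y₀ then (if 2 ≤ k x then 2 * (D : ℤ) else 0) else 0) ≤
        pot D m φ k' A := by
    intro A hA
    have hxA : x ∉ A := fun h => by simpa using hA h
    rw [pot_insert hm hxA, pot_eq_sub (k := k) (k' := k') (φ := φ) (φ' := φ)]
    have := Finset.sum_le_sum fun y hy => hdrop y (hA hy)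
    have e2 : ∑ y ∈ A, (2 * ((D : ℤ) + 1) * (m x y : ℤ) -
        if y = y₀ then (if 2 ≤ k x then 2 * (D : ℤ) else 0) else 0) =
        2 * (D + 1) * ∑ y ∈ A, (m x y : ℤ) -
          ∑ y ∈ A, if y = y₀ then (if 2 ≤ k x then 2 * (D : ℤ) else 0) else 0 := by
      rw [Finset.sum_sub_distrib, Finset.mul_sum]
    have e : ((deg m A x : ℕ) : ℤ) = ∑ y ∈ A, (m x y : ℤ) := by simp [deg]
    rw [e]
    linarith
  have hsparse : Sparse D m φ k' (V.erase x) := by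
    intro A hA hne
    have h1 := hsum A hA
    have hxA : x ∉ A := fun h => by simpa using hA h
    have hsub : insert x A ⊆ V := by
      rw [← hins]
      exact Finset.insert_subset_insert _ hA
    -- Only the whole set lacks the minimality bound. There the potential is at least `-1 - (2 k x -
    -- 2)`, and the saving `2D` at `y₀` compensates because `k x ≤ D + 1`; for `k x = 1` nothing has
    -- to be compensated.
    by_cases hAV : insert x A = V
    · have hAe : A = V.erase x := by rw [← hAV, Finset.erase_insert hxA]
      have h2 := hV V subset_rfl ⟨x, hx⟩
      rw [hAV, hAe, Finset.sum_ite_eq' (V.erase x) y₀, if_pos hy₀V, hwx] at h1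
      rw [hAe]
      split_ifs at h1 with h3 <;> omega
    · have h2 := hmin _ hsub (Finset.mem_insert_self _ _) (fun e => by
        obtain ⟨y, hy⟩ := hne
        have : y ∈ ({x} : Finset α) := e ▸ Finset.mem_insert_of_mem hy
        exact hxA (Finset.mem_singleton.1 this ▸ hy)) hAV
      have h3 : (0 : ℤ) ≤ ∑ y ∈ A, if y = y₀ then (if 2 ≤ k x then 2 * (D : ℤ) else 0) else 0 :=
        Finset.sum_nonneg fun y _ => by split_ifs <;> positivity
      linarith
  obtain ⟨M, hM⟩ := ih m φ k' (V.erase x) (Finset.card_erase_lt_of_mem hx) hm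
    (fun y hy => (hk'le y).trans (hk y (Finset.mem_of_mem_erase hy))) hsparse
  have hxM : x ∉ M := fun h => by simpa using hM.subset h
  have hnbr : ∀ y ∈ M, m x y ≠ 0 → y = y₀ ∧ m x y = 1 ∧ 2 ≤ k x := by
    intro y hy h0
    by_contra h2
    have := hM.deg_lt y hy
    simp only [hk', if_neg h0, if_neg h2] at this
    omega
  have hdx : deg m M x ≤ if 2 ≤ k x then 1 else 0 := by
    split_ifs with h2
    · calc deg m M x ≤ ∑ y ∈ M, (if y = y₀ then 1 else 0) := by
            refine Finset.sum_le_sum fun y hy => ?_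
            by_cases h0 : m x y = 0
            · simp [h0]
            · obtain ⟨e, h1, _⟩ := hnbr y hy h0
              simp [e] at h1 ⊢
              omega
        _ ≤ 1 := by
          rw [Finset.sum_ite_eq']
          split_ifs <;> simp
    · refine (deg_eq_zero_iff.2 fun y hy => ?_).le
      by_contra h0
      exact h2 (hnbr y hy h0).2.2
  refine ⟨insert x M, ⟨?_, ?_, ?_, ?_, ?_⟩⟩
  · rw [← hins]
    exact Finset.insert_subset_insert _ hM.subset
  · intro y hy hyM
    refine hM.allowed y (Finset.mem_erase.2 ⟨?_, hy⟩) fun h => hyM (Finset.mem_insert_of_mem h)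
    rintro rfl
    exact hyM (Finset.mem_insert_self _ _)
  · intro y hy
    rw [deg_insert hxM]
    rcases Finset.mem_insert.1 hy with rfl | hy
    · rw [hm.self, zero_add]
      split_ifs at hdx <;> omega
    · have h1 := hM.deg_lt y hy
      by_cases h0 : m x y = 0
      · rw [hm.symm, h0]
        have := hk'le y
        omega
      · obtain ⟨e, h2, h3⟩ := hnbr y hy h0
        simp only [hk', if_neg h0, if_pos (hnbr y hy h0)] at h1
        rw [hm.symm, h2]
        omega
  · exact hM.forest_left.insert hm (hdx.trans (by split_ifs <;> simp))
  · have : V \ insert x M = V.erase x \ M := by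
      ext y
      simp only [Finset.mem_sdiff, Finset.mem_insert, Finset.mem_erase]
      tauto
    rw [this]
    exact hM.forest_right

/-- A set of least potential can be replaced by a vertex that must belong to the forest of bounded
degree. -/
lemma exists_coloring_of_pot_le (hm : IsMult m) (hk : ∀ x ∈ V, k x ≤ D + 1)
    (hV : Sparse D m φ k V) (ih : ColorableBelow α D V.card) (hS : S ⊆ V) (hS2 : 2 ≤ S.card)
    (hSV : S ≠ V) (hp : pot D m φ k S ≤ 2 * D)
    (hmin : ∀ T ⊆ V, T.Nonempty → T ≠ V → (∀ x, T = {x} → φ x = false) →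
      pot D m φ k S ≤ pot D m φ k T) :
    ∃ M, Coloring m φ k V M := by
  have hSne : S.Nonempty := Finset.card_pos.1 (by omega)
  have hp1 := hV S hS hSne
  -- Half the potential of `S`, rounded up. A forced vertex of capacity `j + 1` weighs `2j`, enough
  -- to replace `S`; conversely, removing `j` units of capacity inside `S` leaves potentials at
  -- least `-1`.
  obtain ⟨j, hj1, hj2⟩ : ∃ j : ℕ, pot D m φ k S ≤ 2 * j ∧ (2 * j : ℤ) ≤ pot D m φ k S + 1 :=
    ⟨((pot D m φ k S + 1) / 2).toNat, by omega, by omega⟩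
  have hjD : j ≤ D := by omega
  obtain ⟨s, hs⟩ := hSne
  set R := V \ S with hR
  have hsR : s ∉ R := fun h => (Finset.mem_sdiff.1 h).2 hs
  have hVu : V = S ∪ R := by rw [hR, Finset.union_sdiff_of_subset hS]
  have hcard : S.card + R.card = V.card := by
    rw [hVu, Finset.card_union_of_disjoint Finset.disjoint_sdiff]
  have hSR : Disjoint S R := Finset.disjoint_sdiff
  have hRV : R ⊆ V := Finset.sdiff_subset
  have hne_s : ∀ y ∈ R, y ≠ s := fun y hy e => hsR (e ▸ hy)
  have hnot1 : ∀ T, S ⊆ T → ∀ x, T = {x} → φ x = false := fun T hT x e => by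
    have := Finset.card_le_card hT
    rw [e, Finset.card_singleton] at this
    omega
  have hminS : ∀ T ⊆ V, S ⊆ T → T ≠ V → pot D m φ k S ≤ pot D m φ k T := fun T hT hST hTV =>
    hmin T hT ⟨s, hST hs⟩ hTV (hnot1 T hST)
  set φ' : α → Bool := fun y => if y = s then false else φ y with hφ'
  set k' : α → ℕ := fun y => if y = s then j + 1 else k y with hk'
  set m' := contract m S s with hm'
  have hφR : ∀ y ∈ R, φ' y = φ y := fun y hy => if_neg (hne_s y hy)
  have hkR : ∀ y ∈ R, k' y = k y := fun y hy => if_neg (hne_s y hy)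
  have hw : ∀ A ⊆ R, pot D m φ' k' A = pot D m φ k A := by
    intro A hA
    rw [pot_eq_sub (k := k) (k' := k') (φ := φ) (φ' := φ'), Finset.sum_eq_zero, sub_zero]
    intro y hy
    rw [weight_sub_weight (hφR y (hA hy)), hkR y (hA hy), sub_self, mul_zero]
  have hsparse : Sparse D m' φ' k' (insert s R) := by
    intro A' hA' hne'
    by_cases hsA : s ∈ A'
    · obtain ⟨A, hsA', rfl⟩ : ∃ A, s ∉ A ∧ A' = insert s A :=
        ⟨A'.erase s, by simp, by simp [hsA]⟩
      have hA : A ⊆ R := fun y hy => by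
        rcases Finset.mem_insert.1 (hA' (Finset.mem_insert_of_mem hy)) with rfl | h'
        · exact absurd hy hsA'
        · exact h'
      rw [pot_contract_insert hm hsA', weight_of_false (by simp [hφ']), hw A hA]
      have h2 := pot_union (D := D) (φ := φ) (k := k) hm (Finset.disjoint_of_subset_right hA hSR)
      have hsub : S ∪ A ⊆ V := Finset.union_subset hS (hA.trans hRV)
      have h3 := hV _ hsub ⟨s, Finset.mem_union_left _ hs⟩
      have h4 : k' s = j + 1 := by simp [hk']
      rw [h4]
      push_cast
      linarith
    · have hA : A' ⊆ R := fun y hy => by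
        rcases Finset.mem_insert.1 (hA' hy) with rfl | h'
        · exact absurd hy hsA
        · exact h'
      rw [pot_contract hsA, hw A' hA]
      exact hV A' (hA.trans hRV) hne'
  obtain ⟨M', h'⟩ := ih m' φ' k' (insert s R)
    (by rw [Finset.card_insert_of_notMem hsR]; omega) (hm.contract _ _)
    (by
      intro y hy
      rcases Finset.mem_insert.1 hy with rfl | hy
      · simp [hk', hjD]
      · rw [hkR y hy]
        exact hk y (hRV hy)) hsparse
  have hsM' : s ∈ M' := by
    by_contra h
    have := h'.allowed s (Finset.mem_insert_self _ _) h
    simp [hφ'] at this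
  obtain ⟨C, hsC, rfl⟩ : ∃ C, s ∉ C ∧ M' = insert s C := ⟨M'.erase s, by simp, by simp [hsM']⟩
  have hCR : C ⊆ R := fun y hy => by
    rcases Finset.mem_insert.1 (h'.subset (Finset.mem_insert_of_mem hy)) with rfl | h
    · exact absurd hy hsC
    · exact h
  have hCj : ∑ x ∈ S, deg m C x ≤ j := by
    have := h'.deg_lt s (Finset.mem_insert_self _ _)
    rw [deg_insert hsC, hm', (hm.contract S s).self, deg_contract_self hsC, ← sum_deg_comm hm] at this
    simp only [hk', if_true] at this
    omega
  -- The edges to `C` are charged to the capacities in advance. Since `s` lies in the bounded forest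
  -- of the contracted graph, there are at most `j` such edges.
  set kS : α → ℕ := fun x => k x - deg m C x with hkS
  have hsparseS : Sparse D m φ kS S := by
    intro A hA hne
    by_cases h1 : ∃ x, A = {x} ∧ φ x = true
    · obtain ⟨x, rfl, hx⟩ := h1
      rw [pot_singleton hm, weight_of_true hx]
      omega
    · have hAV : A ≠ V := by
        rintro rfl
        exact hSV (Finset.Subset.antisymm hS hA)
      have h2 := hmin A (hA.trans hS) hne hAV fun x e => by
        by_contra h
        exact h1 ⟨x, e, by simpa using h⟩
      rw [pot_eq_sub (k := k) (k' := kS) (φ := φ) (φ' := φ)]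
      have h3 : ∑ x ∈ A, (weight D φ k x - weight D φ kS x) ≤ ∑ x ∈ A, 2 * (deg m C x : ℤ) := by
        refine Finset.sum_le_sum fun x _ => ?_
        rw [weight_sub_weight rfl]
        simp only [hkS]
        omega
      have h4 : ∑ x ∈ A, deg m C x ≤ j := (Finset.sum_le_sum_of_subset hA).trans hCj
      have h5 : (∑ x ∈ A, (deg m C x : ℤ)) ≤ j := by exact_mod_cast h4
      rw [← Finset.mul_sum] at h3
      linarith
  obtain ⟨M, hM⟩ := ih m φ kS S (Finset.card_lt_card (lt_of_le_of_ne hS hSV)) hm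
    (fun x hx => (Nat.sub_le _ _).trans (hk x (hS hx))) hsparseS
  -- If some edge leaves `S` from its unrestricted part, this coloring of `S` is extended by the
  -- other contraction and `C` is discarded. Otherwise all edges leaving `S` start in `M`, and `M`
  -- is substituted for `s` in the forest on `s` and `C`.
  by_cases hedge : ∃ y ∈ R, deg m (S \ M) y ≠ 0
  · exact exists_coloring_of_contract hm hk hV ih hS hS2 (by linarith) hminS
      (hM.of_le fun x _ => Nat.sub_le _ _) hedge
  push Not at hedge
  have hSM : ∀ y ∈ R, deg m S y = deg m M y := fun y hy => by
    rw [← deg_add_deg_sdiff hM.subset, hedge y hy, add_zero]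
  have hd : Disjoint M C := Finset.disjoint_of_subset_left hM.subset
    (Finset.disjoint_of_subset_right hCR hSR)
  have hmR : ∀ x ∈ R, ∀ y ∈ R, m' x y = m x y := fun x hx y hy =>
    contract_of_ne (hne_s x hx) (hne_s y hy)
  have eF : insert s R \ insert s C = R \ C := by
    ext x
    have := hne_s x
    simp only [Finset.mem_sdiff, Finset.mem_insert]
    tauto
  have eVM : V \ (M ∪ C) = (S \ M) ∪ (R \ C) := by
    ext x
    have := @hM.subset x
    have := @hCR x
    have := @hS x
    simp only [hR, Finset.mem_sdiff, Finset.mem_union] at *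
    tauto
  refine ⟨M ∪ C, ⟨Finset.union_subset (hM.subset.trans hS) (hCR.trans hRV), ?_, ?_, ?_, ?_⟩⟩
  · intro x hx hxM
    by_cases hxS : x ∈ S
    · exact hM.allowed x hxS fun h => hxM (Finset.mem_union_left _ h)
    · have hxR : x ∈ R := Finset.mem_sdiff.2 ⟨hx, hxS⟩
      rw [← hφR x hxR]
      refine h'.allowed x (Finset.mem_insert_of_mem hxR) fun h => hxM (Finset.mem_union_right _ ?_)
      exact (Finset.mem_insert.1 h).resolve_left (hne_s x hxR)
  · intro x hx
    rw [deg_union hd]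
    rcases Finset.mem_union.1 hx with h | h
    · have := hM.deg_lt x h
      simp only [hkS] at this
      omega
    · have hxR := hCR h
      have := h'.deg_lt x (Finset.mem_insert_of_mem h)
      rw [deg_insert hsC, hm', deg_contract_of_ne hsC (hne_s x hxR), contract_right (hne_s x hxR),
        hkR x hxR, hSM x hxR] at this
      exact this
  · refine Forest.expand (s := s) hm (hm.contract S s) hd hsC hM.forest_left h'.forest_left ?_ ?_
    · exact fun x hx y hy => hmR x (hCR hx) y (hCR hy)
    · intro y hy
      rw [contract_left (hne_s y (hCR hy)), hSM y (hCR hy)]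
  · have hF := h'.forest_right
    rw [eF] at hF
    rw [eVM]
    refine hM.forest_right.union_of_no_edges hm ?_ (hF.of_le fun x hx y hy => ?_) ?_
    · exact Finset.disjoint_of_subset_left Finset.sdiff_subset
        (Finset.disjoint_of_subset_right Finset.sdiff_subset hSR)
    · exact (hmR x (Finset.sdiff_subset hx) y (Finset.sdiff_subset hy)).ge
    · exact fun y hy => hedge y (Finset.sdiff_subset hy)

/-- In a minimal counterexample every vertex may belong to either part, and proper subsets with at
least two vertices have large potential. -/
theorem pot_ge_of_not_colorable (hm : IsMult m) (hk : ∀ x ∈ V, k x ≤ D + 1)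
    (hV : Sparse D m φ k V) (ih : ColorableBelow α D V.card) (hV2 : 2 ≤ V.card)
    (hno : ¬ ∃ M, Coloring m φ k V M) :
    (∀ x ∈ V, φ x = true) ∧
      ∀ S ⊆ V, 2 ≤ S.card → S ≠ V → 2 * (D : ℤ) + 2 ≤ pot D m φ k S := by
  have key : ∀ S ⊆ V, S.Nonempty → S ≠ V → (∀ x, S = {x} → φ x = false) →
      2 * (D : ℤ) + 1 ≤ pot D m φ k S := by
    by_contra! hcon
    obtain ⟨S₀, hS₀, hS₀n, hS₀V, hS₀1, hS₀p⟩ := hcon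
    set 𝒮 := V.powerset.filter fun S => S.Nonempty ∧ S ≠ V ∧ ∀ x ∈ S, S = {x} → φ x = false
      with h𝒮
    have mem : ∀ S, S ∈ 𝒮 ↔ S ⊆ V ∧ S.Nonempty ∧ S ≠ V ∧ ∀ x, S = {x} → φ x = false := by
      intro S
      simp only [h𝒮, Finset.mem_filter, Finset.mem_powerset]
      refine and_congr_right fun _ => and_congr_right fun _ => and_congr_right fun _ =>
        ⟨fun h x e => h x (e ▸ Finset.mem_singleton_self x) e, fun h x _ e => h x e⟩
    obtain ⟨S, hS, hmin⟩ := Finset.exists_min_image 𝒮 (pot D m φ k)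
      ⟨S₀, (mem S₀).2 ⟨hS₀, hS₀n, hS₀V, hS₀1⟩⟩
    obtain ⟨hSV, hSn, hSneV, hS1⟩ := (mem S).1 hS
    have hmin' : ∀ T ⊆ V, T.Nonempty → T ≠ V → (∀ x, T = {x} → φ x = false) →
        pot D m φ k S ≤ pot D m φ k T := fun T h1 h2 h3 h4 => hmin T ((mem T).2 ⟨h1, h2, h3, h4⟩)
    have hp : pot D m φ k S ≤ 2 * D := by
      have := hmin' S₀ hS₀ hS₀n hS₀V hS₀1
      linarith
    rcases Nat.lt_or_ge S.card 2 with h | h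
    · obtain ⟨x, rfl⟩ : ∃ x, S = {x} := Finset.card_eq_one.1 (by
        have := hSn.card_pos
        omega)
      refine hno (exists_coloring_of_forced hm hk hV ih (hSV (Finset.mem_singleton_self x))
        (hS1 x rfl) hSneV.symm fun T hT hxT hT1 hTV => ?_)
      rw [← pot_singleton hm]
      refine hmin' T hT ⟨x, hxT⟩ hTV fun y e => ?_
      have : x = y := Finset.mem_singleton.1 (e ▸ hxT)
      exact absurd (this ▸ e) hT1
    · exact hno (exists_coloring_of_pot_le hm hk hV ih hSV h hSneV hp hmin')
  have hφ : ∀ x ∈ V, φ x = true := by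
    intro x hx
    by_contra h
    have hxf : φ x = false := by simpa using h
    have h1 := key {x} (Finset.singleton_subset_iff.2 hx) (Finset.singleton_nonempty x)
      (fun e => by rw [← e] at hV2; simp at hV2)
      (fun y e => by rw [← Finset.singleton_injective e]; exact hxf)
    rw [pot_singleton hm, weight_of_false hxf] at h1
    have := hk x hx
    omega
  have key2 : ∀ S ⊆ V, 2 ≤ S.card → S ≠ V → 2 * (D : ℤ) + 1 ≤ pot D m φ k S := by
    intro S hS h2 hSV
    refine key S hS (Finset.card_pos.1 (by omega)) hSV fun x e => ?_
    rw [e] at h2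
    simp at h2
  refine ⟨hφ, fun S hS h2 hSV => ?_⟩
  by_contra! hlt
  have hp : pot D m φ k S = 2 * D + 1 := by
    have := key2 S hS h2 hSV
    omega
  -- At potential exactly `2D + 1` a vertex `b` of `S` with an edge to the outside can be barred
  -- from `M`: this costs at most `2D + 2` and leaves `-1`. The coloring of `S` so obtained has an
  -- edge leaving from its unrestricted part, as the contraction requires.
  by_cases hb : ∃ b ∈ S, ∃ y ∈ V \ S, m y b ≠ 0
  · obtain ⟨b, hbS, y, hy, hyb⟩ := hb
    obtain ⟨M, hM⟩ := ih m φ (fun x => if x = b then 0 else k x) S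
      (Finset.card_lt_card (lt_of_le_of_ne hS hSV)) hm
      (fun x hx => by split_ifs; · omega
                      · exact hk x (hS hx))
      (by
        intro A hA hne
        rcases Nat.lt_or_ge A.card 2 with h | h
        · obtain ⟨x, rfl⟩ : ∃ x, A = {x} := Finset.card_eq_one.1 (by
            have := hne.card_pos
            omega)
          rw [pot_singleton hm, weight_of_true (hφ x (hS (hA (Finset.mem_singleton_self x))))]
          split_ifs <;> omega
        · have hAV : A ≠ V := by
            rintro rfl
            exact hSV (Finset.Subset.antisymm hS hA)
          have h1 := key2 A (hA.trans hS) h hAV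
          rw [pot_eq_sub (k := k) (φ := φ)]
          have h3 : ∑ x ∈ A, (weight D φ k x - weight D φ (fun x => if x = b then 0 else k x) x) ≤
              ∑ x ∈ A, if x = b then 2 * (k b : ℤ) else 0 := by
            refine Finset.sum_le_sum fun x _ => ?_
            rw [weight_sub_weight rfl]
            split_ifs with e
            · rw [e]; simp
            · simp
          rw [Finset.sum_ite_eq'] at h3
          have hkb : (k b : ℤ) ≤ D + 1 := by exact_mod_cast hk b (hS hbS)
          split_ifs at h3 <;> linarith)
    have hbM : b ∉ M := fun h => by
      have := hM.deg_lt b h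
      simp at this
    refine hno (exists_coloring_of_contract hm hk hV ih hS h2 hp.le
      (fun T hT hST hTV => hp.le.trans (key2 T hT (h2.trans (Finset.card_le_card hST)) hTV))
      (hM.of_le fun x _ => by split_ifs <;> simp) ⟨y, hy, fun h0 => hyb ?_⟩)
    exact deg_eq_zero_iff.1 h0 b (Finset.mem_sdiff.2 ⟨hbS, hbM⟩)
  · push Not at hb
    exact hno (exists_coloring_of_no_edges hm hk hV ih hS (Finset.card_pos.1 (by omega)) hSV
      fun y hy => deg_eq_zero_iff.2 fun b hb' => hb b hb' y hy)

end Multiplicity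

namespace Multiplicity

variable {α : Type*} [DecidableEq α]
variable {D : ℕ} {m m' : α → α → ℕ} {φ φ' : α → Bool} {k k' c : α → ℕ} {A B S V M : Finset α}
variable {x v : α}

/-! ### Extending colorings by one vertex -/

/-- Adding a vertex to the unrestricted forest. -/
lemma Coloring.insert_right (hm : IsMult m) (h : Coloring m φ k V M) (hv : v ∉ V)
    (hφ : φ v = true) (hd : deg m (V \ M) v ≤ 1) : Coloring m φ k (insert v V) M where
  subset := h.subset.trans (Finset.subset_insert _ _)
  allowed x hx hxM := by
    rcases Finset.mem_insert.1 hx with rfl | hx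
    · exact hφ
    · exact h.allowed x hx hxM
  deg_lt := h.deg_lt
  forest_left := h.forest_left
  forest_right := by
    rw [Finset.insert_sdiff_of_notMem _ fun hM => hv (h.subset hM)]
    exact h.forest_right.insert hm hd

/-- Adding a vertex to the forest of bounded degree. -/
lemma Coloring.insert_left (hm : IsMult m) (h : Coloring m φ k' V M) (hv : v ∉ V)
    (hd : deg m M v ≤ 1) (hkv : deg m M v < k v) (hk : ∀ x ∈ M, deg m M x + m x v < k x) :
    Coloring m φ k (insert v V) (insert v M) where
  subset := Finset.insert_subset_insert _ h.subset
  allowed x hx hxM := by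
    rcases Finset.mem_insert.1 hx with rfl | hx
    · exact absurd (Finset.mem_insert_self _ _) hxM
    · exact h.allowed x hx fun hM => hxM (Finset.mem_insert_of_mem hM)
  deg_lt x hx := by
    rw [deg_insert fun hM => hv (h.subset hM)]
    rcases Finset.mem_insert.1 hx with rfl | hx
    · rw [hm.self, zero_add]
      exact hkv
    · rw [add_comm]
      exact hk x hx
  forest_left := h.forest_left.insert hm hd
  forest_right := by
    have : insert v V \ insert v M = V \ M := by
      ext y
      have : y ∈ V → y ≠ v := fun h e => hv (e ▸ h)
      simp only [Finset.mem_sdiff, Finset.mem_insert]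
      tauto
    rw [this]
    exact h.forest_right

lemma pot_sub_le_pot_bump : pot D m φ k A - 2 * ∑ x ∈ A, (c x : ℤ) ≤
    pot D m φ (fun x => k x - c x) A := by
  rw [pot_eq_sub (k := k) (k' := fun x => k x - c x) (φ := φ) (φ' := φ), Finset.mul_sum]
  have : ∑ x ∈ A, (weight D φ k x - weight D φ (fun x => k x - c x) x) ≤
      ∑ x ∈ A, 2 * (c x : ℤ) := by
    refine Finset.sum_le_sum fun x _ => ?_
    rw [weight_sub_weight rfl]
    omega
  linarith

/-- The potential is the sum of the charges of the vertices. -/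
lemma pot_eq_sum_charge :
    pot D m φ k V = ∑ x ∈ V, (weight D φ k x - (D + 1) * (deg m V x : ℤ)) := by
  rw [pot, total, Finset.sum_sub_distrib, ← Finset.mul_sum]
  push_cast
  rfl

lemma deg_erase (hm : IsMult m) (hx : x ∈ V) : deg m (V.erase x) x = deg m V x := by
  conv_rhs => rw [← Finset.insert_erase hx, deg_insert (Finset.notMem_erase _ _), hm.self, zero_add]

/-! ### Minimal counterexamples -/

/-- A sparse weighted multigraph without coloring, all smaller ones having colorings. -/
structure Critical (D : ℕ) (m : α → α → ℕ) (φ : α → Bool) (k : α → ℕ) (V : Finset α) : Prop where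
  mult : IsMult m
  le : ∀ x ∈ V, k x ≤ D + 1
  sparse : Sparse D m φ k V
  below : ColorableBelow α D V.card
  two_le : 2 ≤ V.card
  not_colorable : ¬ ∃ M, Coloring m φ k V M

namespace Critical

lemma allowed (h : Critical D m φ k V) (hx : x ∈ V) : φ x = true :=
  (pot_ge_of_not_colorable h.mult h.le h.sparse h.below h.two_le h.not_colorable).1 x hx

lemma pot_ge (h : Critical D m φ k V) (hA : A ⊆ V) (hA2 : 2 ≤ A.card) (hAV : A ≠ V) :
    2 * (D : ℤ) + 2 ≤ pot D m φ k A :=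
  (pot_ge_of_not_colorable h.mult h.le h.sparse h.below h.two_le h.not_colorable).2 A hA hA2 hAV

lemma weight_eq (h : Critical D m φ k V) (hx : x ∈ V) : weight D φ k x = 2 * k x + 2 * D + 1 :=
  weight_of_true (h.allowed hx)

/-- The reserve `2D + 2` of proper sets pays for `D + 1` units of capacity. Singletons need no
reserve: an allowed vertex weighs at least `2D + 1` even without capacity. -/
lemma pot_bump_nonneg (h : Critical D m φ k V) (hA : A ⊆ V) (hne : A.Nonempty) (hAV : A ≠ V)
    (hc : ∑ x ∈ A, c x ≤ D + 1) : 0 ≤ pot D m φ (fun x => k x - c x) A := by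
  rcases Nat.lt_or_ge A.card 2 with h2 | h2
  · obtain ⟨x, rfl⟩ : ∃ x, A = {x} := Finset.card_eq_one.1 (by
      have := hne.card_pos
      omega)
    rw [pot_singleton h.mult, weight_of_true (h.allowed (hA (Finset.mem_singleton_self x)))]
    positivity
  · have h1 := h.pot_ge hA h2 hAV
    have h3 := pot_sub_le_pot_bump (D := D) (m := m) (φ := φ) (k := k) (c := c) (A := A)
    have h4 : ∑ x ∈ A, (c x : ℤ) ≤ D + 1 := by exact_mod_cast hc
    linarith

/-- Colorings of smaller weighted multigraphs. -/
lemma exists_coloring (h : Critical D m φ k V) (hm' : IsMult m') (hS : S ⊆ V) (hSV : S ≠ V)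
    (hk' : ∀ x ∈ S, k' x ≤ k x) (hs : Sparse D m' φ' k' S) : ∃ M, Coloring m' φ' k' S M :=
  h.below m' φ' k' S (Finset.card_lt_card (lt_of_le_of_ne hS hSV)) hm'
    (fun x hx => (hk' x hx).trans (h.le x (hS hx))) hs

lemma not_coloring (h : Critical D m φ k V) : ¬ Coloring m φ k V M :=
  fun hM => h.not_colorable ⟨M, hM⟩

/-- A vertex with at most one edge can be deleted and then added to the unrestricted forest as a
leaf or an isolated vertex. -/
lemma two_le_deg (h : Critical D m φ k V) (hv : v ∈ V) : 2 ≤ deg m V v := by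
  by_contra hd
  obtain ⟨M, hM⟩ := h.exists_coloring h.mult (Finset.erase_subset v V)
    (Finset.erase_ssubset hv).ne (fun _ _ => le_rfl)
    (fun A hA => h.sparse A (hA.trans (Finset.erase_subset _ _)))
  have := hM.insert_right h.mult (Finset.notMem_erase v V) (h.allowed hv) (by
    have := deg_mono (m := m) (x := v) (Finset.sdiff_subset (s := V.erase v) (t := M))
    rw [deg_erase h.mult hv] at this
    omega)
  rw [Finset.insert_erase hv] at this
  exact h.not_coloring this

/-- With at most two edges, either at most one goes to the unrestricted forest, which can take `v`,
or none goes to `M`, where `v` becomes isolated. -/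
lemma three_le_deg (h : Critical D m φ k V) (hv : v ∈ V) (hk : 1 ≤ k v) : 3 ≤ deg m V v := by
  by_contra hd
  obtain ⟨M, hM⟩ := h.exists_coloring h.mult (Finset.erase_subset v V)
    (Finset.erase_ssubset hv).ne (fun _ _ => le_rfl)
    (fun A hA => h.sparse A (hA.trans (Finset.erase_subset _ _)))
  have hsum := deg_add_deg_sdiff (m := m) (x := v) hM.subset
  rw [deg_erase h.mult hv] at hsum
  apply h.not_colorable
  rw [← Finset.insert_erase hv]
  by_cases h1 : deg m (V.erase v \ M) v ≤ 1
  · exact ⟨M, hM.insert_right h.mult (Finset.notMem_erase v V) (h.allowed hv) h1⟩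
  · have h0 : deg m M v = 0 := by omega
    refine ⟨_, hM.insert_left h.mult (Finset.notMem_erase v V) (by omega) (by omega)
      fun x hx => ?_⟩
    rw [h.mult.symm, deg_eq_zero_iff.1 h0 x hx, add_zero]
    exact hM.deg_lt x hx

/-- Lowering the capacities at the simple neighbors of a vertex of degree three. -/
lemma not_sparse_bump (h : Critical D m φ k V) (hv : v ∈ V) (hd : deg m V v = 3) (hk : 2 ≤ k v)
    (hc : ∀ y ∈ V, m v y = 1 → 1 ≤ c y ∨ k y = 0) :
    ¬ Sparse D m φ (fun x => k x - c x) (V.erase v) := by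
  intro hs
  obtain ⟨M, hM⟩ := h.exists_coloring h.mult (Finset.erase_subset v V)
    (Finset.erase_ssubset hv).ne (fun _ _ => Nat.sub_le _ _) hs
  have hsum := deg_add_deg_sdiff (m := m) (x := v) hM.subset
  rw [deg_erase h.mult hv] at hsum
  apply h.not_colorable
  rw [← Finset.insert_erase hv]
  -- In the second case at most one of the three edges goes to `M`, so its end is a simple neighbor,
  -- whose capacity was lowered to leave room for `v`. Neighbors along multiple edges cannot lie in
  -- `M` here, which is why `hc` ignores them.
  by_cases h1 : deg m (V.erase v \ M) v ≤ 1
  · exact ⟨M, (hM.of_le fun x _ => Nat.sub_le _ _).insert_right h.mult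
      (Finset.notMem_erase v V) (h.allowed hv) h1⟩
  · have h0 : deg m M v ≤ 1 := by omega
    refine ⟨_, hM.insert_left h.mult (Finset.notMem_erase v V) h0 (by omega) fun x hx => ?_⟩
    have h3 := hM.deg_lt x hx
    have h4 := le_deg (m := m) (x := v) hx
    have h5 := hc x (Finset.mem_of_mem_erase (hM.subset hx))
    rw [h.mult.symm]
    omega

/-- The integer charges, weight minus `D + 1` per edge end, add up to the potential of `V`, which is
at least `-1`. With two or more vertices they cannot all be negative. -/
lemma exists_charge_nonneg (h : Critical D m φ k V) :
    ∃ v ∈ V, ((D : ℤ) + 1) * deg m V v ≤ 2 * k v + 2 * D + 1 := by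
  by_contra! hcon
  have h1 := h.sparse V subset_rfl (Finset.card_pos.1 (by have := h.two_le; omega))
  rw [pot_eq_sum_charge] at h1
  have h2 : ∑ x ∈ V, (weight D φ k x - (D + 1) * (deg m V x : ℤ)) ≤ ∑ x ∈ V, (-1 : ℤ) := by
    refine Finset.sum_le_sum fun x hx => ?_
    have := hcon x hx
    rw [h.weight_eq hx]
    linarith
  have h3 := h.two_le
  simp only [Finset.sum_const, nsmul_eq_mul] at h2
  have : (2 : ℤ) ≤ V.card := by exact_mod_cast h3
  linarith

/-- A vertex of nonnegative charge has degree three. -/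
lemma exists_deg_eq_three (h : Critical D m φ k V) :
    ∃ v ∈ V, deg m V v = 3 ∧ 3 * D + 3 ≤ 2 * k v + 2 * D + 1 := by
  obtain ⟨v, hv, hd⟩ := h.exists_charge_nonneg
  have h1 : (D + 1) * deg m V v ≤ 2 * k v + 2 * D + 1 := by exact_mod_cast hd
  have h2 := h.le v hv
  have h3 := h.two_le_deg hv
  have h4 : 1 ≤ k v := by
    by_contra h0
    have : (D + 1) * 2 ≤ (D + 1) * deg m V v := Nat.mul_le_mul_left _ h3
    omega
  have h5 := h.three_le_deg hv h4
  have h6 : deg m V v < 4 := by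
    by_contra h0
    have : (D + 1) * 4 ≤ (D + 1) * deg m V v := Nat.mul_le_mul_left _ (by omega)
    omega
  have h7 : deg m V v = 3 := by omega
  refine ⟨v, hv, h7, ?_⟩
  rw [h7] at h1
  omega

/-- Lowering capacities by one for each edge at a vertex of degree three uses at most three units,
and `3 ≤ D + 1`. -/
lemma not_two_le (h : Critical D m φ k V) : ¬ 2 ≤ D := by
  intro hD
  obtain ⟨v, hv, hd, hk⟩ := h.exists_deg_eq_three
  refine h.not_sparse_bump (c := m v) hv hd (by omega) (fun y _ hy => Or.inl hy.ge) ?_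
  intro A hA hne
  have hAV : A ⊆ V := hA.trans (Finset.erase_subset _ _)
  refine le_trans (by norm_num) (h.pot_bump_nonneg hAV hne (fun e => ?_) ?_)
  · exact Finset.notMem_erase v V (hA (e ▸ hv))
  · have := deg_mono (m := m) (x := v) hAV
    simp only [deg] at this hd
    omega

end Critical

end Multiplicity

namespace Multiplicity

variable {α : Type*} [DecidableEq α]
variable {D : ℕ} {m m' : α → α → ℕ} {φ φ' : α → Bool} {k k' c : α → ℕ} {A B S V M : Finset α}
variable {x v : α}

/-! ### Reducible configurations for degree bound one -/

lemma exists_of_deg_eq_two (h : deg m A x = 2) :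
    (∃ a ∈ A, m x a = 2 ∧ ∀ y ∈ A, y ≠ a → m x y = 0) ∨
      ∃ a ∈ A, ∃ b ∈ A, a ≠ b ∧ m x a = 1 ∧ m x b = 1 ∧
        ∀ y ∈ A, y ≠ a → y ≠ b → m x y = 0 := by
  have h0 : ∃ a ∈ A, m x a ≠ 0 := by
    by_contra! h0
    rw [deg_eq_zero_iff.2 h0] at h
    omega
  obtain ⟨a, ha, ha0⟩ := h0
  have h1 : m x a + deg m (A.erase a) x = 2 := by
    rw [← deg_insert (Finset.notMem_erase _ _), Finset.insert_erase ha, h]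
  by_cases ha2 : m x a = 2
  · left
    refine ⟨a, ha, ha2, fun y hy hya => ?_⟩
    exact deg_eq_zero_iff.1 (by omega : deg m (A.erase a) x = 0) y (Finset.mem_erase.2 ⟨hya, hy⟩)
  · right
    have h2 : ∃ b ∈ A.erase a, m x b ≠ 0 := by
      by_contra! h0
      rw [deg_eq_zero_iff.2 h0] at h1
      omega
    obtain ⟨b, hb, hb0⟩ := h2
    have h3 : m x b + deg m ((A.erase a).erase b) x = deg m (A.erase a) x := by
      rw [← deg_insert (Finset.notMem_erase _ _), Finset.insert_erase hb]
    refine ⟨a, ha, b, Finset.mem_of_mem_erase hb, (Finset.ne_of_mem_erase hb).symm, by omega,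
      by omega, fun y hy hya hyb => ?_⟩
    exact deg_eq_zero_iff.1 (by omega : deg m ((A.erase a).erase b) x = 0) y
      (Finset.mem_erase.2 ⟨hyb, Finset.mem_erase.2 ⟨hya, hy⟩⟩)

lemma addEdge_of_ne {a b y : α} (ha : x ≠ a) (hb : x ≠ b) : addEdge m a b x y = m x y := by
  simp [addEdge, ha, hb]

lemma deg_two_le_of_mem {y z : α} (hyz : y ≠ z) (hy : y ∈ A) (hz : z ∈ A) (h1 : m x y = 1)
    (h2 : m x z = 1) : 2 ≤ deg m A x := by
  have h3 : deg m A x = m x y + deg m (A.erase y) x := by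
    rw [← deg_insert (Finset.notMem_erase _ _), Finset.insert_erase hy]
  have h4 := le_deg (m := m) (x := x) (Finset.mem_erase.2 ⟨hyz.symm, hz⟩)
  omega

namespace Critical

/-- Lowering the capacities of the simple neighbors must destroy sparsity, while a loss of two units
never does. So the violating set `A` contains three simple neighbors of positive capacity, and its
potential is at most `4`. Adding `v` changes the potential by `7 - 12`, so `insert v A` has
potential at most `-1`. This is too small for a proper set, so it is all of `V`. -/
lemma pot_eq_and_simple (h : Critical 1 m φ k V) (hv : v ∈ V) (hd : deg m V v = 3)
    (hk : k v = 2) :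
    pot 1 m φ k V = -1 ∧ ∀ y ∈ V, m v y ≠ 0 → m v y = 1 ∧ 1 ≤ k y := by
  set c : α → ℕ := fun y => if m v y = 1 ∧ k y ≠ 0 then 1 else 0 with hc
  have hle : ∀ y, c y ≤ m v y := fun y => by
    simp only [hc]
    split_ifs <;> omega
  have h1 := h.not_sparse_bump (c := c) hv hd hk.ge fun y _ hy => by
    simp only [hc, hy]
    by_cases h0 : k y = 0 <;> simp [h0]
  simp only [Sparse, not_forall] at h1
  obtain ⟨A, hA, hne, hlt⟩ := h1
  have hAV := hA.trans (Finset.erase_subset v V)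
  have hvA : v ∉ A := fun hvA => Finset.notMem_erase v V (hA hvA)
  have hAneV : A ≠ V := fun e => hvA (e ▸ hv)
  have hA3 : ¬ ∑ y ∈ A, c y ≤ 2 := fun h2 =>
    hlt (le_trans (by norm_num) (h.pot_bump_nonneg hAV hne hAneV h2))
  have hAd : ∑ y ∈ A, c y ≤ deg m A v := Finset.sum_le_sum fun y _ => hle y
  have hde : deg m A v + deg m (V \ A) v = 3 := by rw [deg_add_deg_sdiff hAV, hd]
  have hrest := deg_eq_zero_iff.1 (by omega : deg m (V \ A) v = 0)
  have heq := (Finset.sum_eq_sum_iff_of_le (s := A) (f := c) (g := m v) fun y _ => hle y).1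
    (show ∑ y ∈ A, c y = deg m A v by omega)
  have hp1 := pot_sub_le_pot_bump (D := 1) (m := m) (φ := φ) (k := k) (c := c) (A := A)
  have hp2 := pot_insert (D := 1) (φ := φ) (k := k) h.mult hvA
  have hs3 : ∑ y ∈ A, c y = 3 := by omega
  have hd3 : deg m A v = 3 := by omega
  have hs3' : ∑ y ∈ A, (c y : ℤ) = 3 := by exact_mod_cast hs3
  rw [h.weight_eq hv, hk, hd3] at hp2
  push_cast at hp2
  have hsub : insert v A ⊆ V := Finset.insert_subset hv hAV
  constructor
  · by_cases hiV : insert v A = V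
    · have := h.sparse V subset_rfl ⟨v, hv⟩
      rw [hiV] at hp2
      linarith
    · have := h.pot_ge hsub (by
        rw [Finset.card_insert_of_notMem hvA]
        have := hne.card_pos
        omega) hiV
      push_cast at this
      linarith
  · intro y hy h0
    have hyA : y ∈ A := by
      by_contra hyA
      exact h0 (hrest y (Finset.mem_sdiff.2 ⟨hy, hyA⟩))
    have := heq y hyA
    simp only [hc] at this
    split_ifs at this <;> omega

lemma mult_le_one (h : Critical 1 m φ k V) (hv : v ∈ V) (hd : deg m V v = 3)
    (hk : k v = 2) {y : α} (hy : y ∈ V) : m v y ≤ 1 := by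
  by_contra h0
  have := (h.pot_eq_and_simple hv hd hk).2 y hy (by omega)
  omega

/-- Vertices of degree three and largest capacity are independent. -/
lemma mult_eq_zero_of_deg_three (h : Critical 1 m φ k V) {w : α} (hv : v ∈ V)
    (hd : deg m V v = 3) (hk : k v = 2) (hw : w ∈ V) (hdw : deg m V w = 3) (hkw : k w = 2) :
    m v w = 0 := by
  by_contra h0
  have hm := h.mult
  have hvw1 := ((h.pot_eq_and_simple hv hd hk).2 w hw h0).1
  have hwv1 : m w v = 1 := by rw [hm.symm, hvw1]
  have hne : v ≠ w := by
    rintro rfl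
    exact h0 (hm.self v)
  set W := (V.erase v).erase w with hW
  have hwVv : w ∈ V.erase v := Finset.mem_erase.2 ⟨hne.symm, hw⟩
  have hwW : w ∉ W := Finset.notMem_erase _ _
  have hvW : v ∉ W := fun hv => by simp [hW] at hv
  have hV1 : insert w W = V.erase v := Finset.insert_erase hwVv
  have hV2 : insert v (insert w W) = V := by rw [hV1, Finset.insert_erase hv]
  have hvwW : v ∉ insert w W := by simp [hne, hvW]
  have hwvW : w ∉ insert v W := by simp [hne.symm, hwW]
  have hdv2 : deg m W v = 2 := by
    have := hd
    rw [← hV2, deg_insert hvwW, deg_insert hwW, hm.self] at this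
    omega
  have hdw2 : deg m W w = 2 := by
    have := hdw
    rw [← hV2, deg_insert hvwW, deg_insert hwW, hm.self] at this
    omega
  have hWV : W ⊆ V := (Finset.erase_subset _ _).trans (Finset.erase_subset _ _)
  have hWneV : W ≠ V := fun e => hvW (e ▸ hv)
  -- Only the two units for the remaining edges at `w` are affordable. They suffice: `w` joins `M`
  -- next to an old vertex only if `v` goes to the unrestricted forest. If `v` has two edges into
  -- that forest, it has no neighbor in `M` among the old vertices and needs no reserved capacity
  -- there; if `w` has two as well, both go to `M`, where they are adjacent only to each other.
  obtain ⟨M, hM⟩ := h.exists_coloring (k' := fun x => k x - m w x) (φ' := φ) hm hWV hWneV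
    (fun _ _ => Nat.sub_le _ _) fun A hA hAne => by
      refine le_trans (by norm_num) (h.pot_bump_nonneg (hA.trans hWV) hAne
        (fun e => hvW (hA (e ▸ hv))) ?_)
      have : deg m A w ≤ deg m W w := deg_mono hA
      simp only [deg] at this hdw2
      omega
  have hsv := deg_add_deg_sdiff (m := m) (x := v) hM.subset
  have hsw := deg_add_deg_sdiff (m := m) (x := w) hM.subset
  have hvM : v ∉ M := fun h' => hvW (hM.subset h')
  have hwM : w ∉ M := fun h' => hwW (hM.subset h')
  apply h.not_colorable
  rw [← hV2, Finset.insert_comm]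
  by_cases h1 : deg m (W \ M) v ≤ 1
  · have hM1 := hM.insert_right hm hvW (h.allowed hv) h1
    have hdw' : deg m (insert v W \ M) w = 1 + deg m (W \ M) w := by
      rw [Finset.insert_sdiff_of_notMem _ hvM, deg_insert (by simp [hvW]), hwv1]
    by_cases h2 : deg m (W \ M) w = 0
    · exact ⟨M, (hM1.of_le fun x _ => Nat.sub_le _ _).insert_right hm hwvW (h.allowed hw)
        (by omega)⟩
    · refine ⟨_, hM1.insert_left hm hwvW (by omega) (by omega) fun u hu => ?_⟩
      have := hM.deg_lt u hu
      rw [hm.symm u w]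
      omega
  · have h0v : deg m M v = 0 := by omega
    have hzv : ∀ u ∈ M, m u v = 0 := fun u hu => by
      rw [hm.symm]
      exact deg_eq_zero_iff.1 h0v u hu
    have hM0 : Coloring m φ k W M := hM.of_le fun x _ => Nat.sub_le _ _
    by_cases h2 : deg m (W \ M) w ≤ 1
    · rw [Finset.insert_comm]
      have hM1 := hM0.insert_right hm hwW (h.allowed hw) h2
      refine ⟨_, hM1.insert_left hm hvwW (by omega) (by omega) fun u hu => ?_⟩
      rw [hzv u hu, add_zero]
      exact hM1.deg_lt u hu
    · have h0w : deg m M w = 0 := by omega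
      have hzw : ∀ u ∈ M, m u w = 0 := fun u hu => by
        rw [hm.symm]
        exact deg_eq_zero_iff.1 h0w u hu
      have hM1 := hM0.insert_left (k := k) hm hvW (by omega) (by omega) fun u hu => by
        rw [hzv u hu, add_zero]
        exact hM0.deg_lt u hu
      have hdw' : deg m (insert v M) w = 1 := by rw [deg_insert hvM, hwv1, h0w]
      refine ⟨_, hM1.insert_left hm hwvW hdw'.le (by omega) fun u hu => ?_⟩
      rw [deg_insert hvM]
      rcases Finset.mem_insert.1 hu with rfl | hu
      · rw [hm.self, h0v, hvw1]
        omega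
      · rw [hzv u hu, hzw u hu, zero_add, add_zero]
        exact hM0.deg_lt u hu

/-- Vertices of degree three with different positive capacities are not adjacent. -/
lemma mult_eq_zero_of_capacity_one (h : Critical 1 m φ k V) (hv : v ∈ V)
    (hd : deg m V v = 3) (hk : k v = 2) (hx : x ∈ V) (hdx : deg m V x = 3) (hkx : k x = 1) :
    m v x = 0 := by
  by_contra h0
  have hm := h.mult
  have hvx1 := ((h.pot_eq_and_simple hv hd hk).2 x hx h0).1
  have hxv1 : m x v = 1 := by rw [hm.symm, hvx1]
  have hne : v ≠ x := by
    rintro rfl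
    exact h0 (hm.self v)
  set W := (V.erase v).erase x with hW
  have hxVv : x ∈ V.erase v := Finset.mem_erase.2 ⟨hne.symm, hx⟩
  have hxW : x ∉ W := Finset.notMem_erase _ _
  have hvW : v ∉ W := fun hv => by simp [hW] at hv
  have hV1 : insert x W = V.erase v := Finset.insert_erase hxVv
  have hV2 : insert v (insert x W) = V := by rw [hV1, Finset.insert_erase hv]
  have hvxW : v ∉ insert x W := by simp [hne, hvW]
  have hxvW : x ∉ insert v W := by simp [hne.symm, hxW]
  have hdv2 : deg m W v = 2 := by
    have := hd
    rw [← hV2, deg_insert hvxW, deg_insert hxW, hm.self] at this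
    omega
  have hdx2 : deg m W x = 2 := by
    have := hdx
    rw [← hV2, deg_insert hvxW, deg_insert hxW, hm.self] at this
    omega
  have hWV : W ⊆ V := (Finset.erase_subset _ _).trans (Finset.erase_subset _ _)
  have hWneV : W ≠ V := fun e => hvW (e ▸ hv)
  have hxs : ∀ A ⊆ W, pot 1 m φ k (insert x A) = pot 1 m φ k A + 5 - 4 * deg m A x := by
    intro A hA
    rw [pot_insert hm fun h' => hxW (hA h'), h.weight_eq hx, hkx]
    push_cast
    ring
  have hxg : ∀ A ⊆ W, A.Nonempty → 4 ≤ pot 1 m φ k (insert x A) := by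
    intro A hA hAne
    have hxA : x ∉ A := fun h' => hxW (hA h')
    have := h.pot_ge (Finset.insert_subset hx (hA.trans hWV)) (by
      rw [Finset.card_insert_of_notMem hxA]
      have := hAne.card_pos
      omega) (fun e => hvxW (Finset.insert_subset_insert x hA (e ▸ hv)))
    push_cast at this
    linarith
  rcases exists_of_deg_eq_two hdx2 with ⟨a, ha, ha2, hrest⟩ | ⟨a, ha, b, hb, hab, ha1, hb1, hrest⟩
  · have hka : 2 ≤ k a := by
      have h1 := hxg {a} (by simpa using ha) (Finset.singleton_nonempty a)
      rw [hxs {a} (by simpa using ha), pot_singleton hm, h.weight_eq (hWV ha)] at h1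
      simp only [deg, Finset.sum_singleton, ha2] at h1
      push_cast at h1
      omega
    -- If both remaining edges at `x` go to `a`, forcing `a` into `M` leaves `x` free to enter the
    -- unrestricted forest. Withdrawing the flag costs `2D + 3 = 5`, which a potential of at least
    -- `4` allows.
    set φ' : α → Bool := fun y => if y = a then false else φ y with hφ'
    obtain ⟨M, hM⟩ := h.exists_coloring (k' := k) (φ' := φ') hm hWV hWneV
      (fun _ _ => le_rfl) fun A hA hAne => by
        by_cases hA2 : 2 ≤ A.card
        · have h1 := h.pot_ge (hA.trans hWV) hA2 fun e => hvW (hA (e ▸ hv))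
          rw [pot_eq_sub (φ := φ) (φ' := φ') (k := k)]
          have h3 : ∑ y ∈ A, (weight 1 φ k y - weight 1 φ' k y) ≤
              ∑ y ∈ A, if y = a then 5 else 0 := by
            refine Finset.sum_le_sum fun y _ => ?_
            by_cases hya : y = a
            · simp only [weight, hφ', hya, if_true]
              split_ifs <;> simp_all
            · simp [weight, hφ', hya]
          rw [Finset.sum_ite_eq'] at h3
          push_cast at h1
          split_ifs at h3 <;> linarith
        · obtain ⟨y, rfl⟩ : ∃ y, A = {y} := Finset.card_eq_one.1 (by
            have := hAne.card_pos
            omega)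
          rw [pot_singleton hm, weight]
          by_cases hya : y = a
          · subst hya
            simp [hφ']
            omega
          · have := h.allowed (hWV (hA (Finset.mem_singleton_self y)))
            simp [hφ', hya, this]
            omega
    have haM : a ∈ M := by
      by_contra haM
      have := hM.allowed a ha haM
      simp [hφ'] at this
    have hM0 : Coloring m φ k W M := hM.of_not_forced fun y hy => by
      simp only [hφ'] at hy
      split_ifs at hy
      exact hy
    have hx0 : deg m (W \ M) x = 0 := deg_eq_zero_iff.2 fun y hy =>
      hrest y (Finset.sdiff_subset hy) fun e => (Finset.mem_sdiff.1 hy).2 (e ▸ haM)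
    have hsv := deg_add_deg_sdiff (m := m) (x := v) hM.subset
    have hvM : v ∉ M := fun h' => hvW (hM.subset h')
    apply h.not_colorable
    rw [← hV2, Finset.insert_comm]
    by_cases h1 : deg m (W \ M) v ≤ 1
    · refine ⟨M, (hM0.insert_right hm hvW (h.allowed hv) h1).insert_right hm hxvW
        (h.allowed hx) ?_⟩
      rw [Finset.insert_sdiff_of_notMem _ hvM, deg_insert (by simp [hvW]), hxv1, hx0]
    · have h0v : deg m M v = 0 := by omega
      have hM1 := hM0.insert_left (k := k) hm hvW (by omega) (by omega) fun u hu => by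
        rw [hm.symm, deg_eq_zero_iff.1 h0v u hu, add_zero]
        exact hM0.deg_lt u hu
      refine ⟨_, hM1.insert_right hm hxvW (h.allowed hx) ?_⟩
      have : insert v W \ insert v M = W \ M := by
        ext y
        have : y ∈ W → y ≠ v := fun h e => hvW (e ▸ h)
        simp only [Finset.mem_sdiff, Finset.mem_insert]
        tauto
      rw [this, hx0]
      exact Nat.zero_le _
  -- With distinct neighbors `a` and `b`, an added edge between them lets `x` enter the unrestricted
  -- forest by subdivision, and the capacities at the neighbors of `v` are lowered too. Sets
  -- containing both `a` and `b` have potential at least `7`, because adding `x` changes it by at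
  -- most `5 - 8` and must leave at least `4`; the total cost is `4 + 4`.
  · obtain ⟨M, hM⟩ := h.exists_coloring (k' := fun x => k x - m v x) (φ' := φ)
      (hm.addEdge hab) hWV hWneV (fun _ _ => Nat.sub_le _ _) fun A hA hAne => by
        have hdA : deg m A v ≤ 2 := hdv2 ▸ deg_mono hA
        rw [pot_addEdge hab]
        split_ifs with hAab
        · have h1 := hxg A hA hAne
          rw [hxs A hA] at h1
          have h2 : 2 ≤ deg m A x := deg_two_le_of_mem hab hAab.1 hAab.2 ha1 hb1
          have h3 := pot_sub_le_pot_bump (D := 1) (m := m) (φ := φ) (k := k) (c := m v) (A := A)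
          have h4 : ∑ y ∈ A, (m v y : ℤ) ≤ 2 := by exact_mod_cast hdA
          push_cast
          have h5 : (2 : ℤ) ≤ deg m A x := by exact_mod_cast h2
          linarith
        · have := h.pot_bump_nonneg (c := m v) (hA.trans hWV) hAne
            (fun e => hvW (hA (e ▸ hv))) hdA
          linarith
    have hxM : x ∉ M := fun h' => hxW (hM.subset h')
    have hF : Forest m (insert x (W \ M)) :=
      hM.forest_right.subdivide hm hab ha1.le hb1.le fun y hy => hrest y (Finset.sdiff_subset hy)
    have hM1 : Coloring m φ (fun x => k x - m v x) (insert x W) M := by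
      refine ⟨hM.subset.trans (Finset.subset_insert _ _), fun y hy hyM => ?_, fun y hy => ?_, ?_, ?_⟩
      · refine h.allowed ?_
        rcases Finset.mem_insert.1 hy with rfl | hy
        · exact hx
        · exact hWV hy
      · exact lt_of_le_of_lt (Finset.sum_le_sum fun z _ => le_addEdge) (hM.deg_lt y hy)
      · exact hM.forest_left.of_le fun _ _ _ _ => le_addEdge
      · rwa [Finset.insert_sdiff_of_notMem _ hxM]
    have hsv := deg_add_deg_sdiff (m := m) (x := v) hM.subset
    have hdv' : deg m (insert x W \ M) v = 1 + deg m (W \ M) v := by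
      rw [Finset.insert_sdiff_of_notMem _ hxM, deg_insert (by simp [hxW]), hvx1]
    apply h.not_colorable
    rw [← hV2]
    by_cases h1 : deg m (W \ M) v = 0
    · exact ⟨M, (hM1.of_le fun x _ => Nat.sub_le _ _).insert_right hm hvxW (h.allowed hv)
        (by omega)⟩
    · refine ⟨_, hM1.insert_left hm hvxW (by omega) (by omega) fun u hu => ?_⟩
      have := hM1.deg_lt u hu
      rw [hm.symm u v]
      omega

end Critical

end Multiplicity

/-! ### A vertex of degree four with only small neighbors -/

namespace Multiplicity

variable {α : Type*} [DecidableEq α]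
variable {D : ℕ} {m m' : α → α → ℕ} {φ φ' : α → Bool} {k k' c : α → ℕ} {A B S V M : Finset α}
variable {x v : α}

/-- A set on which the sum of small numbers is four has four elements. -/
lemma exists_four_of_deg (h : deg m A x = 4) (h1 : ∀ y ∈ A, m x y ≤ 1) :
    ∃ a b c d, ({a, b, c, d} : Finset α) ⊆ A ∧ a ≠ b ∧ a ≠ c ∧ a ≠ d ∧ b ≠ c ∧ b ≠ d ∧ c ≠ d ∧
      m x a = 1 ∧ m x b = 1 ∧ m x c = 1 ∧ m x d = 1 ∧
      ∀ y ∈ A, y ∉ ({a, b, c, d} : Finset α) → m x y = 0 := by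
  have hcard : (A.filter fun y => m x y ≠ 0).card = 4 := by
    rw [Finset.card_filter, ← h, deg]
    refine Finset.sum_congr rfl fun y hy => ?_
    have := h1 y hy
    split_ifs <;> omega
  obtain ⟨a, t, hat, ht, hcard'⟩ := Finset.card_eq_succ.1 hcard
  obtain ⟨b, c, d, hbc, hbd, hcd, rfl⟩ := Finset.card_eq_three.1 hcard'
  have hmem : ∀ y, y ∈ ({a, b, c, d} : Finset α) ↔ y ∈ A ∧ m x y ≠ 0 := fun y => by
    rw [ht, Finset.mem_filter]
  have hone : ∀ y ∈ ({a, b, c, d} : Finset α), m x y = 1 := fun y hy => by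
    have := h1 y ((hmem y).1 hy).1
    have := ((hmem y).1 hy).2
    omega
  simp only [Finset.mem_insert, Finset.mem_singleton, not_or] at hat
  refine ⟨a, b, c, d, fun y hy => ((hmem y).1 hy).1, hat.1, hat.2.1, hat.2.2, hbc, hbd, hcd,
    hone a (by simp), hone b (by simp), hone c (by simp), hone d (by simp), fun y hy hyn => ?_⟩
  by_contra h0
  exact hyn ((hmem y).2 ⟨hy, h0⟩)

namespace Critical

lemma pot_insert_le (h : Critical 1 m φ k V) (hx : x ∈ V) (hxA : x ∉ A) {d : ℕ}
    (hd : d ≤ deg m A x) : pot 1 m φ k (insert x A) ≤ pot 1 m φ k A + 7 - 4 * d := by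
  rw [pot_insert h.mult hxA, h.weight_eq hx]
  have h1 : (k x : ℤ) ≤ 2 := by exact_mod_cast h.le x hx
  have h2 : (d : ℤ) ≤ deg m A x := by exact_mod_cast hd
  push_cast
  linarith

set_option maxHeartbeats 400000 in
/-- A vertex of degree four has a neighbor that is not of degree three and largest capacity. -/
lemma exists_neighbor_of_deg_four (h : Critical 1 m φ k V) (hx : x ∈ V) (hdx : deg m V x = 4)
    (hkx : k x = 2) : ∃ y ∈ V, m x y ≠ 0 ∧ ¬ (k y = 2 ∧ deg m V y = 3) := by
  by_contra! hcon
  have hm := h.mult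
  have hle : ∀ y ∈ V, m x y ≤ 1 := fun y hy => by
    by_cases h0 : m x y = 0
    · omega
    · obtain ⟨hk, hd⟩ := hcon y hy h0
      rw [hm.symm]
      exact h.mult_le_one hy hd hk hx
  obtain ⟨v₁, v₂, v₃, v₄, hsub, h12, h13, h14, h23, h24, h34, hx1, hx2, hx3, hx4, hrest⟩ :=
    exists_four_of_deg hdx hle
  set N : Finset α := {v₁, v₂, v₃, v₄} with hN
  have hN1 : v₁ ∈ N := by simp [hN]
  have hN2 : v₂ ∈ N := by simp [hN]
  have hN3 : v₃ ∈ N := by simp [hN]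
  have hN4 : v₄ ∈ N := by simp [hN]
  have hNm : ∀ v ∈ N, m x v = 1 := fun v hv => by
    simp only [hN, Finset.mem_insert, Finset.mem_singleton] at hv
    rcases hv with rfl | rfl | rfl | rfl <;> assumption
  have hlow : ∀ v ∈ N, k v = 2 ∧ deg m V v = 3 := fun v hv =>
    hcon v (hsub hv) (by rw [hNm v hv]; omega)
  have hNN : ∀ v ∈ N, ∀ w ∈ N, m v w = 0 := fun v hv w hw =>
    h.mult_eq_zero_of_deg_three (hsub hv) (hlow v hv).2 (hlow v hv).1 (hsub hw) (hlow w hw).2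
      (hlow w hw).1
  have hxN : x ∉ N := fun hxN => by
    have := hNm x hxN
    rw [hm.self] at this
    omega
  have hxNV : insert x N ⊆ V := Finset.insert_subset hx hsub
  set W := V \ insert x N with hW
  have hWV : W ⊆ V := Finset.sdiff_subset
  have hxW : x ∉ W := fun h' => (Finset.mem_sdiff.1 h').2 (Finset.mem_insert_self _ _)
  have hNW : ∀ v ∈ N, v ∉ W := fun v hv h' =>
    (Finset.mem_sdiff.1 h').2 (Finset.mem_insert_of_mem hv)
  have hxW0 : ∀ y ∈ W, m x y = 0 := fun y hy =>
    hrest y (hWV hy) fun hyN => hNW y hyN hy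
  have hN0 : ∀ v ∈ N, deg m N v = 0 := fun v hv => deg_eq_zero_iff.2 (hNN v hv)
  have hdW : ∀ v ∈ N, deg m W v = 2 := fun v hv => by
    have h1 := deg_add_deg_sdiff (m := m) (x := v) hxNV
    rw [deg_insert hxN, hN0 v hv, hm.symm, hNm v hv, (hlow v hv).2, ← hW] at h1
    omega
  have hpair : ∀ v ∈ N, ∃ y ∈ W, ∃ z ∈ W, y ≠ z ∧ m v y = 1 ∧ m v z = 1 ∧
      ∀ u ∈ W ∪ N, u ≠ y → u ≠ z → m v u = 0 := fun v hv => by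
    rcases exists_of_deg_eq_two (hdW v hv) with ⟨a, ha, ha2, _⟩ | ⟨a, ha, b, hb, hab, ha1, hb1, hr⟩
    · have := h.mult_le_one (hsub hv) (hlow v hv).2 (hlow v hv).1 (hWV ha)
      omega
    · refine ⟨a, ha, b, hb, hab, ha1, hb1, fun u hu hua hub => ?_⟩
      rcases Finset.mem_union.1 hu with hu | hu
      · exact hr u hu hua hub
      · exact hNN v hv u hu
  obtain ⟨y₁, hy1, z₁, hz1, hyz1, hm1y, hm1z, hr1⟩ := hpair v₁ hN1
  obtain ⟨y₂, hy2, z₂, hz2, hyz2, hm2y, hm2z, hr2⟩ := hpair v₂ hN2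
  obtain ⟨y₃, hy3, z₃, hz3, hyz3, hm3y, hm3z, hr3⟩ := hpair v₃ hN3
  have hWne : ∀ v ∈ N, ∀ y ∈ W, v ≠ y := fun v hv y hy e => hNW v hv (e ▸ hy)
  -- The new edges stand for `v₁`, `v₂`, `v₃`, which are to be placed in the unrestricted forest by
  -- subdivision. The vertices `x` and `v₄` remain flexible: once the first three are there, `x` can
  -- go to `M`, where `v₄` is its only possible neighbor.
  set m1 := addEdge m y₁ z₁ with hm1
  set m2 := addEdge m1 y₂ z₂ with hm2
  set m3 := addEdge m2 y₃ z₃ with hm3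
  have hM1 : IsMult m1 := hm.addEdge hyz1
  have hM2 : IsMult m2 := hM1.addEdge hyz2
  have hM3 : IsMult m3 := hM2.addEdge hyz3
  have em1 : ∀ v ∈ N, ∀ u, m1 v u = m v u := fun v hv u =>
    addEdge_of_ne (hWne v hv _ hy1) (hWne v hv _ hz1)
  have em2 : ∀ v ∈ N, ∀ u, m2 v u = m v u := fun v hv u => by
    rw [← em1 v hv u]
    exact addEdge_of_ne (hWne v hv _ hy2) (hWne v hv _ hz2)
  have hle3 : ∀ a b, m a b ≤ m3 a b := fun a b =>
    le_addEdge.trans (le_addEdge.trans le_addEdge)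
  -- two of the new edges inside a set
  have htwo : ∀ A ⊆ W, A.Nonempty → ∀ v ∈ N, ∀ w ∈ N, v ≠ w → v ≠ v₄ → w ≠ v₄ →
      2 ≤ deg m A v → 2 ≤ deg m A w → 7 ≤ pot 1 m φ k A := by
    intro A hA hne v hv w hw hvw hv4 hw4 hdv hdw
    have hvA : v ∉ A := fun h' => hNW v hv (hA h')
    have hwA : w ∉ insert v A := by
      simp only [Finset.mem_insert, not_or]
      exact ⟨hvw.symm, fun h' => hNW w hw (hA h')⟩
    have hxA : x ∉ insert w (insert v A) := by
      simp only [Finset.mem_insert, not_or]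
      exact ⟨fun e => hxN (e ▸ hw), fun e => hxN (e ▸ hv), fun h' => hxW (hA h')⟩
    have h1 := h.pot_insert_le (hsub hv) hvA hdv
    have h2 := h.pot_insert_le (hsub hw) hwA (hdw.trans (deg_mono (Finset.subset_insert _ _)))
    have h3 := h.pot_insert_le hx hxA (d := 2) (by
      exact deg_two_le_of_mem hvw (by simp) (by simp) (hNm v hv) (hNm w hw))
    have h4 := h.pot_ge (A := insert x (insert w (insert v A)))
      (Finset.insert_subset hx (Finset.insert_subset (hsub hw) (Finset.insert_subset (hsub hv)
        (hA.trans hWV))))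
      (by
        rw [Finset.card_insert_of_notMem hxA, Finset.card_insert_of_notMem hwA]
        omega)
      (fun e => by
        have := hsub hN4
        rw [← e] at this
        simp only [Finset.mem_insert] at this
        rcases this with e | e | e | e
        · exact hxN (e ▸ hN4)
        · exact hw4 e.symm
        · exact hv4 e.symm
        · exact hNW v₄ hN4 (hA e))
    push_cast at h1 h2 h3 h4
    linarith
  -- Adding the three vertices and `x` changes the potential by at most `4 * 7 - 4 * 9 = -8`. The
  -- enlarged set misses `v₄`, so it is proper and has potential at least `4`.
  have hthree : ∀ A ⊆ W, A.Nonempty → 2 ≤ deg m A v₁ → 2 ≤ deg m A v₂ → 2 ≤ deg m A v₃ →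
      12 ≤ pot 1 m φ k A := by
    intro A hA hne hd1 hd2 hd3
    have h1A : v₁ ∉ A := fun h' => hNW v₁ hN1 (hA h')
    have h2A : v₂ ∉ insert v₁ A := by
      simp only [Finset.mem_insert, not_or]
      exact ⟨h12.symm, fun h' => hNW v₂ hN2 (hA h')⟩
    have h3A : v₃ ∉ insert v₂ (insert v₁ A) := by
      simp only [Finset.mem_insert, not_or]
      exact ⟨h23.symm, h13.symm, fun h' => hNW v₃ hN3 (hA h')⟩
    have hxA : x ∉ insert v₃ (insert v₂ (insert v₁ A)) := by
      simp only [Finset.mem_insert, not_or]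
      exact ⟨fun e => hxN (e ▸ hN3), fun e => hxN (e ▸ hN2), fun e => hxN (e ▸ hN1),
        fun h' => hxW (hA h')⟩
    have h1 := h.pot_insert_le (hsub hN1) h1A hd1
    have h2 := h.pot_insert_le (hsub hN2) h2A (hd2.trans (deg_mono (Finset.subset_insert _ _)))
    have h3 := h.pot_insert_le (hsub hN3) h3A (hd3.trans (deg_mono
      ((Finset.subset_insert _ _).trans (Finset.subset_insert _ _))))
    have h4 := h.pot_insert_le hx hxA (d := 3) (by
      rw [deg_insert h3A, deg_insert h2A, deg_insert h1A, hx1, hx2, hx3]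
      omega)
    have h5 := h.pot_ge (A := insert x (insert v₃ (insert v₂ (insert v₁ A))))
      (Finset.insert_subset hx (Finset.insert_subset (hsub hN3) (Finset.insert_subset (hsub hN2)
        (Finset.insert_subset (hsub hN1) (hA.trans hWV)))))
      (by
        rw [Finset.card_insert_of_notMem hxA, Finset.card_insert_of_notMem h3A]
        omega)
      (fun e => by
        have := hsub hN4
        rw [← e] at this
        simp only [Finset.mem_insert] at this
        rcases this with e | e | e | e | e
        · exact hxN (e ▸ hN4)
        · exact h34 e.symm
        · exact h24 e.symm
        · exact h14 e.symm
        · exact hNW v₄ hN4 (hA e))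
    push_cast at h1 h2 h3 h4 h5
    linarith
  have hWneV : W ≠ V := fun e => hxW (e ▸ hx)
  -- Each new edge costs `4`: one, two or three of them inside `A` are covered by the lower bounds
  -- `4`, `7` and `12` for the potential of `A`, up to the permitted `-1`.
  obtain ⟨M, hM⟩ := h.exists_coloring (k' := k) (φ' := φ) hM3 hWV hWneV
    (fun _ _ => le_rfl) fun A hA hAne => by
      have hd1 : y₁ ∈ A ∧ z₁ ∈ A → 2 ≤ deg m A v₁ := fun ha =>
        deg_two_le_of_mem hyz1 ha.1 ha.2 hm1y hm1z
      have hd2 : y₂ ∈ A ∧ z₂ ∈ A → 2 ≤ deg m A v₂ := fun ha =>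
        deg_two_le_of_mem hyz2 ha.1 ha.2 hm2y hm2z
      have hd3 : y₃ ∈ A ∧ z₃ ∈ A → 2 ≤ deg m A v₃ := fun ha =>
        deg_two_le_of_mem hyz3 ha.1 ha.2 hm3y hm3z
      have hAV : A ≠ V := fun e => hxW (hA (e ▸ hx))
      have hone : ∀ y z, y ≠ z → y ∈ A ∧ z ∈ A → 4 ≤ pot 1 m φ k A := fun y z hyz ha => by
        have := h.pot_ge (hA.trans hWV) (Finset.one_lt_card.2 ⟨y, ha.1, z, ha.2, hyz⟩) hAV
        push_cast at this
        linarith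
      have h0 := h.sparse A (hA.trans hWV) hAne
      rw [pot_addEdge hyz3, pot_addEdge hyz2, pot_addEdge hyz1]
      push_cast
      by_cases e1 : y₁ ∈ A ∧ z₁ ∈ A <;> by_cases e2 : y₂ ∈ A ∧ z₂ ∈ A <;>
        by_cases e3 : y₃ ∈ A ∧ z₃ ∈ A <;> simp only [e1, e2, e3, if_true, if_false, and_self]
      · linarith [hthree A hA hAne (hd1 e1) (hd2 e2) (hd3 e3)]
      · linarith [htwo A hA hAne v₁ hN1 v₂ hN2 h12 h14 h24 (hd1 e1) (hd2 e2)]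
      · linarith [htwo A hA hAne v₁ hN1 v₃ hN3 h13 h14 h34 (hd1 e1) (hd3 e3)]
      · linarith [hone _ _ hyz1 e1]
      · linarith [htwo A hA hAne v₂ hN2 v₃ hN3 h23 h24 h34 (hd2 e2) (hd3 e3)]
      · linarith [hone _ _ hyz2 e2]
      · linarith [hone _ _ hyz3 e3]
      · linarith
  have hNM : ∀ v ∈ N, v ∉ M := fun v hv h' => hNW v hv (hM.subset h')
  set F := W \ M with hF
  have hFW : F ⊆ W := Finset.sdiff_subset
  have hf3 : Forest m2 (insert v₃ F) :=
    hM.forest_right.subdivide hM2 hyz3 (by rw [em2 _ hN3, hm3y]) (by rw [em2 _ hN3, hm3z])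
      fun y hy hy1 hy2 => by
        rw [em2 _ hN3]
        exact hr3 y (Finset.mem_union_left _ (hFW hy)) hy1 hy2
  have hf2 : Forest m1 (insert v₂ (insert v₃ F)) :=
    hf3.subdivide hM1 hyz2 (by rw [em1 _ hN2, hm2y]) (by rw [em1 _ hN2, hm2z])
      fun y hy hy1 hy2 => by
        rw [em1 _ hN2]
        refine hr2 y ?_ hy1 hy2
        rcases Finset.mem_insert.1 hy with rfl | hy
        · exact Finset.mem_union_right _ hN3
        · exact Finset.mem_union_left _ (hFW hy)
  have hf1 : Forest m (insert v₁ (insert v₂ (insert v₃ F))) :=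
    hf2.subdivide hm hyz1 hm1y.le hm1z.le
      fun y hy hy1 hy2 => by
        refine hr1 y ?_ hy1 hy2
        rcases Finset.mem_insert.1 hy with rfl | hy
        · exact Finset.mem_union_right _ hN2
        rcases Finset.mem_insert.1 hy with rfl | hy
        · exact Finset.mem_union_right _ hN3
        · exact Finset.mem_union_left _ (hFW hy)
  set U := insert v₁ (insert v₂ (insert v₃ W)) with hU
  have hUV : U ⊆ V := Finset.insert_subset (hsub hN1) (Finset.insert_subset (hsub hN2)
    (Finset.insert_subset (hsub hN3) hWV))
  have hUM : U \ M = insert v₁ (insert v₂ (insert v₃ F)) := by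
    rw [hU, Finset.insert_sdiff_of_notMem _ (hNM _ hN1),
      Finset.insert_sdiff_of_notMem _ (hNM _ hN2), Finset.insert_sdiff_of_notMem _ (hNM _ hN3)]
  have hMU : Coloring m φ k U M := by
    refine ⟨hM.subset.trans fun y hy => ?_, fun y hy _ => h.allowed (hUV hy), fun y hy => ?_,
      ?_, ?_⟩
    · simp [hU, hy]
    · exact lt_of_le_of_lt (Finset.sum_le_sum fun z _ => hle3 _ _) (hM.deg_lt y hy)
    · exact hM.forest_left.of_le fun a _ b _ => hle3 a b
    · rw [hUM]
      exact hf1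
  have hxV4 : insert x (insert v₄ U) = V := by
    have e : insert x (insert v₄ U) = insert x N ∪ W := by
      ext y
      simp only [hU, hN, Finset.mem_insert, Finset.mem_union, Finset.mem_singleton]
      clear * -
      tauto
    rw [e, hW, Finset.union_sdiff_of_subset hxNV]
  have h4U : v₄ ∉ U := by
    simp only [hU, Finset.mem_insert, not_or]
    exact ⟨h14.symm, h24.symm, h34.symm, hNW _ hN4⟩
  have hx4U : x ∉ insert v₄ U := by
    simp only [hU, Finset.mem_insert, not_or]
    exact ⟨fun e => hxN (e ▸ hN4), fun e => hxN (e ▸ hN1), fun e => hxN (e ▸ hN2),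
      fun e => hxN (e ▸ hN3), hxW⟩
  have hxM0 : deg m M x = 0 := deg_eq_zero_iff.2 fun y hy => hxW0 y (hM.subset hy)
  have hd4 : deg m (U \ M) v₄ = deg m F v₄ := by
    rw [hUM, deg_insert, deg_insert, deg_insert, hNN v₄ hN4 v₁ hN1, hNN v₄ hN4 v₂ hN2,
      hNN v₄ hN4 v₃ hN3]
    · omega
    · exact fun h' => hNW _ hN3 (hFW h')
    · simp only [Finset.mem_insert, not_or]
      exact ⟨h23, fun h' => hNW _ hN2 (hFW h')⟩
    · simp only [Finset.mem_insert, not_or]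
      exact ⟨h12, h13, fun h' => hNW _ hN1 (hFW h')⟩
  apply h.not_colorable
  rw [← hxV4]
  by_cases h1 : deg m F v₄ ≤ 1
  · have hM4 := hMU.insert_right hm h4U (h.allowed (hsub hN4)) (by omega)
    refine ⟨_, hM4.insert_left hm hx4U (by omega) (by omega) fun u hu => ?_⟩
    rw [hm.symm, hxW0 u (hM.subset hu), add_zero]
    exact hM4.deg_lt u hu
  · have h2 := deg_add_deg_sdiff (m := m) (x := v₄) hM.subset
    rw [hdW v₄ hN4, ← hF] at h2
    have h0 : deg m M v₄ = 0 := by omega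
    have hz : ∀ u ∈ M, m u v₄ = 0 := fun u hu => by
      rw [hm.symm]
      exact deg_eq_zero_iff.1 h0 u hu
    have hk4 := (hlow v₄ hN4).1
    have hM4 := hMU.insert_left (k := k) hm h4U (by omega) (by omega) fun u hu => by
      rw [hz u hu, add_zero]
      exact hMU.deg_lt u hu
    have hdx4 : deg m (insert v₄ M) x = 1 := by
      rw [deg_insert (hNM _ hN4), hx4, hxM0]
    refine ⟨_, hM4.insert_left hm hx4U hdx4.le (by omega) fun u hu => ?_⟩
    rw [deg_insert (hNM _ hN4)]
    rcases Finset.mem_insert.1 hu with rfl | hu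
    · rw [hm.self, h0, hm.symm, hx4]
      omega
    · rw [hz u hu, hm.symm u x, hxW0 u (hM.subset hu)]
      simpa using hMU.deg_lt u hu

end Critical

end Multiplicity

namespace Multiplicity

variable {α : Type*} [DecidableEq α]
variable {m : α → α → ℕ} {q : α → ℕ} {L B T A : Finset α} {x v : α}

/-! ### Tight bipartite-like multigraphs -/

/-- An independent set `L` of vertices of degree three whose neighbors lie in `B`, where the
degrees of the vertices of `B` are governed by a function `q` of total weight three. -/
structure Layered (m : α → α → ℕ) (L B : Finset α) (q : α → ℕ) : Prop where
  mult : IsMult m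
  disj : Disjoint L B
  indep : ∀ v ∈ L, ∀ w ∈ L, m v w = 0
  three : ∀ v ∈ L, deg m B v = 3
  simple : ∀ v ∈ L, ∀ b ∈ B, m v b ≤ 1
  outer : ∀ b ∈ B, deg m L b + q b = 3
  inner : ∀ b ∈ B, q b ≠ 3 → deg m B b = q b + 1
  sum : ∑ b ∈ B, q b = 3

namespace Layered

lemma deg_left (h : Layered m L B q) (hA : A ⊆ L) (hv : v ∈ L) : deg m A v = 0 :=
  deg_eq_zero_iff.2 fun w hw => h.indep v hv w (hA hw)

lemma notMem (h : Layered m L B q) (hx : x ∈ B) : x ∉ L :=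
  fun hxL => Finset.disjoint_left.1 h.disj hxL hx

/-- A star with some isolated vertices, as `L` is independent and its edges to `B` are simple. -/
lemma forest_insert (h : Layered m L B q) {t : α} (ht : t ∈ B) : Forest m (insert t L) := by
  have := (forest_singleton h.mult (x := t)).union_of_deg_le_one h.mult L fun v hv => by
    rw [← Finset.insert_eq, deg_insert (h.notMem ht), h.deg_left subset_rfl hv]
    exact h.simple v hv t ht
  rwa [← Finset.insert_eq] at this

/-- Two stars with at most one common leaf form a forest: after `t`, the common neighbors and `t'`,
every remaining vertex of `L` has at most one edge. -/
lemma forest_insert_insert (h : Layered m L B q) {t t' : α} (ht : t ∈ B) (ht' : t' ∈ B)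
    (hne : t ≠ t') (h0 : m t t' = 0)
    (hI : (L.filter fun v => m v t = 1 ∧ m v t' = 1).card ≤ 1) :
    Forest m (insert t' (insert t L)) := by
  have hm := h.mult
  set I := L.filter fun v => m v t = 1 ∧ m v t' = 1 with hIdef
  have hIL : I ⊆ L := Finset.filter_subset _ _
  have h1 : Forest m (insert t I) := (h.forest_insert ht).mono (Finset.insert_subset_insert _ hIL)
  have h2 : Forest m (insert t' (insert t I)) := h1.insert hm (by
    rw [deg_insert fun h' => h.notMem ht (hIL h'), hm.symm, h0, zero_add]
    refine le_trans ?_ hI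
    rw [Finset.card_eq_sum_ones]
    refine Finset.sum_le_sum fun v hv => ?_
    rw [hm.symm]
    exact h.simple v (hIL hv) t' ht')
  have h3 := h2.union_of_deg_le_one hm (L \ I) fun v hv => by
    have hvL := Finset.sdiff_subset hv
    have e : insert t' (insert t I) ∪ L \ I = insert t' (insert t L) := by
      rw [Finset.insert_union, Finset.insert_union, Finset.union_sdiff_of_subset hIL]
    have hvI : ¬ (m v t = 1 ∧ m v t' = 1) := fun hh =>
      (Finset.mem_sdiff.1 hv).2 (Finset.mem_filter.2 ⟨hvL, hh⟩)
    rw [e, deg_insert (by simp [hne.symm, h.notMem ht']), deg_insert (h.notMem ht),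
      h.deg_left subset_rfl hvL]
    have := h.simple v hvL t ht
    have := h.simple v hvL t' ht'
    omega
  rwa [Finset.insert_union, Finset.insert_union, Finset.union_sdiff_of_subset hIL] at h3

/-- Without its private neighbor `p`, the vertex `b` has only one edge to the forest and can be
attached; then `p` returns as a leaf at `b`. -/
lemma forest_insert_of_private (h : Layered m L B q) {b p : α} (hb : b ∈ B) (hT : T ⊆ B)
    (hbT : b ∉ T) (hdb : deg m L b = 2) (hTb : deg m T b = 0) (hp : p ∈ L) (hpb : m p b = 1)
    (hpT : deg m T p = 0) (hF : Forest m (T ∪ L)) : Forest m (insert b T ∪ L) := by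
  have hm := h.mult
  have hTL : Disjoint T L := Finset.disjoint_of_subset_left hT h.disj.symm
  have hpTn : p ∉ T := fun h' => h.notMem (hT h') hp
  have h1 : Forest m (T ∪ L.erase p) :=
    hF.mono (Finset.union_subset_union subset_rfl (Finset.erase_subset _ _))
  have h2 : Forest m (insert b (T ∪ L.erase p)) := h1.insert hm (by
    rw [deg_union (Finset.disjoint_of_subset_right (Finset.erase_subset _ _) hTL), hTb]
    have : m b p + deg m (L.erase p) b = deg m L b := by
      rw [← deg_insert (Finset.notMem_erase _ _), Finset.insert_erase hp]
    rw [hm.symm, hpb] at this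
    omega)
  have h3 : Forest m (insert p (insert b (T ∪ L.erase p))) := h2.insert hm (by
    rw [deg_insert, deg_union (Finset.disjoint_of_subset_right (Finset.erase_subset _ _) hTL),
      hpT, h.deg_left (Finset.erase_subset _ _) hp, hpb]
    simp only [Finset.mem_union, not_or]
    exact ⟨hbT, fun h' => h.notMem hb (Finset.mem_of_mem_erase h')⟩)
  have e : insert b T ∪ L = insert p (insert b (T ∪ L.erase p)) := by
    conv_lhs => rw [← Finset.insert_erase hp]
    ext y
    simp only [Finset.mem_union, Finset.mem_insert]
    tauto
  rwa [e]

/-- The part of the conclusion that concerns the vertices of `B` outside `T`. -/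
def Hits (m : α → α → ℕ) (B : Finset α) (q : α → ℕ) (T : Finset α) : Prop :=
  T ⊆ B ∧ ∀ b ∈ B, b ∉ T → q b ≠ 3 ∧ q b ≤ deg m T b

/-- Two neighbors in `L` determine the neighborhood of a vertex with two neighbors in `L`. -/
lemma eq_or_eq (h : Layered m L B q) {b s s' u : α} (hdb : deg m L b = 2)
    (hs : s ∈ L) (hs' : s' ∈ L) (hu : u ∈ L) (hne : s ≠ s') (h1 : m s b = 1) (h2 : m s' b = 1)
    (h3 : m u b = 1) : u = s ∨ u = s' := by
  by_contra! hcon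
  have : ∑ y ∈ ({s, s', u} : Finset α), m b y ≤ deg m L b :=
    Finset.sum_le_sum_of_subset (by
      intro y hy
      simp only [Finset.mem_insert, Finset.mem_singleton] at hy
      rcases hy with rfl | rfl | rfl <;> assumption)
  rw [Finset.sum_insert (by simp [hne, hcon.1.symm]), Finset.sum_insert (by simp [hcon.2.symm]),
    Finset.sum_singleton, h.mult.symm b s, h.mult.symm b s', h.mult.symm b u] at this
  omega

lemma exists_two (h : Layered m L B q) {b : α} (hb : b ∈ B) (hdb : deg m L b = 2) :
    ∃ s ∈ L, ∃ s' ∈ L, s ≠ s' ∧ m s b = 1 ∧ m s' b = 1 := by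
  rcases exists_of_deg_eq_two hdb with ⟨a, ha, ha2, _⟩ | ⟨a, ha, a', ha', hne, h1, h2, _⟩
  · have := h.simple a ha b hb
    rw [h.mult.symm, ha2] at this
    omega
  · exact ⟨a, ha, a', ha', hne, by rw [h.mult.symm, h1], by rw [h.mult.symm, h2]⟩

/-- Three paths with two edges, whose inner vertices are `b i`: the selection of one vertex from
each of them. -/
lemma exists_of_three_paths (h : Layered m L B q) {b c d : Fin 3 → α}
    (hb : ∀ i, b i ∈ B) (hc : ∀ i, c i ∈ B)
    (hdb : ∀ i, deg m L (b i) = 2) (hdc : ∀ i, deg m L (c i) = 3)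
    (hslot : ∀ k i j, k ≠ i → k ≠ j → i ≠ j → ∀ p ∈ L,
      m p (b k) + m p (c k) + m p (d k) + (m p (b i) + m p (c i) + m p (d i)) +
        (m p (b j) + m p (c j) + m p (d j)) ≤ 3) :
    ∃ k i j, k ≠ i ∧ k ≠ j ∧ i ≠ j ∧ ∃ p ∈ L, m p (b k) = 1 ∧
      ∃ t, (t = b i ∨ t = c i ∨ t = d i) ∧ ∃ t', (t' = b j ∨ t' = c j ∨ t' = d j) ∧
        m p t = 0 ∧ m p t' = 0 ∧ (L.filter fun v => m v t = 1 ∧ m v t' = 1).card ≤ 1 := by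
  by_contra hno
  have hgood : ∀ k i j, k ≠ i → k ≠ j → i ≠ j → ∀ p ∈ L, m p (b k) = 1 →
      ∀ t, (t = b i ∨ t = c i ∨ t = d i) → ∀ t', (t' = b j ∨ t' = c j ∨ t' = d j) →
      m p t = 0 → m p t' = 0 → 2 ≤ (L.filter fun v => m v t = 1 ∧ m v t' = 1).card := by
    intro k i j hki hkj hij p hp hpb t ht t' ht' h1 h2
    by_contra hlt
    exact hno ⟨k, i, j, hki, hkj, hij, p, hp, hpb, t, ht, t', ht', h1, h2, by omega⟩
  -- sharing two neighbors with some `b j`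
  have hshare : ∀ t j, 2 ≤ (L.filter fun v => m v t = 1 ∧ m v (b j) = 1).card →
      ∀ s ∈ L, m s (b j) = 1 → m s t = 1 := by
    intro t j h2 s hs hsb
    obtain ⟨u, hu, u', hu', hne⟩ := Finset.one_lt_card.1 (show 1 < _ from h2)
    simp only [Finset.mem_filter] at hu hu'
    rcases h.eq_or_eq (hdb j) hu.1 hu'.1 hs hne hu.2.2 hu'.2.2 hsb with rfl | rfl
    · exact hu.2.1
    · exact hu'.2.1
  have hshare' : ∀ t j, 2 ≤ (L.filter fun v => m v (b j) = 1 ∧ m v t = 1).card →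
      ∀ s ∈ L, m s (b j) = 1 → m s t = 1 := by
    intro t j h2
    refine hshare t j (h2.trans_eq ?_)
    congr 1
    ext v
    simp only [Finset.mem_filter, and_comm (a := m v t = 1)]
  have hsb : ∀ p ∈ L, ∀ i, m p (b i) ≤ 1 := fun p hp i => h.simple p hp _ (hb i)
  -- If `p` misses both `b i` and `b j`, these have a common neighbor `s`, and `s` is adjacent to
  -- each of `c i`, `d i`, `c j`, `d j` that `p` misses. But `p` has at most two edges left for
  -- these four vertices and `s` at most one.
  have hshared : ∀ k i j, k ≠ i → k ≠ j → i ≠ j → ∀ p ∈ L, m p (b k) = 1 →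
      m p (b i) = 1 ∨ m p (b j) = 1 := by
    intro k i j hki hkj hij p hp hpb
    by_contra! hcon
    have hpi : m p (b i) = 0 := by have := hsb p hp i; omega
    have hpj : m p (b j) = 0 := by have := hsb p hp j; omega
    have h1 := hgood k i j hki hkj hij p hp hpb _ (Or.inl rfl) _ (Or.inl rfl) hpi hpj
    obtain ⟨s, hs⟩ := Finset.card_pos.1 (lt_of_lt_of_le (by norm_num : 0 < 2) h1)
    simp only [Finset.mem_filter] at hs
    obtain ⟨hsL, hsi, hsj⟩ := hs
    have hi : ∀ t, (t = b i ∨ t = c i ∨ t = d i) → m p t = 0 → m s t = 1 := fun t ht ht0 =>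
      hshare t j (hgood k i j hki hkj hij p hp hpb t ht _ (Or.inl rfl) ht0 hpj) s hsL hsj
    have hj : ∀ t, (t = b j ∨ t = c j ∨ t = d j) → m p t = 0 → m s t = 1 := fun t ht ht0 =>
      hshare' t i (hgood k i j hki hkj hij p hp hpb _ (Or.inl rfl) t ht hpi ht0) s hsL hsi
    have e1 := hi (c i) (by simp)
    have e2 := hi (d i) (by simp)
    have e3 := hj (c j) (by simp)
    have e4 := hj (d j) (by simp)
    have sp := hslot k i j hki hkj hij p hp
    have ss := hslot k i j hki hkj hij s hsL
    omega
  -- Two of the `b`'s cannot have the same pair of neighbors: otherwise the third has this pair too,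
  -- so all edges from `p` go to the `b`'s and every choice among the outer path vertices is
  -- available to test.
  have hequal : ∀ k i j, k ≠ i → k ≠ j → i ≠ j → ∀ p ∈ L, ∀ r ∈ L, p ≠ r →
      m p (b k) = 1 → m r (b k) = 1 → m p (b i) = 1 → m r (b i) = 1 → False := by
    intro k i j hki hkj hij p hp r hr hpr hpk hrk hpi hri
    have hmem : ∀ u ∈ L, m u (b j) = 1 → u = p ∨ u = r := by
      intro u hu huj
      rcases hshared j k i hkj.symm hij.symm hki u hu huj with hh | hh
      · exact h.eq_or_eq (hdb k) hp hr hu hpr hpk hrk hh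
      · exact h.eq_or_eq (hdb i) hp hr hu hpr hpi hri hh
    obtain ⟨s, hs, s', hs', hss, h1, h2⟩ := h.exists_two (hb j) (hdb j)
    have hpj : m p (b j) = 1 := by
      rcases hmem s hs h1 with rfl | rfl
      · exact h1
      · rcases hmem s' hs' h2 with rfl | rfl
        · exact h2
        · exact absurd rfl hss
    have sp := hslot k i j hki hkj hij p hp
    have hp0 : m p (c k) = 0 ∧ m p (d k) = 0 ∧ m p (c i) = 0 ∧ m p (d i) = 0 ∧ m p (c j) = 0 := by
      omega
    -- the vertex `c j` shares two neighbors with each of four vertices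
    have hk1 := hgood i k j hki.symm hij hkj p hp hpi (c k) (by simp) (c j) (by simp)
      hp0.1 hp0.2.2.2.2
    have hk2 := hgood i k j hki.symm hij hkj p hp hpi (d k) (by simp) (c j) (by simp)
      hp0.2.1 hp0.2.2.2.2
    have hi1 := hgood k i j hki hkj hij p hp hpk (c i) (by simp) (c j) (by simp)
      hp0.2.2.1 hp0.2.2.2.2
    have hi2 := hgood k i j hki hkj hij p hp hpk (d i) (by simp) (c j) (by simp)
      hp0.2.2.2.1 hp0.2.2.2.2
    have hcard : ∀ t, (L.filter fun v => m v t = 1 ∧ m v (c j) = 1).card ≤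
        ∑ v ∈ L, m v t * m v (c j) := by
      intro t
      rw [Finset.card_filter]
      refine Finset.sum_le_sum fun v _ => ?_
      split_ifs with hh
      · simp [hh.1, hh.2]
      · exact Nat.zero_le _
    -- Each of the three neighbors of `c j` in `L` has at most two further edges to the paths, so
    -- the four counts sum to at most six, whereas each is at least two.
    have htot : ∑ v ∈ L, m v (c k) * m v (c j) + ∑ v ∈ L, m v (d k) * m v (c j) +
        ∑ v ∈ L, m v (c i) * m v (c j) + ∑ v ∈ L, m v (d i) * m v (c j) ≤
        2 * ∑ v ∈ L, m v (c j) := by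
      rw [← Finset.sum_add_distrib, ← Finset.sum_add_distrib, ← Finset.sum_add_distrib,
        Finset.mul_sum]
      refine Finset.sum_le_sum fun v hv => ?_
      have sv := hslot k i j hki hkj hij v hv
      have := h.simple v hv _ (hc j)
      obtain hh | hh : m v (c j) = 0 ∨ m v (c j) = 1 := by omega
      · simp [hh]
      · rw [hh]
        omega
    have hcj : ∑ v ∈ L, m v (c j) = 3 := by
      rw [← hdc j]
      exact Finset.sum_congr rfl fun v _ => h.mult.symm _ _
    have := hcard (c k)
    have := hcard (d k)
    have := hcard (c i)
    have := hcard (d i)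
    omega
  -- The neighbors of the `b`'s cannot spread out cyclically either. As `p` is adjacent to `b k` and
  -- `b i`, it misses at least three of `c k`, `d k`, `c i`, `d i`; each of those shares both
  -- neighbors of `b j`, so `r` is adjacent to it, in excess of the three edges at `r`.
  have hhex : ∀ k i j, k ≠ i → k ≠ j → i ≠ j → ∀ p ∈ L, ∀ r ∈ L, p ≠ r →
      m p (b k) = 1 → m r (b k) = 1 → m p (b i) = 1 → m r (b j) = 1 → False := by
    intro k i j hki hkj hij p hp r hr hpr hpk hrk hpi hrj
    have hpj : m p (b j) = 0 := by
      by_contra h0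
      exact hequal k j i hkj hki hij.symm p hp r hr hpr hpk hrk
        (by have := hsb p hp j; omega) hrj
    have key : ∀ t, m p t = 0 → ((t = b k ∨ t = c k ∨ t = d k) ∨ (t = b i ∨ t = c i ∨ t = d i)) →
        m r t = 1 := by
      rintro t ht0 (ht | ht)
      · exact hshare t j (hgood i k j hki.symm hij hkj p hp hpi t ht _ (Or.inl rfl) ht0 hpj)
          r hr hrj
      · exact hshare t j (hgood k i j hki hkj hij p hp hpk t ht _ (Or.inl rfl) ht0 hpj)
          r hr hrj
    have e1 := key (c i)
    have e2 := key (d i)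
    have e3 := key (c k)
    have e4 := key (d k)
    simp only [true_or, or_true, forall_const] at e1 e2 e3 e4
    have sp := hslot k i j hki hkj hij p hp
    have sr := hslot k i j hki hkj hij r hr
    omega
  obtain ⟨p, hp, r, hr, hpr, hp0, hr0⟩ := h.exists_two (hb 0) (hdb 0)
  have n01 : (0 : Fin 3) ≠ 1 := by decide
  have n02 : (0 : Fin 3) ≠ 2 := by decide
  have n12 : (1 : Fin 3) ≠ 2 := by decide
  rcases hshared 0 1 2 n01 n02 n12 p hp hp0 with hp1 | hp2 <;>
    rcases hshared 0 1 2 n01 n02 n12 r hr hr0 with hr1 | hr2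
  · exact hequal 0 1 2 n01 n02 n12 p hp r hr hpr hp0 hr0 hp1 hr1
  · exact hhex 0 1 2 n01 n02 n12 p hp r hr hpr hp0 hr0 hp1 hr2
  · exact hhex 0 2 1 n02 n01 n12.symm p hp r hr hpr hp0 hr0 hp2 hr1
  · exact hequal 0 2 1 n02 n01 n12.symm p hp r hr hpr hp0 hr0 hp2 hr2

end Layered

end Multiplicity

/-! ### Choosing `T` according to the distribution of the deficit -/

namespace Multiplicity

variable {α : Type*} [DecidableEq α]
variable {m : α → α → ℕ} {q : α → ℕ} {L B T S A : Finset α} {x v : α}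

namespace Layered

/-- A set `S` carrying the whole deficit is all that has to be checked: elsewhere `q` vanishes and
nothing is demanded of `T`. -/
lemma hits_of (h : Layered m L B q) (hT : T ⊆ B) (hS : S ⊆ B) (h3 : ∑ b ∈ S, q b = 3)
    (hh : ∀ b ∈ S, b ∉ T → q b ≠ 3 ∧ q b ≤ deg m T b) : Hits m B q T := by
  refine ⟨hT, fun b hb hbT => ?_⟩
  by_cases hbS : b ∈ S
  · exact hh b hbS hbT
  · have := Finset.sum_sdiff hS (f := q)
    have := Finset.single_le_sum (f := q) (fun _ _ => Nat.zero_le _)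
      (Finset.mem_sdiff.2 ⟨hb, hbS⟩)
    have := h.sum
    omega

lemma forest_singleton_union (h : Layered m L B q) {t : α} (ht : t ∈ B) :
    Forest m ({t} ∪ L) := by
  rw [← Finset.insert_eq]
  exact h.forest_insert ht

/-- If `b` and `b'` are adjacent, `b` alone serves `b'`. Otherwise both are taken: `b` has only one
neighbor in `L`, so it is attached to the star at `b'` by at most one edge. -/
lemma exists_of_two (h : Layered m L B q) {b b' : α} (hb : b ∈ B) (hb' : b' ∈ B)
    (hq : q b = 2) (hq' : q b' = 1) : ∃ T, Hits m B q T ∧ Forest m (T ∪ L) := by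
  have hm := h.mult
  have hne : b ≠ b' := by
    rintro rfl
    omega
  have hsum : ∑ x ∈ ({b, b'} : Finset α), q x = 3 := by
    rw [Finset.sum_pair hne, hq, hq']
  have hS : ({b, b'} : Finset α) ⊆ B := by
    intro x hx
    rcases Finset.mem_insert.1 hx with rfl | hx
    · exact hb
    · rwa [Finset.mem_singleton.1 hx]
  by_cases hadj : m b' b = 0
  · refine ⟨{b, b'}, h.hits_of hS hS hsum fun x hx hx' => absurd hx hx', ?_⟩
    rw [Finset.insert_union]
    refine (h.forest_singleton_union hb').insert hm ?_
    rw [← Finset.insert_eq, deg_insert (h.notMem hb'), hm.symm, hadj]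
    have := h.outer b hb
    omega
  · refine ⟨{b}, h.hits_of (by simpa using hb) hS hsum fun x hx hx' => ?_,
      h.forest_singleton_union hb⟩
    obtain rfl : x = b' := by
      rcases Finset.mem_insert.1 hx with rfl | hx
      · simp at hx'
      · exact Finset.mem_singleton.1 hx
    have := le_deg (m := m) (x := x) (Finset.mem_singleton_self b)
    omega

/-- Three vertices with `q = 1` that carry the whole weight. -/
structure Triple (B : Finset α) (q : α → ℕ) (b b' b'' : α) : Prop where
  mem : b ∈ B
  mem' : b' ∈ B
  mem'' : b'' ∈ B
  ne : b ≠ b'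
  ne' : b ≠ b''
  ne'' : b' ≠ b''
  one : q b = 1
  one' : q b' = 1
  one'' : q b'' = 1

variable {b b' b'' : α}

lemma hits_of_triple (h : Layered m L B q) (t : Triple B q b b' b'') (hT : T ⊆ B)
    (h1 : b ∉ T → 1 ≤ deg m T b) (h2 : b' ∉ T → 1 ≤ deg m T b')
    (h3 : b'' ∉ T → 1 ≤ deg m T b'') : Hits m B q T := by
  refine h.hits_of hT (S := {b, b', b''}) ?_ ?_ ?_
  · intro x hx
    simp only [Finset.mem_insert, Finset.mem_singleton] at hx
    rcases hx with rfl | rfl | rfl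
    exacts [t.mem, t.mem', t.mem'']
  · simp [Finset.sum_insert, t.ne, t.ne', t.ne'', t.one, t.one', t.one'']
  · intro x hx hxT
    simp only [Finset.mem_insert, Finset.mem_singleton] at hx
    rcases hx with rfl | rfl | rfl
    · rw [t.one]
      exact ⟨by norm_num, h1 hxT⟩
    · rw [t.one']
      exact ⟨by norm_num, h2 hxT⟩
    · rw [t.one'']
      exact ⟨by norm_num, h3 hxT⟩

lemma one_le_deg {y : α} (hy : y ∈ T) (h : m x y ≠ 0) : 1 ≤ deg m T x :=
  (Nat.one_le_iff_ne_zero.2 h).trans (le_deg hy)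

lemma exists_of_center (h : Layered m L B q) (t : Triple B q b b' b'')
    (h1 : m b' b ≠ 0) (h2 : m b'' b ≠ 0) : ∃ T, Hits m B q T ∧ Forest m (T ∪ L) :=
  ⟨{b}, h.hits_of_triple t (by simpa using t.mem) (fun h' => by simp at h')
    (fun _ => one_le_deg (Finset.mem_singleton_self b) h1)
    (fun _ => one_le_deg (Finset.mem_singleton_self b) h2), h.forest_singleton_union t.mem⟩

lemma deg_eq_two (h : Layered m L B q) (hb : b ∈ B) (hq : q b = 1) :
    deg m L b = 2 ∧ deg m B b = 2 := by
  have := h.outer b hb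
  have := h.inner b hb
  omega

lemma exists_of_private_pair (h : Layered m L B q) {p c : α} (hb : b ∈ B) (hq : q b = 1)
    (hc : c ∈ B) (hne : b ≠ c) (hbc : m b c = 0) (hp : p ∈ L) (hpb : m p b = 1)
    (hpc : m p c = 0) : Forest m ({b, c} ∪ L) :=
  h.forest_insert_of_private hb (by simpa using hc) (by simpa using hne) (h.deg_eq_two hb hq).1
    (by simpa [deg] using hbc) hp hpb (by simpa [deg] using hpc) (h.forest_singleton_union hc)

/-- Either end of the edge serves the other, so `b''` with one end suffices if some neighbor of
`b''` in `L` is private against that end. Otherwise that neighbor is used up by the triple, and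
`b''` is served from outside by one of its neighbors in `B`. -/
lemma exists_of_edge (h : Layered m L B q) (t : Triple B q b b' b'')
    (h1 : m b b' ≠ 0) (h2 : m b b'' = 0) (h3 : m b' b'' = 0) :
    ∃ T, Hits m B q T ∧ Forest m (T ∪ L) := by
  have hm := h.mult
  obtain ⟨hl, hd⟩ := h.deg_eq_two t.mem'' t.one''
  obtain ⟨p, hp, -, -, -, hpb, -⟩ := h.exists_two t.mem'' hl
  have hsub : ∀ {x y}, x ∈ B → y ∈ B → ({x, y} : Finset α) ⊆ B := fun hx hy z hz => by
    rcases Finset.mem_insert.1 hz with rfl | hz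
    · exact hx
    · rwa [Finset.mem_singleton.1 hz]
  by_cases hpb1 : m p b = 0
  · refine ⟨{b'', b}, h.hits_of_triple t (hsub t.mem'' t.mem) (by simp) (fun _ => ?_) (by simp),
      h.exists_of_private_pair t.mem'' t.one'' t.mem t.ne'.symm (by rw [hm.symm, h2]) hp hpb hpb1⟩
    exact one_le_deg (y := b) (by simp) (by rwa [hm.symm])
  by_cases hpb2 : m p b' = 0
  · refine ⟨{b'', b'}, h.hits_of_triple t (hsub t.mem'' t.mem') (fun _ => ?_) (by simp) (by simp),
      h.exists_of_private_pair t.mem'' t.one'' t.mem' t.ne''.symm (by rw [hm.symm, h3]) hp hpb hpb2⟩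
    exact one_le_deg (y := b') (by simp) h1
  -- Now `p` is adjacent to `b`, `b'` and `b''`, hence to nothing else in `B`. So `p` is private for
  -- `b` against any neighbor `c` of `b''`, and since `q c = 0`, the only neighbor of `c` in `B` is
  -- `b''`.
  obtain ⟨c, hc, hcb⟩ : ∃ c ∈ B, m b'' c ≠ 0 := by
    by_contra! hno
    rw [deg_eq_zero_iff.2 hno] at hd
    omega
  have c1 : c ≠ b := by
    rintro rfl
    exact hcb (by rw [hm.symm, h2])
  have c2 : c ≠ b' := by
    rintro rfl
    exact hcb (by rw [hm.symm, h3])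
  have c3 : c ≠ b'' := by
    rintro rfl
    exact hcb (hm.self _)
  have hpc : m p c = 0 := by
    have : ∑ y ∈ ({c, b, b', b''} : Finset α), m p y ≤ deg m B p :=
      Finset.sum_le_sum_of_subset (by
        intro y hy
        simp only [Finset.mem_insert, Finset.mem_singleton] at hy
        rcases hy with rfl | rfl | rfl | rfl
        exacts [hc, t.mem, t.mem', t.mem''])
    rw [h.three p hp, Finset.sum_insert (by simp [c1, c2, c3]),
      Finset.sum_insert (by simp [t.ne, t.ne']), Finset.sum_pair t.ne''] at this
    omega
  have hcq : q c = 0 := by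
    have : ∑ y ∈ ({c, b, b', b''} : Finset α), q y ≤ ∑ y ∈ B, q y :=
      Finset.sum_le_sum_of_subset (by
        intro y hy
        simp only [Finset.mem_insert, Finset.mem_singleton] at hy
        rcases hy with rfl | rfl | rfl | rfl
        exacts [hc, t.mem, t.mem', t.mem''])
    rw [h.sum, Finset.sum_insert (by simp [c1, c2, c3]),
      Finset.sum_insert (by simp [t.ne, t.ne']), Finset.sum_pair t.ne'', t.one, t.one',
      t.one''] at this
    omega
  have hbc : m b c = 0 := by
    have h4 := h.inner c hc (by omega)
    have : ∑ y ∈ ({b, b''} : Finset α), m c y ≤ deg m B c :=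
      Finset.sum_le_sum_of_subset (hsub t.mem t.mem'')
    rw [Finset.sum_pair t.ne', hm.symm c b, hm.symm c b''] at this
    omega
  refine ⟨{b, c}, h.hits_of_triple t (hsub t.mem hc) (by simp) (fun _ => ?_) (fun _ => ?_),
    h.exists_of_private_pair t.mem t.one hc c1.symm hbc hp
      (by have := h.simple p hp b t.mem; omega) hpc⟩
  · exact one_le_deg (y := b) (by simp) (by rwa [hm.symm])
  · exact one_le_deg (y := c) (by simp) hcb

/-- Each `b i` has two distinct neighbors in `B`, both with `q = 0` and hence with no other neighbor
in `B`. This gives three disjoint paths with no edges between them, and one vertex from each path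
meets all demands. For the selection from `exists_of_three_paths`, the stars at `t` and `t'` share
at most one leaf, and `b k` is attached by means of its private neighbor `p`. -/
lemma exists_of_independent (h : Layered m L B q) {b : Fin 3 → α} (hinj : Function.Injective b)
    (hb : ∀ i, b i ∈ B) (hq : ∀ i, q (b i) = 1) (h0 : ∀ i j, m (b i) (b j) = 0) :
    ∃ T, Hits m B q T ∧ Forest m (T ∪ L) := by
  have hm := h.mult
  have htr : ∀ {i j k}, i ≠ j → i ≠ k → j ≠ k → Triple B q (b i) (b j) (b k) :=
    fun hij hik hjk => ⟨hb _, hb _, hb _, hinj.ne hij, hinj.ne hik, hinj.ne hjk, hq _, hq _, hq _⟩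
  have hzero : ∀ y ∈ B, (∀ i, y ≠ b i) → q y = 0 := by
    intro y hy hne
    by_contra hy0
    have : ∑ y ∈ ({y, b 0, b 1, b 2} : Finset α), q y ≤ ∑ y ∈ B, q y :=
      Finset.sum_le_sum_of_subset (by
        intro z hz
        simp only [Finset.mem_insert, Finset.mem_singleton] at hz
        rcases hz with rfl | rfl | rfl | rfl
        exacts [hy, hb _, hb _, hb _])
    rw [h.sum, Finset.sum_insert (by simp [hne]), Finset.sum_insert (by simp [hinj.eq_iff]),
      Finset.sum_pair (hinj.ne (by decide)), hq, hq, hq] at this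
    omega
  have hcd : ∀ i, ∃ c d, c ≠ d ∧ (c ∈ B ∧ q c = 0 ∧ m c (b i) = 1) ∧
      (d ∈ B ∧ q d = 0 ∧ m d (b i) = 1) := by
    intro i
    have hz : ∀ y ∈ B, m (b i) y ≠ 0 → q y = 0 := fun y hy hne => hzero y hy fun j hj => by
      rw [hj, h0] at hne
      exact hne rfl
    rcases exists_of_deg_eq_two (h.deg_eq_two (hb i) (hq i)).2 with
      ⟨c, hc, hc2, _⟩ | ⟨c, hc, d, hd, hne, h1, h2, _⟩
    · have hqc := hz c hc (by omega)
      have := h.inner c hc (by omega)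
      have := le_deg (m := m) (x := c) (hb i)
      rw [hm.symm, hc2] at this
      omega
    · exact ⟨c, d, hne, ⟨hc, hz c hc (by omega), by rw [hm.symm, h1]⟩,
        ⟨hd, hz d hd (by omega), by rw [hm.symm, h2]⟩⟩
  choose c d hne hc hd using hcd
  set C : Fin 3 → Finset α := fun i => {b i, c i, d i} with hC
  have hmem : ∀ i, ∀ y ∈ C i, y = b i ∨ (y ∈ B ∧ q y = 0 ∧ m y (b i) = 1) := by
    intro i y hy
    simp only [hC, Finset.mem_insert, Finset.mem_singleton] at hy
    rcases hy with rfl | rfl | rfl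
    exacts [Or.inl rfl, Or.inr (hc i), Or.inr (hd i)]
  have hmemB : ∀ i, ∀ y ∈ C i, y ∈ B := fun i y hy => by
    rcases hmem i y hy with rfl | hy
    exacts [hb i, hy.1]
  have honly : ∀ i, ∀ y ∈ B, q y = 0 → m y (b i) = 1 → ∀ z ∈ B, m y z ≠ 0 → z = b i := by
    intro i y hy hqy hyb z hz hyz
    by_contra hzb
    have h1 := h.inner y hy (by omega)
    have : ∑ w ∈ ({z, b i} : Finset α), m y w ≤ deg m B y :=
      Finset.sum_le_sum_of_subset (by
        intro w hw
        rcases Finset.mem_insert.1 hw with rfl | hw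
        · exact hz
        · rw [Finset.mem_singleton.1 hw]
          exact hb i)
    rw [Finset.sum_pair hzb] at this
    omega
  have hdisj : ∀ i j, i ≠ j → Disjoint (C i) (C j) := by
    intro i j hij
    refine Finset.disjoint_left.2 fun y hy hy' => ?_
    rcases hmem i y hy with rfl | ⟨h1, h2, h3⟩ <;> rcases hmem j _ hy' with h4 | ⟨h5, h6, h7⟩
    · exact hij (hinj h4)
    · rw [hq] at h6
      omega
    · rw [h4, hq] at h2
      omega
    · exact hij (hinj (honly j y h1 h2 h7 (b i) (hb i) (by omega)))
  have hnon : ∀ i j, i ≠ j → ∀ y ∈ C i, ∀ z ∈ C j, m y z = 0 := by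
    intro i j hij y hy z hz
    by_contra hyz
    have hbC : ∀ i, b i ∈ C i := fun i => by simp [hC]
    rcases hmem i y hy with rfl | ⟨h1, h2, h3⟩
    · rcases hmem j z hz with rfl | ⟨h1, h2, h3⟩
      · exact hyz (h0 i j)
      · exact hij (hinj (honly j z h1 h2 h3 (b i) (hb i) (by rwa [hm.symm])))
    · have := honly i y h1 h2 h3 z (hmemB j z hz) hyz
      rw [this] at hz
      exact Finset.disjoint_left.1 (hdisj i j hij) (hbC i) hz
  have hne' : ∀ i, b i ≠ c i ∧ b i ≠ d i := fun i => by
    constructor <;> intro he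
    · have := (hc i).2.2
      rw [← he, hm.self] at this
      omega
    · have := (hd i).2.2
      rw [← he, hm.self] at this
      omega
  have hsumC : ∀ i p, deg m (C i) p = m p (b i) + m p (c i) + m p (d i) := fun i p => by
    rw [hC]
    dsimp only
    rw [deg_insert (by simp [hne' i]), deg_insert (by simp [hne i])]
    simp [deg, add_assoc]
  obtain ⟨k, i, j, hki, hkj, hij, p, hp, hpk, t, ht, t', ht', hpt, hpt', hI⟩ :=
    h.exists_of_three_paths (b := b) (c := c) (d := d) hb (fun i => (hc i).1)
      (fun i => (h.deg_eq_two (hb i) (hq i)).1)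
      (fun i => by have := h.outer _ (hc i).1; have := (hc i).2.1; omega)
      (by
        intro k i j hki hkj hij p hp
        rw [← hsumC, ← hsumC, ← hsumC, ← deg_union (hdisj k i hki),
          ← deg_union (Finset.disjoint_union_left.2 ⟨hdisj k j hkj, hdisj i j hij⟩), ← h.three p hp]
        refine deg_mono fun y hy => ?_
        simp only [Finset.mem_union] at hy
        rcases hy with (hy | hy) | hy
        exacts [hmemB _ _ hy, hmemB _ _ hy, hmemB _ _ hy])
  have htC : t ∈ C i := by simpa [hC] using ht
  have htC' : t' ∈ C j := by simpa [hC] using ht'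
  have hbk : b k ∈ C k := by simp [hC]
  have hne1 : ∀ {i j y z}, i ≠ j → y ∈ C i → z ∈ C j → y ≠ z := fun hij hy hz he =>
    Finset.disjoint_left.1 (hdisj _ _ hij) hy (he ▸ hz)
  have hhit : ∀ {i y}, y ∈ C i → b i ≠ y → m (b i) y ≠ 0 := by
    intro i y hy hne
    rcases hmem i y hy with rfl | hy
    · exact absurd rfl hne
    · rw [hm.symm, hy.2.2]
      exact one_ne_zero
  have htB := hmemB i t htC
  have htB' := hmemB j t' htC'
  have hTB : ({t', t} : Finset α) ⊆ B := by
    intro y hy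
    rcases Finset.mem_insert.1 hy with rfl | hy
    · exact htB'
    · rwa [Finset.mem_singleton.1 hy]
  have htt : t' ≠ t := hne1 hij.symm htC' htC
  refine ⟨insert (b k) {t', t}, h.hits_of_triple (htr hki hkj hij)
    (Finset.insert_subset (hb k) hTB) (by simp) (fun hn => ?_) (fun hn => ?_), ?_⟩
  · exact one_le_deg (y := t) (by simp) (hhit htC fun he => hn (by simp [he]))
  · exact one_le_deg (y := t') (by simp) (hhit htC' fun he => hn (by simp [he]))
  · refine h.forest_insert_of_private (hb k) hTB ?_ (h.deg_eq_two (hb k) (hq k)).1 ?_ hp hpk ?_ ?_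
    · simp [hne1 hki hbk htC, hne1 hkj hbk htC']
    · rw [deg_insert (by simpa using htt), hnon k j hkj _ hbk _ htC']
      simp [deg, hnon k i hki _ hbk _ htC]
    · rw [deg_insert (by simpa using htt), hpt']
      simp [deg, hpt]
    · rw [Finset.insert_union, ← Finset.insert_eq]
      exact h.forest_insert_insert htB htB' htt.symm (hnon i j hij _ htC _ htC') hI

/-- The deficit three splits as `3`, `2 + 1` or `1 + 1 + 1`. In the last case the three vertices are
distinguished by the edges among them: none, one, or at least two, which yields a vertex adjacent to
both others. -/
theorem exists_hits (h : Layered m L B q) : ∃ T, Hits m B q T ∧ Forest m (T ∪ L) := by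
  have hm := h.mult
  by_cases h3 : ∃ b ∈ B, q b = 3
  · obtain ⟨b, hb, hq⟩ := h3
    exact ⟨{b}, h.hits_of (by simpa using hb) (S := {b}) (by simpa using hb) (by simpa using hq)
      fun x hx hx' => absurd hx hx', h.forest_singleton_union hb⟩
  by_cases h2 : ∃ b ∈ B, q b = 2
  · obtain ⟨b, hb, hq⟩ := h2
    have hs := h.sum
    rw [← Finset.add_sum_erase _ _ hb, hq] at hs
    obtain ⟨b', hb', hq'⟩ : ∃ b' ∈ B.erase b, q b' ≠ 0 := by
      by_contra! hno
      rw [Finset.sum_eq_zero hno] at hs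
      omega
    have := Finset.single_le_sum (f := q) (fun _ _ => Nat.zero_le _) hb'
    exact h.exists_of_two hb (Finset.mem_of_mem_erase hb') hq (by omega)
  have hle : ∀ b ∈ B, q b = 0 ∨ q b = 1 := by
    intro b hb
    have := Finset.single_le_sum (f := q) (fun _ _ => Nat.zero_le _) hb
    have := h.sum
    have : q b ≠ 3 := fun hh => h3 ⟨b, hb, hh⟩
    have : q b ≠ 2 := fun hh => h2 ⟨b, hb, hh⟩
    omega
  have hcard : (B.filter fun b => q b = 1).card = 3 := by
    rw [Finset.card_filter, ← h.sum]
    refine Finset.sum_congr rfl fun b hb => ?_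
    rcases hle b hb with hh | hh <;> simp [hh]
  obtain ⟨b1, b2, b3, n12, n13, n23, he⟩ := Finset.card_eq_three.1 hcard
  have hmem : ∀ x ∈ ({b1, b2, b3} : Finset α), x ∈ B ∧ q x = 1 := by
    rw [← he]
    exact fun x hx => Finset.mem_filter.1 hx
  obtain ⟨m1, q1⟩ := hmem b1 (by simp)
  obtain ⟨m2, q2⟩ := hmem b2 (by simp)
  obtain ⟨m3, q3⟩ := hmem b3 (by simp)
  have t123 : Triple B q b1 b2 b3 := ⟨m1, m2, m3, n12, n13, n23, q1, q2, q3⟩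
  have t213 : Triple B q b2 b1 b3 := ⟨m2, m1, m3, n12.symm, n23, n13, q2, q1, q3⟩
  have t312 : Triple B q b3 b1 b2 := ⟨m3, m1, m2, n13.symm, n23.symm, n12, q3, q1, q2⟩
  have t132 : Triple B q b1 b3 b2 := ⟨m1, m3, m2, n13, n12, n23.symm, q1, q3, q2⟩
  have t231 : Triple B q b2 b3 b1 := ⟨m2, m3, m1, n23, n12.symm, n13.symm, q2, q3, q1⟩
  have s12 := hm.symm b1 b2
  have s13 := hm.symm b1 b3
  have s23 := hm.symm b2 b3
  by_cases e12 : m b1 b2 = 0 <;> by_cases e13 : m b1 b3 = 0 <;> by_cases e23 : m b2 b3 = 0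
  · refine h.exists_of_independent (b := ![b1, b2, b3]) ?_ ?_ ?_ ?_
    · intro i j hij
      fin_cases i <;> fin_cases j <;>
        first
          | rfl
          | exact absurd hij n12
          | exact absurd hij n13
          | exact absurd hij n23
          | exact absurd hij.symm n12
          | exact absurd hij.symm n13
          | exact absurd hij.symm n23
    · intro i
      fin_cases i <;> assumption
    · intro i
      fin_cases i <;> assumption
    · rw [e12] at s12
      rw [e13] at s13
      rw [e23] at s23
      intro i j
      fin_cases i <;> fin_cases j <;>
        first
          | exact hm.self _
          | assumption
          | exact s12.symm
          | exact s13.symm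
          | exact s23.symm
  · exact h.exists_of_edge t231 e23 (by omega) (by omega)
  · exact h.exists_of_edge t132 e13 (by omega) (by omega)
  · exact h.exists_of_center t312 e13 e23
  · exact h.exists_of_edge t123 e12 (by omega) (by omega)
  · exact h.exists_of_center t213 e12 (by omega)
  · exact h.exists_of_center t123 (by omega) (by omega)
  · exact h.exists_of_center t123 (by omega) (by omega)

end Layered

end Multiplicity

/-! ### Discharging for degree bound one and the end of the induction -/

namespace Multiplicity

variable {α : Type*} [DecidableEq α]
variable {m : α → α → ℕ} {φ : α → Bool} {k : α → ℕ} {V : Finset α} {D : ℕ}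

namespace Critical

/-- The structure of a minimal counterexample with `D = 1`. -/
lemma exists_layered (h : Critical 1 m φ k V) :
    ∃ L B q, L ∪ B = V ∧ Layered m L B q ∧ ∀ b ∈ B, q b ≠ 3 → k b = 2 := by
  have hm := h.mult
  obtain ⟨v, hv, hdv, hkv⟩ := h.exists_deg_eq_three
  have hkv : k v = 2 := by have := h.le v hv; omega
  set L := V.filter fun x => k x = 2 ∧ deg m V x = 3 with hLdef
  have hL : ∀ {x}, x ∈ L ↔ x ∈ V ∧ k x = 2 ∧ deg m V x = 3 := by simp [hLdef]
  have hLV : L ⊆ V := Finset.filter_subset _ _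
  set B := V \ L with hBdef
  have hBV : B ⊆ V := Finset.sdiff_subset
  have hLB : L ∪ B = V := Finset.union_sdiff_of_subset hLV
  have hsplit : ∀ x, deg m L x + deg m B x = deg m V x := fun x => deg_add_deg_sdiff hLV
  have hind : ∀ v ∈ L, ∀ w ∈ L, m v w = 0 := fun v hv w hw => by
    obtain ⟨h1, h2, h3⟩ := hL.1 hv
    obtain ⟨h4, h5, h6⟩ := hL.1 hw
    exact h.mult_eq_zero_of_deg_three h1 h3 h2 h4 h6 h5
  have hthree : ∀ v ∈ L, deg m B v = 3 := fun v hv => by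
    have := hsplit v
    rw [(hL.1 hv).2.2, deg_eq_zero_iff.2 (hind v hv)] at this
    omega
  have hzero : ∀ b ∈ V, (∀ w ∈ L, m w b = 0) → deg m L b = 0 := fun b _ hb =>
    deg_eq_zero_iff.2 fun w hw => by rw [hm.symm, hb w hw]
  -- the possible types of the vertices outside `L`
  have htype : ∀ b ∈ B, 6 * k b + 9 + deg m L b ≤ 6 * deg m V b ∧
      (6 * deg m V b ≤ 6 * k b + 12 + deg m L b →
        (k b = 2 ∧ deg m V b = 4 ∧ deg m L b ≤ 3) ∨
          deg m L b = 0 ∧ 6 * deg m V b = 6 * k b + 12) := by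
    intro b hb
    have hbV := hBV hb
    have hk2 := h.le b hbV
    have hd2 := h.two_le_deg hbV
    have hs := hsplit b
    obtain hk | hk | hk : k b = 0 ∨ k b = 1 ∨ k b = 2 := by omega
    · have : deg m L b = 0 := hzero b hbV fun w hw => by
        by_contra h0
        obtain ⟨h1, h2, h3⟩ := hL.1 hw
        have := ((h.pot_eq_and_simple h1 h3 h2).2 b hbV h0).2
        omega
      omega
    · have hd3 := h.three_le_deg hbV (by omega)
      by_cases hd : deg m V b = 3
      · have : deg m L b = 0 := hzero b hbV fun w hw => by
          obtain ⟨h1, h2, h3⟩ := hL.1 hw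
          exact h.mult_eq_zero_of_capacity_one h1 h3 h2 hbV hd hk
        omega
      · omega
    · have hd3 := h.three_le_deg hbV (by omega)
      have hd : deg m V b ≠ 3 := fun hd => (Finset.mem_sdiff.1 hb).2 (hL.2 ⟨hbV, hk, hd⟩)
      by_cases hd4 : deg m V b = 4
      · obtain ⟨y, hy, hby, hyn⟩ := h.exists_neighbor_of_deg_four hbV hd4 hk
        have hyB : y ∈ B := Finset.mem_sdiff.2 ⟨hy, fun hyL => hyn (hL.1 hyL).2⟩
        have := le_deg (m := m) (x := b) hyB
        omega
      · omega
  -- Each vertex of `L` has charge `1` and sends a third along each of its three edges to `B`. Then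
  -- `q b` is `-3` times the final charge of `b`; truncated subtraction is harmless by `htype`. As
  -- the total charge is `-1`, these values sum to three.
  set q : α → ℕ := fun b => 6 * deg m V b - (6 * k b + 9 + deg m L b) with hq
  have hsum : ∑ b ∈ B, q b = 3 := by
    have h1 := (h.pot_eq_and_simple hv hdv hkv).1
    rw [pot_eq_sum_charge, ← hLB, Finset.sum_union Finset.disjoint_sdiff] at h1
    rw [hLB] at h1
    have h2 : ∑ x ∈ L, (weight 1 φ k x - ((1 : ℕ) + 1) * (deg m V x : ℤ)) = ∑ x ∈ L, 1 := by
      refine Finset.sum_congr rfl fun x hx => ?_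
      obtain ⟨h3, h4, h5⟩ := hL.1 hx
      rw [h.weight_eq h3, h4, h5]
      norm_num
    have h3 : ∑ x ∈ L, (1 : ℤ) * 3 = ∑ x ∈ B, (deg m L x : ℤ) := by
      have := sum_deg_comm hm (A := L) (B := B)
      rw [Finset.sum_congr rfl hthree] at this
      simpa using congrArg (Nat.cast (R := ℤ)) this
    rw [← Finset.sum_mul] at h3
    have h4 : ∑ b ∈ B, (q b : ℤ) = ∑ b ∈ B,
        ((-3) * (weight 1 φ k b - ((1 : ℕ) + 1) * (deg m V b : ℤ)) - deg m L b) := by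
      refine Finset.sum_congr rfl fun b hb => ?_
      rw [h.weight_eq (hBV hb), hq]
      simp only
      rw [Nat.cast_sub (htype b hb).1]
      push_cast
      ring
    rw [Finset.sum_sub_distrib, ← Finset.mul_sum] at h4
    have : ∑ b ∈ B, (q b : ℤ) = 3 := by linarith
    exact_mod_cast this
  have hcases : ∀ b ∈ B, (k b = 2 ∧ deg m V b = 4 ∧ deg m L b ≤ 3) ∨
      deg m L b = 0 ∧ 6 * deg m V b = 6 * k b + 12 := by
    intro b hb
    refine (htype b hb).2 ?_
    have : q b ≤ _ := Finset.single_le_sum (f := q) (fun _ _ => Nat.zero_le _) hb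
    rw [hsum] at this
    simp only [hq] at this
    omega
  refine ⟨L, B, q, hLB, ⟨hm, Finset.disjoint_sdiff, hind, hthree, fun v hv b hb => ?_,
    fun b hb => ?_, fun b hb hqb => ?_, hsum⟩, fun b hb hqb => ?_⟩
  · obtain ⟨h1, h2, h3⟩ := hL.1 hv
    exact h.mult_le_one h1 h3 h2 (hBV hb)
  · have := hcases b hb
    simp only [hq]
    omega
  · have := hcases b hb
    have := hsplit b
    simp only [hq] at hqb ⊢
    omega
  · have := hcases b hb
    simp only [hq] at hqb
    omega

/-- The coloring takes `B \ T` as the bounded part. A vertex there has `q b + 1` edges inside `B`,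
at least `q b` of them to `T`, hence at most one within `B \ T`, which its capacity two permits. -/
lemma false_of_one (h : Critical 1 m φ k V) : False := by
  obtain ⟨L, B, q, hLB, hl, hk⟩ := h.exists_layered
  have hm := h.mult
  obtain ⟨T, ⟨hTB, hT⟩, hF⟩ := hl.exists_hits
  have hBV : B ⊆ V := hLB ▸ Finset.subset_union_right
  have hdeg : ∀ b ∈ B \ T, deg m (B \ T) b ≤ 1 ∧ k b = 2 := by
    intro b hb
    obtain ⟨hbB, hbT⟩ := Finset.mem_sdiff.1 hb
    obtain ⟨h1, h2⟩ := hT b hbB hbT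
    have := deg_add_deg_sdiff (m := m) (x := b) hTB
    have := hl.inner b hbB h1
    exact ⟨by omega, hk b hbB h1⟩
  refine h.not_colorable ⟨B \ T, ⟨Finset.sdiff_subset.trans hBV, fun x hx _ => h.allowed hx,
    fun x hx => ?_, ?_, ?_⟩⟩
  · have := hdeg x hx
    omega
  · have := (forest_empty (m := m)).union_of_deg_le_one hm (B \ T) fun x hx => by
      rw [Finset.empty_union]
      exact (hdeg x hx).1
    rwa [Finset.empty_union] at this
  · refine hF.mono fun x hx => ?_
    obtain ⟨hxV, hxM⟩ := Finset.mem_sdiff.1 hx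
    rw [← hLB] at hxV
    rcases Finset.mem_union.1 hxV with hxL | hxB
    · exact Finset.mem_union_right _ hxL
    · by_contra hxT
      exact hxM (Finset.mem_sdiff.2 ⟨hxB, fun h' => hxT (Finset.mem_union_left _ h')⟩)

end Critical

/-- Sparse weighted multigraphs have colorings. -/
theorem exists_coloring_of_sparse (hD : 1 ≤ D) (hm : IsMult m) (hk : ∀ x ∈ V, k x ≤ D + 1)
    (hV : Sparse D m φ k V) : ∃ M, Coloring m φ k V M := by
  suffices ∀ n, ColorableBelow α D n from this _ m φ k V (Nat.lt_succ_self _) hm hk hV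
  intro n
  induction n with
  | zero => exact fun _ _ _ _ h => absurd h (Nat.not_lt_zero _)
  | succ n ih =>
    intro m φ k V hn hm hk hV
    have hbelow : ColorableBelow α D V.card := fun m φ k W hW =>
      ih m φ k W (lt_of_lt_of_le hW (Nat.lt_succ_iff.1 hn))
    by_contra hno
    have h2 : V.card < 2 := by
      by_contra h2
      have hc : Critical D m φ k V := ⟨hm, hk, hV, hbelow, by omega, hno⟩
      obtain rfl : D = 1 := by
        have := hc.not_two_le
        omega
      exact hc.false_of_one
    have hdeg : ∀ x ∈ V, ∀ A ⊆ V, deg m A x = 0 := fun x hx A hA => deg_eq_zero_iff.2 fun y hy => by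
      rw [Finset.card_le_one.1 (Nat.lt_succ_iff.1 h2) x hx y (hA hy), hm.self]
    have hforest : Forest m V := by
      have := (forest_empty (m := m)).union_of_deg_le_one hm V fun x hx => by
        rw [Finset.empty_union, hdeg x hx V subset_rfl]
        exact Nat.zero_le _
      rwa [Finset.empty_union] at this
    -- With at most one vertex there are no edges. A forced vertex goes to `M`, and its weight `2 k
    -- x - 2 ≥ -1` ensures positive capacity.
    refine hno ⟨V.filter fun x => φ x = false, Finset.filter_subset _ _, fun x hx hxM => ?_,
      fun x hx => ?_, hforest.mono (Finset.filter_subset _ _), hforest.mono Finset.sdiff_subset⟩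
    · by_contra h0
      exact hxM (Finset.mem_filter.2 ⟨hx, by simpa using h0⟩)
    · obtain ⟨hxV, hφ⟩ := Finset.mem_filter.1 hx
      have := hV {x} (by simpa using hxV) (Finset.singleton_nonempty x)
      rw [pot_singleton hm, weight_of_false hφ] at this
      rw [hdeg x hxV _ (Finset.filter_subset _ _)]
      omega

end Multiplicity

/-! ### Edge multiplicities of a multigraph -/

namespace Graph

open Multiplicity

variable {α : Type*} {β : Type*} {G : Graph α β} {x y : α} {D : ℕ}

/-- The number of edges between two vertices. -/
noncomputable def mult (G : Graph α β) (x y : α) : ℕ := {e | G.IsLink e x y}.ncard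

lemma isMult_mult (hG : G.Loopless) : IsMult G.mult where
  symm x y := by simp only [mult, G.isLink_comm]
  self x := by
    have : {e | G.IsLink e x x} = ∅ :=
      Set.eq_empty_of_forall_notMem fun e he => hG.not_isLoopAt e x he
    rw [mult, this, Set.ncard_empty]

variable [DecidableEq α] {A : Finset α}

lemma finite_and_ncard_eq_deg (hfin : ∀ y ∈ A, {e | G.IsLink e x y}.Finite) :
    {e | ∃ y ∈ A, G.IsLink e x y}.Finite ∧
      {e | ∃ y ∈ A, G.IsLink e x y}.ncard = deg G.mult A x := by
  induction A using Finset.induction_on with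
  | empty => simp [deg_empty]
  | insert z A hz ih =>
    have he : {e | ∃ y ∈ insert z A, G.IsLink e x y} =
        {e | G.IsLink e x z} ∪ {e | ∃ y ∈ A, G.IsLink e x y} := by
      ext e
      simp
    obtain ⟨h1, h2⟩ := ih fun y hy => hfin y (Finset.mem_insert_of_mem hy)
    have h3 := hfin z (Finset.mem_insert_self _ _)
    refine ⟨he ▸ h3.union h1, ?_⟩
    rw [he, Set.ncard_union_eq ?_ h3 h1, h2, deg_insert hz, mult]
    refine Set.disjoint_left.2 fun e hez hey => ?_
    obtain ⟨y, hy, hey⟩ := hey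
    exact hz (hey.right_unique hez ▸ hy)

lemma finite_and_two_mul_ncard_eq_total (hG : G.Loopless)
    (hfin : ∀ x ∈ A, ∀ y ∈ A, {e | G.IsLink e x y}.Finite) :
    E(G.induce (A : Set α)).Finite ∧ 2 * E(G.induce (A : Set α)).ncard = total G.mult A := by
  induction A using Finset.induction_on with
  | empty => simp [total_empty, edgeSet_induce]
  | insert z A hz ih =>
    have he : E(G.induce ((insert z A : Finset α) : Set α)) =
        E(G.induce (A : Set α)) ∪ {e | ∃ y ∈ A, G.IsLink e z y} := by
      ext e
      simp only [edgeSet_induce, Set.mem_ofPred_eq, Finset.mem_coe, Finset.mem_insert,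
        Set.mem_union]
      constructor
      · rintro ⟨x, y, h, rfl | hx, rfl | hy⟩
        · exact absurd h (hG.not_isLoopAt e _)
        · exact Or.inr ⟨y, hy, h⟩
        · exact Or.inr ⟨x, hx, h.symm⟩
        · exact Or.inl ⟨x, y, h, hx, hy⟩
      · rintro (⟨x, y, h, hx, hy⟩ | ⟨y, hy, h⟩)
        · exact ⟨x, y, h, Or.inr hx, Or.inr hy⟩
        · exact ⟨z, y, h, Or.inl rfl, Or.inr hy⟩
    obtain ⟨h1, h2⟩ := ih fun x hx y hy =>
      hfin x (Finset.mem_insert_of_mem hx) y (Finset.mem_insert_of_mem hy)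
    obtain ⟨h3, h4⟩ := finite_and_ncard_eq_deg (A := A) fun y hy =>
      hfin z (Finset.mem_insert_self _ _) y (Finset.mem_insert_of_mem hy)
    refine ⟨he ▸ h1.union h3, ?_⟩
    rw [he, Set.ncard_union_eq ?_ h1 h3, h4, total_insert (isMult_mult hG) hz, ← h2]
    · ring
    refine Set.disjoint_left.2 fun e hez hey => ?_
    obtain ⟨x, y, h, hx, hy⟩ := hez
    obtain ⟨w, -, hw⟩ := hey
    rcases hw.left_eq_or_eq h with rfl | rfl
    · exact hz hx
    · exact hz hy

lemma degree_induce (hG : G.Loopless) (hx : x ∈ A)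
    (hfin : ∀ y ∈ A, {e | G.IsLink e x y}.Finite) :
    (G.induce (A : Set α)).degree x = deg G.mult A x := by
  obtain ⟨h1, h2⟩ := finite_and_ncard_eq_deg hfin
  have h3 : (G.induce (A : Set α)).incidenceSet x = {e | ∃ y ∈ A, G.IsLink e x y} := by
    ext e
    simp only [mem_incidenceSet, Inc, induce_isLink, Set.mem_ofPred_eq, Finset.mem_coe]
    exact ⟨fun ⟨y, h, _, hy⟩ => ⟨y, hy, h⟩, fun ⟨y, hy, h⟩ => ⟨y, h, hx, hy⟩⟩
  have h4 : (G.induce (A : Set α)).loopSet x = ∅ :=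
    Set.eq_empty_of_forall_notMem fun e he => hG.not_isLoopAt e x he.1
  rw [degree, h3, h4, Set.encard_empty, add_zero, ← h1.cast_ncard_eq, h2]

/-- Pairs show that there are no parallel edges. The vertex set of a longer cycle would have all
inner degrees at least two, hence at least as many edges as vertices. -/
lemma isForest_induce (hG : G.Loopless)
    (hfin : ∀ x ∈ A, ∀ y ∈ A, {e | G.IsLink e x y}.Finite) (hA : Forest G.mult A) :
    (G.induce (A : Set α)).IsForest := by
  have hm := isMult_mult hG
  have hle : ∀ x ∈ A, ∀ y ∈ A, G.mult x y ≤ 1 := by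
    intro x hx y hy
    by_cases hxy : x = y
    · rw [hxy, hm.self]
      exact Nat.zero_le _
    · have := hA {x, y} (Finset.insert_subset hx (by simpa using hy)) (by simp)
      rw [total_insert hm (by simpa using hxy), total_singleton hm, Finset.card_pair hxy] at this
      simp only [deg, Finset.sum_singleton] at this
      omega
  have hloop : (G.induce (A : Set α)).Loopless := ⟨fun e x he => hG.not_isLoopAt e x he.1⟩
  refine ⟨{ toLoopless := hloop, eq_of_isLink := fun e f x y he hf => ?_ }, ?_⟩
  · exact (Set.ncard_le_one (hfin x he.2.1 y he.2.2)).1 (hle x he.2.1 y he.2.2) e he.1 f hf.1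
  · intro v w hw
    set S : Finset α := w.support.toFinset.image Subtype.val with hS
    have hSA : S ⊆ A := by
      intro z hz
      obtain ⟨z, -, rfl⟩ := Finset.mem_image.1 hz
      exact z.2
    have hdeg : ∀ z ∈ S, 2 ≤ deg G.mult S z := by
      intro z hz
      obtain ⟨z, hzw, rfl⟩ := Finset.mem_image.1 hz
      have h2 := hw.ncard_neighborSet_toSubgraph_eq_two (List.mem_toFinset.1 hzw)
      obtain ⟨a, b, hab, he⟩ := Set.ncard_eq_two.1 h2
      have key : ∀ c ∈ w.toSubgraph.neighborSet z, c.1 ∈ S ∧ 1 ≤ G.mult z.1 c.1 := by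
        intro c hc
        have hadj : w.toSubgraph.Adj z c := hc
        have hcS : c.1 ∈ S := Finset.mem_image_of_mem _
          (List.mem_toFinset.2 (w.mem_verts_toSubgraph.1 hadj.snd_mem))
        obtain ⟨-, e, he, -⟩ := hadj.adj_sub
        exact ⟨hcS, (Set.ncard_pos (hfin _ z.2 _ c.2)).2 ⟨e, he⟩⟩
      obtain ⟨ha, ha1⟩ := key a (he ▸ by simp)
      obtain ⟨hb, hb1⟩ := key b (he ▸ by simp)
      have : ∑ y ∈ ({a.1, b.1} : Finset α), G.mult z.1 y ≤ deg G.mult S z.1 :=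
        Finset.sum_le_sum_of_subset (Finset.insert_subset ha (by simpa using hb))
      rw [Finset.sum_pair fun h' => hab (Subtype.ext h')] at this
      omega
    have hne : S.Nonempty :=
      ⟨v.1, Finset.mem_image_of_mem _ (List.mem_toFinset.2 w.start_mem_support)⟩
    have h1 := hA S hSA hne
    have h2 : ∑ z ∈ S, 2 ≤ total G.mult S := Finset.sum_le_sum hdeg
    rw [Finset.sum_const, smul_eq_mul] at h2
    omega

/-- The bound `a_D |A| + b_D` on the number of edges in terms of potentials. -/
lemma ncard_le_iff (hG : G.Loopless)
    (hfin : ∀ x ∈ A, ∀ y ∈ A, {e | G.IsLink e x y}.Finite) :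
    (E(G.induce (A : Set α)).ncard : ℝ) ≤
      (4 * (D : ℝ) + 3) / (2 * ((D : ℝ) + 1)) * A.card + 1 / (2 * ((D : ℝ) + 1)) ↔
      -1 ≤ pot D G.mult (fun _ => true) (fun _ => D + 1) A := by
  have h := (finite_and_two_mul_ncard_eq_total hG hfin).2
  have hw : ∀ x : α, weight D (fun _ => true) (fun _ => D + 1) x = 4 * D + 3 := fun x => by
    rw [weight_of_true rfl]
    push_cast
    ring
  have hpos : (0 : ℝ) < 2 * ((D : ℝ) + 1) := by positivity
  rw [div_mul_eq_mul_div, ← add_div, le_div_iff₀ hpos, pot, ← h]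
  simp only [hw, Finset.sum_const, nsmul_eq_mul]
  rw [← Int.cast_le (R := ℝ)]
  push_cast
  constructor <;> intro h' <;> linarith

theorem hasDFFColoring_of_isSparse (hD : 1 ≤ D) (hV : V(G).Finite)
    (hG : G.IsSparse ((4 * (D : ℝ) + 3) / (2 * ((D : ℝ) + 1))) (1 / (2 * ((D : ℝ) + 1)))) :
    G.HasDFFColoring D := by
  obtain ⟨hloop, hs⟩ := hG
  have hm := isMult_mult hloop
  obtain ⟨V, hVe⟩ : ∃ V : Finset α, (V : Set α) = V(G) := ⟨hV.toFinset, hV.coe_toFinset⟩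
  -- Finiteness of the edge set is not assumed separately; it comes from the sparsity condition on
  -- pairs of vertices.
  have hfin : ∀ x ∈ V, ∀ y ∈ V, {e | G.IsLink e x y}.Finite := by
    intro x hx y hy
    by_cases hxy : x = y
    · refine Set.Finite.subset Set.finite_empty fun e he => ?_
      exact hloop.not_isLoopAt e x (hxy ▸ he)
    · refine (hs {x, y} ?_ (Finset.card_pair hxy).ge).1.subset fun e he => ⟨x, y, he, ?_, ?_⟩
      · rw [← hVe]
        exact_mod_cast Finset.insert_subset hx (by simpa using hy)
      all_goals simp
  obtain ⟨M, hM⟩ := exists_coloring_of_sparse (V := V) (φ := fun _ => true) (k := fun _ => D + 1)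
    hD hm (fun _ _ => le_rfl) (by
      intro A hA hne
      rcases Nat.lt_or_ge A.card 2 with h2 | h2
      · obtain ⟨x, rfl⟩ := Finset.card_eq_one.1 (show A.card = 1 by have := hne.card_pos; omega)
        rw [pot_singleton hm, weight_of_true rfl]
        push_cast
        linarith
      · rw [← ncard_le_iff hloop fun x hx y hy => hfin x (hA hx) y (hA hy)]
        exact (hs A (by rw [← hVe]; exact_mod_cast hA) h2).2)
  have hMV := hM.subset
  refine ⟨M, (V \ M : Finset α), ?_, ?_, ?_, ?_, ?_⟩
  · rw [← hVe]
    exact_mod_cast Finset.union_sdiff_of_subset hMV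
  · exact_mod_cast Finset.disjoint_sdiff
  · exact isForest_induce hloop (fun x hx y hy => hfin x (hMV hx) y (hMV hy)) hM.forest_left
  · intro x hx
    rw [degree_induce hloop hx fun y hy => hfin x (hMV hx) y (hMV hy)]
    exact_mod_cast Nat.lt_succ_iff.1 (hM.deg_lt x hx)
  · exact isForest_induce hloop
      (fun x hx y hy => hfin x (Finset.sdiff_subset hx) y (Finset.sdiff_subset hy))
      hM.forest_right

end Graph

/-! ### Weighted multigraphs without colorings -/

namespace Multiplicity

variable {α : Type*} [DecidableEq α]
variable {D : ℕ} {m : α → α → ℕ} {r : α → ℕ} {V A M : Finset α} {v x y z : α}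

/-- The potential in which all vertices are unrestricted. -/
abbrev freePot (D : ℕ) (m : α → α → ℕ) (A : Finset α) : ℤ :=
  pot D m (fun _ => true) (fun _ => D + 1) A

/-- Necessary conditions for the part `M` of a coloring. -/
structure WeakColoring (D : ℕ) (m : α → α → ℕ) (V M : Finset α) : Prop where
  mem_iff : ∀ x ∈ V, ∀ y ∈ V, 2 ≤ m x y → (x ∈ M ↔ y ∉ M)
  deg_le : ∀ x ∈ V, x ∈ M → deg m (V ∩ M) x ≤ D

lemma WeakColoring.mono {m' : α → α → ℕ} {V' : Finset α} (h : WeakColoring D m' V' M)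
    (hV : V ⊆ V') (hm : ∀ x ∈ V, ∀ y ∈ V, m' x y = m x y) : WeakColoring D m V M where
  mem_iff x hx y hy hxy := h.mem_iff x (hV hx) y (hV hy) (by rwa [hm x hx y hy])
  deg_le x hx hxM := by
    rw [← deg_congr fun y hy => hm x hx y (Finset.inter_subset_left hy)]
    exact (deg_mono (Finset.inter_subset_inter_right hV)).trans (h.deg_le x (hV hx) hxM)

/-- The multigraph with a new vertex `z` and `r y` edges from `z` to `y`. -/
def adjoin (m : α → α → ℕ) (z : α) (r : α → ℕ) (x y : α) : ℕ :=
  if x = z then if y = z then 0 else r y else if y = z then r x else m x y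

lemma IsMult.adjoin (hm : IsMult m) : IsMult (adjoin m z r) where
  symm x y := by
    unfold Multiplicity.adjoin
    split_ifs <;> first | rfl | exact hm.symm x y
  self x := by
    unfold Multiplicity.adjoin
    split_ifs <;> first | rfl | exact hm.self x

lemma adjoin_of_ne (hx : x ≠ z) (hy : y ≠ z) : adjoin m z r x y = m x y := by
  simp [adjoin, hx, hy]

lemma adjoin_left (hy : y ≠ z) : adjoin m z r z y = r y := by simp [adjoin, hy]

lemma adjoin_right (hx : x ≠ z) : adjoin m z r x z = r x := by simp [adjoin, hx]

lemma freePot_adjoin (hz : z ∉ A) : freePot D (adjoin m z r) A = freePot D m A :=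
  pot_congr_mult fun _ hx _ hy =>
    adjoin_of_ne (fun e => hz (e ▸ hx)) (fun e => hz (e ▸ hy))

lemma freePot_adjoin_insert (hm : IsMult m) (hz : z ∉ A) :
    freePot D (adjoin m z r) (insert z A) =
      freePot D m A + (4 * D + 3) - 2 * (D + 1) * ∑ y ∈ A, (r y : ℤ) := by
  have h1 : deg (adjoin m z r) A z = ∑ y ∈ A, r y :=
    Finset.sum_congr rfl fun y hy => adjoin_left fun e => hz (e ▸ hy)
  rw [freePot, pot_insert hm.adjoin hz, ← freePot, freePot_adjoin hz, weight_of_true rfl, h1]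
  push_cast
  ring

/-- A multigraph with a root `v` such that the potential of the sets containing `v` is minimal
for the whole set `V`, where it is `c`. In every coloring, if `v` is put into `M`, then it has at
least `t` neighbors there; and `b` implies that `v` is put into `M`. -/
structure Rooted (D : ℕ) (m : α → α → ℕ) (V : Finset α) (v : α) (c : ℤ) (t : ℕ) (b : Prop) :
    Prop where
  mult : IsMult m
  mem : v ∈ V
  pot_eq : freePot D m V = c
  pot_nonneg : ∀ A ⊆ V, v ∉ A → 0 ≤ freePot D m A
  pot_gt : ∀ A ⊆ V, v ∈ A → A ≠ V → c + 1 ≤ freePot D m A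
  le_deg : ∀ M, WeakColoring D m V M → v ∈ M → t ≤ deg m (V ∩ M) v
  forced : b → ∀ M, WeakColoring D m V M → v ∈ M

namespace Rooted

variable {c : ℤ} {t : ℕ} {b : Prop}

lemma pot_ge (h : Rooted D m V v c t b) (hA : A ⊆ V) (hv : v ∈ A) : c ≤ freePot D m A := by
  by_cases hAV : A = V
  · rw [hAV, h.pot_eq]
  · have := h.pot_gt A hA hv hAV
    omega

lemma singleton (D : ℕ) (v : α) : Rooted D (fun _ _ => 0) {v} v (4 * D + 3) 0 False := by
  have hm : IsMult fun _ _ : α => 0 := ⟨fun _ _ => rfl, fun _ => rfl⟩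
  refine ⟨hm, Finset.mem_singleton_self v, ?_, fun A hA hv => ?_, fun A hA hv hne => ?_,
    fun _ _ _ => Nat.zero_le _, False.elim⟩
  · rw [freePot, pot_singleton hm, weight_of_true rfl]
    push_cast
    ring
  · rcases Finset.subset_singleton_iff.1 hA with rfl | rfl
    · rw [freePot, pot_empty]
    · exact absurd (Finset.mem_singleton_self v) hv
  · rcases Finset.subset_singleton_iff.1 hA with rfl | rfl
    · simp at hv
    · exact absurd rfl hne

/-- The subsets of `insert z V`. -/
lemma subset_insert_cases (hA : A ⊆ insert z V) :
    A ⊆ V ∧ z ∉ A ∨ ∃ B ⊆ V, z ∉ B ∧ A = insert z B := by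
  by_cases hzA : z ∈ A
  · refine Or.inr ⟨A.erase z, ?_, Finset.notMem_erase z A, (Finset.insert_erase hzA).symm⟩
    rwa [← Finset.subset_insert_iff]
  · exact Or.inl ⟨(Finset.subset_insert_iff_of_notMem hzA).1 hA, hzA⟩

lemma sum_single (j : ℕ) :
    ∑ y ∈ A, (((if y = v then j else 0 : ℕ)) : ℤ) = if v ∈ A then (j : ℤ) else 0 := by
  push_cast
  rw [Finset.sum_ite_eq']

/-- A new root that is joined to the old one. -/
lemma adjoin (h : Rooted D m V v c t b) (hz : z ∉ V) {j : ℕ} (hc : 0 ≤ c)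
    (hc' : c < 2 * j * (D + 1)) {t' : ℕ} {b' : Prop}
    (ht : ∀ M, WeakColoring D (Multiplicity.adjoin m z fun y => if y = v then j else 0)
      (insert z V) M → z ∈ M →
        t' ≤ deg (Multiplicity.adjoin m z fun y => if y = v then j else 0) (insert z V ∩ M) z)
    (hb : b' → ∀ M, WeakColoring D (Multiplicity.adjoin m z fun y => if y = v then j else 0)
      (insert z V) M → z ∈ M) :
    Rooted D (Multiplicity.adjoin m z fun y => if y = v then j else 0) (insert z V) z
      (c + (4 * D + 3) - 2 * j * (D + 1)) t' b' := by
  refine ⟨h.mult.adjoin, Finset.mem_insert_self _ _, ?_, fun A hA hzA => ?_,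
    fun A hA hzA hne => ?_, ht, hb⟩
  · rw [freePot_adjoin_insert h.mult hz, sum_single, if_pos h.mem, h.pot_eq]
    ring
  · rw [freePot_adjoin hzA]
    have hAV := (Finset.subset_insert_iff_of_notMem hzA).1 hA
    by_cases hv : v ∈ A
    · exact hc.trans (h.pot_ge hAV hv)
    · exact h.pot_nonneg A hAV hv
  · rcases subset_insert_cases hA with ⟨-, h'⟩ | ⟨B, hB, hzB, rfl⟩
    · exact absurd hzA h'
    rw [freePot_adjoin_insert h.mult hzB, sum_single]
    split_ifs with hv
    · have := h.pot_gt B hB hv fun e => hne (by rw [e])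
      linarith
    · have := h.pot_nonneg B hB hv
      linarith

/-- A pair of new vertices that are joined by two edges, and to the root by one edge each. -/
lemma gadget [Infinite α] (h : Rooted D m V v c t b) :
    ∃ m' V', V ⊆ V' ∧ Rooted D m' V' v (c - 2) (t + 1) b := by
  obtain ⟨y, hy⟩ := Infinite.exists_notMem_finset V
  obtain ⟨z, hz⟩ := Infinite.exists_notMem_finset (insert y V)
  have hzV : z ∉ V := fun h' => hz (Finset.mem_insert_of_mem h')
  have hzy : z ≠ y := fun e => hz (e ▸ Finset.mem_insert_self _ _)
  have hvy : v ≠ y := fun e => hy (e ▸ h.mem)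
  have hvz : v ≠ z := fun e => hzV (e ▸ h.mem)
  set m₁ := Multiplicity.adjoin m y fun x => if x = v then 1 else 0 with hm₁
  set m₂ := Multiplicity.adjoin m₁ z fun x => (if x = v then 1 else 0) + if x = y then 2 else 0
    with hm₂
  have hmul : IsMult m₁ := h.mult.adjoin
  have hsum : ∀ A : Finset α, ∑ x ∈ A, (((if x = v then 1 else 0) + if x = y then 2 else 0 : ℕ) : ℤ)
      = (if v ∈ A then 1 else 0) + if y ∈ A then 2 else 0 := fun A => by
    push_cast
    rw [Finset.sum_add_distrib, Finset.sum_ite_eq', Finset.sum_ite_eq']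
  have p0 : ∀ B, y ∉ B → z ∉ B → freePot D m₂ B = freePot D m B := fun B h1 h2 => by
    rw [hm₂, freePot_adjoin h2, hm₁, freePot_adjoin h1]
  have p1 : ∀ B, y ∉ B → z ∉ B → freePot D m₂ (insert y B) =
      freePot D m B + (4 * D + 3) - 2 * (D + 1) * if v ∈ B then 1 else 0 := fun B h1 h2 => by
    rw [hm₂, freePot_adjoin (by simp [h2, hzy]), hm₁, freePot_adjoin_insert h.mult h1, sum_single]
    simp
  have p2 : ∀ B, y ∉ B → z ∉ B → freePot D m₂ (insert z B) =
      freePot D m B + (4 * D + 3) - 2 * (D + 1) * if v ∈ B then 1 else 0 := fun B h1 h2 => by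
    rw [hm₂, freePot_adjoin_insert hmul h2, hsum, hm₁, freePot_adjoin h1, if_neg h1, add_zero]
  -- With the root in `B`, two vertices and four edges change the potential by `2(4D + 3) - 8(D + 1)
  -- = -2`. Adding just one of the two vertices raises it by `2D + 1`, so the whole set remains the
  -- minimum among sets containing the root.
  have p3 : ∀ B, y ∉ B → z ∉ B → freePot D m₂ (insert z (insert y B)) =
      freePot D m B + (4 * D + 2) - 2 * (2 * (D + 1)) * if v ∈ B then 1 else 0 :=
    fun B h1 h2 => by
    rw [hm₂, freePot_adjoin_insert hmul (by simp [h2, hzy]), hsum, hm₁,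
      freePot_adjoin_insert h.mult h1, sum_single]
    simp only [Finset.mem_insert, hvy, false_or, true_or, if_true]
    push_cast
    split_ifs <;> ring
  have hagree : ∀ x ∈ V, ∀ x' ∈ V, m₂ x x' = m x x' := fun x hx x' hx' => by
    have h1 : x ≠ z := fun e => hzV (e ▸ hx)
    have h2 : x' ≠ z := fun e => hzV (e ▸ hx')
    have h3 : x ≠ y := fun e => hy (e ▸ hx)
    have h4 : x' ≠ y := fun e => hy (e ▸ hx')
    rw [hm₂, adjoin_of_ne h1 h2, hm₁, adjoin_of_ne h3 h4]
  have hsub : V ⊆ insert z (insert y V) :=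
    (Finset.subset_insert _ _).trans (Finset.subset_insert _ _)
  have hD : (0 : ℤ) ≤ D := Int.natCast_nonneg D
  have hcases : ∀ A ⊆ insert z (insert y V), ∃ B ⊆ V, y ∉ B ∧ z ∉ B ∧
      (A = B ∨ A = insert y B ∨ A = insert z B ∨ A = insert z (insert y B)) := by
    intro A hA
    rcases subset_insert_cases hA with ⟨hA', hzA⟩ | ⟨A, hA', hzA, rfl⟩ <;>
      rcases subset_insert_cases hA' with ⟨hA, hyA⟩ | ⟨B, hB, hyB, rfl⟩
    · exact ⟨A, hA, hyA, hzA, Or.inl rfl⟩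
    · exact ⟨B, hB, hyB, fun h' => hzA (Finset.mem_insert_of_mem h'), Or.inr (Or.inl rfl)⟩
    · exact ⟨A, hA, hyA, hzA, Or.inr (Or.inr (Or.inl rfl))⟩
    · exact ⟨B, hB, hyB, fun h' => hzA (Finset.mem_insert_of_mem h'),
        Or.inr (Or.inr (Or.inr rfl))⟩
  refine ⟨m₂, insert z (insert y V), hsub, hmul.adjoin, hsub h.mem, ?_, fun A hA hv => ?_,
    fun A hA hv hne => ?_, fun M hM hv => ?_,
    fun hb M hM => h.forced hb M (hM.mono hsub hagree)⟩
  · rw [p3 V hy hzV, if_pos h.mem, h.pot_eq]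
    ring
  · obtain ⟨B, hB, hyB, hzB, hAB⟩ := hcases A hA
    have hvB : v ∉ B := fun hvB => hv (by rcases hAB with rfl | rfl | rfl | rfl <;> simp [hvB])
    have := h.pot_nonneg B hB hvB
    rcases hAB with rfl | rfl | rfl | rfl
    · rwa [p0 A hyB hzB]
    · rw [p1 B hyB hzB, if_neg hvB, mul_zero]
      linarith
    · rw [p2 B hyB hzB, if_neg hvB, mul_zero]
      linarith
    · rw [p3 B hyB hzB, if_neg hvB, mul_zero]
      linarith
  · obtain ⟨B, hB, hyB, hzB, hAB⟩ := hcases A hA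
    have hvB : v ∈ B := by
      rcases hAB with rfl | rfl | rfl | rfl <;> simpa [hvy, hvz] using hv
    have := h.pot_ge hB hvB
    rcases hAB with rfl | rfl | rfl | rfl
    · rw [p0 A hyB hzB]
      linarith
    · rw [p1 B hyB hzB, if_pos hvB]
      linarith
    · rw [p2 B hyB hzB, if_pos hvB]
      linarith
    · have := h.pot_gt B hB hvB fun e => hne (by rw [e])
      rw [p3 B hyB hzB, if_pos hvB]
      linarith
  · have h1 := h.le_deg M (hM.mono hsub hagree) hv
    rw [deg_congr (m' := m₂) fun x hx => (hagree v h.mem x (Finset.inter_subset_left hx)).symm] at h1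
    have hyz : m₂ y z = 2 := by
      rw [hm₂, adjoin_right hzy.symm]
      simp [hvy.symm]
    have hvy1 : m₂ v y = 1 := by
      rw [hm₂, adjoin_of_ne hvz hzy.symm, hm₁, adjoin_right hvy, if_pos rfl]
    have hvz1 : m₂ v z = 1 := by
      rw [hm₂, adjoin_right hvz, if_pos rfl, if_neg hvy]
    have hmem := hM.mem_iff y (by simp) z (by simp) hyz.ge
    by_cases hyM : y ∈ M
    · have hs : insert y (V ∩ M) ⊆ insert z (insert y V) ∩ M := by
        refine Finset.insert_subset (by simp [hyM]) (Finset.inter_subset_inter_right hsub)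
      have := deg_mono (m := m₂) (x := v) hs
      rw [deg_insert (by simp [hy]), hvy1] at this
      omega
    · have hzM : z ∈ M := by
        by_contra hzM
        exact hyM (hmem.2 hzM)
      have hs : insert z (V ∩ M) ⊆ insert z (insert y V) ∩ M := by
        refine Finset.insert_subset (by simp [hzM]) (Finset.inter_subset_inter_right hsub)
      have := deg_mono (m := m₂) (x := v) hs
      rw [deg_insert (by simp [hzV]), hvz1] at this
      omega

lemma gadgets [Infinite α] (h : Rooted D m V v c t b) (n : ℕ) :
    ∃ m' V', V ⊆ V' ∧ Rooted D m' V' v (c - 2 * n) (t + n) b := by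
  induction n with
  | zero => exact ⟨m, V, subset_rfl, by simpa using h⟩
  | succ n ih =>
    obtain ⟨m', V', hV, h'⟩ := ih
    obtain ⟨m'', V'', hV', h''⟩ := h'.gadget
    refine ⟨m'', V'', hV.trans hV', ?_⟩
    convert h'' using 1
    · push_cast
      ring
    · exact (add_assoc _ _ _).symm

/-- A root that is not put into `M` forces its neighbor along a double edge into `M`. -/
lemma double (h : Rooted D m V v (2 * D + 1) (D + 1) False) (hz : z ∉ V) :
    ∃ m', Rooted D m' (insert z V) z (2 * D) 0 True := by
  have hzv : v ≠ z := fun e => hz (e ▸ h.mem)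
  refine ⟨Multiplicity.adjoin m z fun y => if y = v then 2 else 0, ?_⟩
  have := h.adjoin hz (j := 2) (t' := 0) (b' := True) (by positivity) (by push_cast; linarith)
    (fun _ _ _ => Nat.zero_le _) (fun _ M hM => ?_)
  · convert this using 1
    push_cast
    ring
  · have hMV := hM.mono (m := m) (Finset.subset_insert z V) fun x hx y hy =>
      adjoin_of_ne (fun e => hz (e ▸ hx)) (fun e => hz (e ▸ hy))
    have hv : v ∉ M := fun hv => by
      have := h.le_deg M hMV hv
      have := hMV.deg_le v h.mem hv
      omega
    refine (hM.mem_iff z (Finset.mem_insert_self _ _) v (Finset.mem_insert_of_mem h.mem) ?_).2 hv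
    rw [adjoin_left hzv, if_pos rfl]

/-- A saturated root that is put into `M` forces its neighbors out of `M`. -/
lemma single (h : Rooted D m V v 0 D True) (hz : z ∉ V) :
    ∃ m', Rooted D m' (insert z V) z (2 * D + 1) (D + 1) False := by
  have hzv : v ≠ z := fun e => hz (e ▸ h.mem)
  refine ⟨Multiplicity.adjoin m z fun y => if y = v then 1 else 0, ?_⟩
  have := h.adjoin hz (j := 1) (t' := D + 1) (b' := False) le_rfl (by positivity)
    (fun M hM hzM => ?_) False.elim
  · convert this using 1
    push_cast
    ring
  · have hagree : ∀ x ∈ V, ∀ y ∈ V,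
        Multiplicity.adjoin m z (fun y => if y = v then 1 else 0) x y = m x y := fun x hx y hy =>
      adjoin_of_ne (fun e => hz (e ▸ hx)) (fun e => hz (e ▸ hy))
    have hMV := hM.mono (Finset.subset_insert z V) hagree
    have hv := h.forced trivial M hMV
    have h1 := h.le_deg M hMV hv
    have h2 := hM.deg_le v (Finset.mem_insert_of_mem h.mem) hv
    rw [Finset.insert_inter_of_mem hzM, deg_insert (by simp [hz]), adjoin_right hzv, if_pos rfl,
      deg_congr fun y hy => hagree v h.mem y (Finset.inter_subset_left hy)] at h2
    omega

/-- A root with `D + 1` gadgets is excluded from `M`. A double edge to a new root forces that one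
into `M`, `D` gadgets saturate it, and a single edge to a further root excludes the latter from `M`.
The potential runs through `2D + 1`, `2D`, `0` and back to `2D + 1`, so the chain can be repeated at
will. -/
lemma exists_card_ge [Infinite α] (D N : ℕ) : ∃ (m : α → α → ℕ) (V : Finset α) (v : α),
    N ≤ V.card ∧ Rooted D m V v (2 * D + 1) (D + 1) False := by
  induction N with
  | zero =>
    obtain ⟨v⟩ : Nonempty α := inferInstance
    obtain ⟨m, V, -, h⟩ := (singleton D v).gadgets (D + 1)
    refine ⟨m, V, v, Nat.zero_le _, ?_⟩
    convert h using 1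
    · push_cast
      ring
    · ring
  | succ N ih =>
    obtain ⟨m, V, v, hN, h⟩ := ih
    obtain ⟨z, hz⟩ := Infinite.exists_notMem_finset V
    obtain ⟨m₁, h₁⟩ := h.double hz
    obtain ⟨m₂, V₂, hV₂, h₂⟩ := h₁.gadgets D
    obtain ⟨w, hw⟩ := Infinite.exists_notMem_finset V₂
    have h₂' : Rooted D m₂ V₂ z 0 D True := by
      convert h₂ using 1 <;> ring
    obtain ⟨m₃, h₃⟩ := h₂'.single hw
    refine ⟨m₃, insert w V₂, w, ?_, h₃⟩
    have := Finset.card_le_card hV₂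
    rw [Finset.card_insert_of_notMem hz] at this
    rw [Finset.card_insert_of_notMem hw]
    omega

end Rooted

/-- Large multigraphs without weak coloring whose proper subsets have potential at least `-1`. -/
theorem exists_not_weakColoring [Infinite α] (D N : ℕ) : ∃ (m : α → α → ℕ) (V : Finset α),
    IsMult m ∧ N ≤ V.card ∧ freePot D m V = -2 ∧ (∀ A ⊂ V, -1 ≤ freePot D m A) ∧
      ∀ M, ¬ WeakColoring D m V M := by
  obtain ⟨m, V, v, hN, h⟩ := Rooted.exists_card_ge (α := α) D N
  obtain ⟨z, hz⟩ := Infinite.exists_notMem_finset V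
  obtain ⟨m₁, h₁⟩ := h.double hz
  -- One gadget more than in the repeating chain: the root is forced into `M` but would have `D + 1`
  -- neighbors there, and the potential ends at `2D - 2(D + 1) = -2`.
  obtain ⟨m₂, V₂, hV₂, h₂⟩ := h₁.gadgets (D + 1)
  refine ⟨m₂, V₂, h₂.mult, ?_, ?_, fun A hA => ?_, fun M hM => ?_⟩
  · exact hN.trans (Finset.card_le_card ((Finset.subset_insert z V).trans hV₂))
  · rw [h₂.pot_eq]
    push_cast
    ring
  · by_cases hv : z ∈ A
    · have := h₂.pot_gt A hA.subset hv hA.ne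
      push_cast at this
      linarith
    · have := h₂.pot_nonneg A hA.subset hv
      linarith
  · have h3 := h₂.forced trivial M hM
    have := h₂.le_deg M hM h3
    have := hM.deg_le z h₂.mem h3
    omega

end Multiplicity

/-! ### Multigraphs with given edge multiplicities -/

namespace Graph

open Multiplicity

variable {m : ℕ → ℕ → ℕ} {V A : Finset ℕ} {x y : ℕ} {D : ℕ}

/-- The multigraph on `V` with `m x y` edges between `x` and `y`. -/
def ofMult (m : ℕ → ℕ → ℕ) (V : Finset ℕ) : Graph ℕ ℕ where
  vertexSet := V
  IsLink e x y := x ∈ V ∧ y ∈ V ∧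
    -- An edge is encoded by its sorted pair of ends and an index, so that it determines its ends.
    ∃ i < m (min x y) (max x y), e = Nat.pair (Nat.pair (min x y) (max x y)) i
  isLink_symm e _ := ⟨fun x y ⟨hx, hy, h⟩ => ⟨hy, hx, by rwa [min_comm, max_comm]⟩⟩
  eq_or_eq_of_isLink_of_isLink e x y v w h h' := by
    obtain ⟨-, -, i, -, h⟩ := h
    obtain ⟨-, -, j, -, h'⟩ := h'
    obtain ⟨h1, h2⟩ := Nat.pair_eq_pair.1 (Nat.pair_eq_pair.1 (h.symm.trans h')).1
    omega
  left_mem_of_isLink _ _ _ h := h.1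

lemma setOf_isLink_ofMult (hm : IsMult m) (hx : x ∈ V) (hy : y ∈ V) :
    {e | (ofMult m V).IsLink e x y} =
      ((Finset.range (m x y)).image (Nat.pair (Nat.pair (min x y) (max x y))) : Finset ℕ) := by
  have he : m (min x y) (max x y) = m x y := by
    rcases le_total x y with h | h
    · rw [min_eq_left h, max_eq_right h]
    · rw [min_eq_right h, max_eq_left h, hm.symm]
  ext e
  simp only [ofMult, he, Set.mem_ofPred_eq, hx, hy, true_and, Finset.coe_image, Set.mem_image,
    Finset.mem_coe, Finset.mem_range]
  exact ⟨fun ⟨i, hi, h⟩ => ⟨i, hi, h.symm⟩, fun ⟨i, hi, h⟩ => ⟨i, hi, h.symm⟩⟩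

lemma finite_isLink_ofMult (hm : IsMult m) (hx : x ∈ V) (hy : y ∈ V) :
    {e | (ofMult m V).IsLink e x y}.Finite := by
  rw [setOf_isLink_ofMult hm hx hy]
  exact Finset.finite_toSet _

lemma mult_ofMult (hm : IsMult m) (hx : x ∈ V) (hy : y ∈ V) : (ofMult m V).mult x y = m x y := by
  rw [mult, setOf_isLink_ofMult hm hx hy, Set.ncard_coe_finset, Finset.card_image_of_injective,
    Finset.card_range]
  exact fun i j hij => (Nat.pair_eq_pair.1 hij).2

lemma loopless_ofMult (hm : IsMult m) : (ofMult m V).Loopless where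
  not_isLoopAt e x h := by
    obtain ⟨-, -, i, hi, -⟩ := h
    rw [min_self, max_self, hm.self] at hi
    exact Nat.not_lt_zero _ hi

/-- Only two consequences of a coloring are needed for the lower bound: parallel edges cannot lie
inside a part, and degrees in `M` are bounded. Longer cycles play no role. -/
lemma weakColoring_of_isDFFColoring (hm : IsMult m) {M F : Set ℕ}
    (h : (ofMult m V).IsDFFColoring D M F) : ∃ M, WeakColoring D m V M := by
  classical
  have hMF : M ∪ F = V := h.union_eq
  set M' := V.filter fun x => x ∈ M with hM'
  have hMM : (M' : Set ℕ) = M := by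
    ext x
    simp only [hM', Finset.coe_filter, Set.mem_ofPred_eq, and_iff_right_iff_imp]
    intro hx
    have : x ∈ (V : Set ℕ) := hMF ▸ Or.inl hx
    exact this
  have hsimple : ∀ S : Set ℕ, ((ofMult m V).induce S).IsForest → ∀ x ∈ V, ∀ y ∈ V, x ∈ S → y ∈ S →
      m x y ≤ 1 := by
    intro S hS x hx y hy hxS hyS
    rw [← mult_ofMult hm hx hy, mult, Set.ncard_le_one (finite_isLink_ofMult hm hx hy)]
    exact fun e he f hf => hS.1.eq_of_isLink ⟨he, hxS, hyS⟩ ⟨hf, hxS, hyS⟩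
  refine ⟨M', fun x hx y hy hxy => ⟨fun hxM hyM => ?_, fun hyM => ?_⟩, fun x hx hxM => ?_⟩
  · have := hsimple M h.isForest_left x hx y hy (Finset.mem_filter.1 hxM).2
      (Finset.mem_filter.1 hyM).2
    omega
  · by_contra hxM
    have key : ∀ z ∈ V, z ∉ M' → z ∈ F := fun z hz hzM => by
      have : z ∈ M ∪ F := hMF ▸ hz
      exact this.resolve_left fun h' => hzM (Finset.mem_filter.2 ⟨hz, h'⟩)
    have := hsimple F h.isForest_right x hx y hy (key x hx hxM) (key y hy hyM)
    omega
  · have hMV : M' ⊆ V := Finset.filter_subset _ _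
    have := h.degree_le x (Finset.mem_filter.1 hxM).2
    rw [← hMM, degree_induce (loopless_ofMult hm) hxM fun y hy =>
      finite_isLink_ofMult hm hx (hMV hy)] at this
    rw [Finset.inter_eq_right.2 hMV, ← deg_congr fun y hy => mult_ofMult hm hx (hMV hy)]
    exact_mod_cast this

/-- Large multigraphs without coloring that violate the sparsity bound only on the whole vertex
set, and there by the least possible amount. -/
theorem exists_not_hasDFFColoring (D N : ℕ) :
    ∃ H : Graph ℕ ℕ, V(H).Finite ∧ E(H).Finite ∧ H.Loopless ∧ N ≤ V(H).ncard ∧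
      ¬ H.HasDFFColoring D ∧
      (E(H).ncard : ℝ) = ((4 * (D : ℝ) + 3) * V(H).ncard + 2) / (2 * ((D : ℝ) + 1)) ∧
      ∀ A : Finset ℕ, (A : Set ℕ) ⊂ V(H) → 2 ≤ A.card →
        (E(H.induce (A : Set ℕ)).ncard : ℝ) ≤
          (4 * (D : ℝ) + 3) / (2 * ((D : ℝ) + 1)) * A.card + 1 / (2 * ((D : ℝ) + 1)) := by
  obtain ⟨m, V, hm, hN, hV, hA, hno⟩ := exists_not_weakColoring (α := ℕ) D N
  have hl : (ofMult m V).Loopless := loopless_ofMult hm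
  have hind : (ofMult m V).induce (V : Set ℕ) = ofMult m V := induce_vertexSet _
  obtain ⟨h1, h2⟩ := finite_and_two_mul_ncard_eq_total (A := V) hl fun x hx y hy =>
    finite_isLink_ofMult hm hx hy
  rw [hind] at h1 h2
  have hcard : V(ofMult m V).ncard = V.card := Set.ncard_coe_finset V
  have hpot : ∀ A ⊆ V, freePot D (ofMult m V).mult A = freePot D m A := fun A hA =>
    pot_congr_mult fun x hx y hy => mult_ofMult hm (hA hx) (hA hy)
  refine ⟨ofMult m V, V.finite_toSet, h1, hl, hN.trans_eq hcard.symm, ?_, ?_, fun A hAV _ => ?_⟩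
  · rintro ⟨M, F, h⟩
    obtain ⟨M', hM'⟩ := weakColoring_of_isDFFColoring hm h
    exact hno M' hM'
  · rw [← hpot V subset_rfl, freePot, pot, ← h2] at hV
    simp only [weight_of_true, Finset.sum_const, nsmul_eq_mul] at hV
    have hV' := congrArg (Int.cast (R := ℝ)) hV
    push_cast at hV'
    rw [hcard, eq_div_iff (by positivity)]
    linarith
  · have hAV' : A ⊂ V := by exact_mod_cast hAV
    rw [ncard_le_iff hl fun x hx y hy =>
      finite_isLink_ofMult hm (hAV'.subset hx) (hAV'.subset hy), ← freePot, hpot A hAV'.subset]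
    exact hA A hAV'

/-- Neither of the parameters `a_D` and `b_D` can be relaxed. -/
theorem exists_isSparse_not_hasDFFColoring {a b : ℝ}
    (ha : (4 * (D : ℝ) + 3) / (2 * ((D : ℝ) + 1)) ≤ a) (hb : 1 / (2 * ((D : ℝ) + 1)) ≤ b)
    (hab : (4 * (D : ℝ) + 3) / (2 * ((D : ℝ) + 1)) < a ∨ 2 / (2 * ((D : ℝ) + 1)) ≤ b) :
    ∃ H : Graph ℕ ℕ, V(H).Finite ∧ H.IsSparse a b ∧ ¬ H.HasDFFColoring D := by
  set a₀ := (4 * (D : ℝ) + 3) / (2 * ((D : ℝ) + 1)) with ha₀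
  set b₀ := 1 / (2 * ((D : ℝ) + 1)) with hb₀
  have hb2 : 2 / (2 * ((D : ℝ) + 1)) = 2 * b₀ := by rw [hb₀]; ring
  -- Only the whole vertex set exceeds the bound, by `b₀`. A larger slope absorbs this as soon as `n
  -- ≥ b₀ / (a - a₀)`; if `b ≥ 2 * b₀`, every `n` will do.
  obtain ⟨N, hN⟩ : ∃ N : ℕ, ∀ n : ℕ, N ≤ n → a₀ * n + 2 * b₀ ≤ a * n + b := by
    rcases hab with hlt | hle
    · obtain ⟨N, hN⟩ := exists_nat_ge (b₀ / (a - a₀))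
      refine ⟨N, fun n hn => ?_⟩
      have h1 : b₀ / (a - a₀) ≤ n := hN.trans (by exact_mod_cast hn)
      rw [div_le_iff₀ (sub_pos.2 hlt)] at h1
      linarith
    · refine ⟨0, fun n _ => ?_⟩
      rw [hb2] at hle
      have := mul_le_mul_of_nonneg_right ha (Nat.cast_nonneg (α := ℝ) n)
      linarith
  obtain ⟨H, hV, hE, hl, hn, hno, he, hA⟩ := exists_not_hasDFFColoring D N
  refine ⟨H, hV, ⟨hl, fun A hAV h2 => ⟨hE.subset ?_, ?_⟩⟩, hno⟩
  · rintro e ⟨x, y, h⟩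
    exact h.1.edge_mem
  · by_cases hAe : (A : Set ℕ) = V(H)
    · rw [hAe, induce_vertexSet, he]
      have h3 := hN _ hn
      rw [← hAe, Set.ncard_coe_finset] at h3 ⊢
      refine le_trans (le_of_eq ?_) h3
      rw [ha₀, hb₀]
      ring
    · have h3 := hA A (lt_of_le_of_ne hAV hAe) h2
      have := mul_le_mul_of_nonneg_right ha (Nat.cast_nonneg (α := ℝ) A.card)
      linarith

end Graph

/-! ### The main theorem -/

theorem mainTheorem5 (D : ℕ) (hD : 1 ≤ D) :
    -- every sparse multigraph has a coloring
    (∀ (α : Type u) (β : Type v) (G : Graph α β), V(G).Finite →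
      G.IsSparse ((4 * (D : ℝ) + 3) / (2 * ((D : ℝ) + 1))) (1 / (2 * ((D : ℝ) + 1))) →
      G.HasDFFColoring D) ∧
    -- arbitrarily large non-colorable multigraphs that violate the sparsity bound only on the
    -- whole vertex set, and there by the least possible amount
    (∀ N : ℕ, ∃ H : Graph ℕ ℕ, V(H).Finite ∧ E(H).Finite ∧ H.Loopless ∧ N ≤ V(H).ncard ∧
      ¬ H.HasDFFColoring D ∧
      (E(H).ncard : ℝ) = ((4 * (D : ℝ) + 3) * V(H).ncard + 2) / (2 * ((D : ℝ) + 1)) ∧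
      ∀ A : Finset ℕ, (A : Set ℕ) ⊂ V(H) → 2 ≤ A.card →
        (E(H.induce (A : Set ℕ)).ncard : ℝ) ≤
          (4 * (D : ℝ) + 3) / (2 * ((D : ℝ) + 1)) * A.card + 1 / (2 * ((D : ℝ) + 1))) ∧
    -- neither parameter can be relaxed
    (∀ a b : ℝ, (4 * (D : ℝ) + 3) / (2 * ((D : ℝ) + 1)) ≤ a → 1 / (2 * ((D : ℝ) + 1)) ≤ b →
      ((4 * (D : ℝ) + 3) / (2 * ((D : ℝ) + 1)) < a ∨ 2 / (2 * ((D : ℝ) + 1)) ≤ b) →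
      ∃ H : Graph ℕ ℕ, V(H).Finite ∧ H.IsSparse a b ∧ ¬ H.HasDFFColoring D) := by
  classical
  exact ⟨fun _ _ _ hV hG => Graph.hasDFFColoring_of_isSparse hD hV hG,
    Graph.exists_not_hasDFFColoring D, fun _ _ => Graph.exists_isSparse_not_hasDFFColoring⟩
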